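/- Let $\Omega\subset\mathbb C$ be open and let $V\in SH_0(\Omega)$, that is, $V:\Omega\to[-\infty,\infty)$ is subharmonic (upper semicontinuous, satisfying the sub-mean value inequality, and not identically $-\infty$ on any connected component of $\Omega$) and the support $K=\operatorname{supp}\Delta V$ of its distributional Laplacian has Lebesgue measure $0$. Suppose that $\partial V/\partial z$ is piecewise holomorphic with respect to holomorphic functions $g_1,\dots,g_k$ on $\Omega$, that is, on each connected component of $\Omega\setminus K$ the distribution derivative $\partial V/\partial z=\frac12(\partial V/\partial x-i\,\partial V/\partial y)$ equals some $g_j$. For an open set $N\subset\Omega$ and finitely many harmonic functions $h_1,\dots,h_n$ on $N$, call $V|_N$ piecewise harmonic with respect to $h_1,\dots,h_n$ if $V|_N\in SH_0(N)$ and on each connected component of $N\setminus\operatorname{supp}\Delta(V|_N)$ the function $V$ equals some $h_j$. Then for each simply connected open set $U\subset\Omega$ there are harmonic functions $H_1,\dots,H_k$ on $U$ with $\partial H_i/\partial z=g_i$ in $U$ for $1\le i\le k$, such that for each open set $U_0$ that is relatively compact in $U$ there are finitely many real constants $c_1,\dots,c_m$ (depending on $U_0$) for which $V|_{U_0}$ is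 piecewise harmonic with respect to a subfamily of the $m\cdot k$ functions $H_i+c_\nu$, $1\le i\le k$, $1\le\nu\le m$. In particular, $V$ is locally piecewise harmonic: every point of $\Omega$ has an open neighbourhood $N\subset\Omega$ such that $V|_N$ is piecewise harmonic with respect to finitely many harmonic functions on $N$. -/

import Mathlib

open scoped Distributions
open MeasureTheory TopologicalSpace InnerProductSpace

/-- The mean value of an extended-real function `V` over the circle `|z - c| = r`: the mean of the
positive part minus the mean of the negative part. For an upper semicontinuous `V < ∞` the first of
these is finite, so that the difference is the usual integral mean with values in `[-∞, ∞)`. -/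
noncomputable def circleMeanEReal (V : ℂ → EReal) (c : ℂ) (r : ℝ) : EReal :=
  ((laverage (volume.restrict (Set.Ioc 0 (2 * Real.pi)))
      (fun θ : ℝ => (V (circleMap c r θ)).toENNReal) : ENNReal) : EReal) -
    ((laverage (volume.restrict (Set.Ioc 0 (2 * Real.pi)))
      (fun θ : ℝ => (-V (circleMap c r θ)).toENNReal) : ENNReal) : EReal)

/-- Subharmonic functions on an open set `Ω ⊆ ℂ`: upper semicontinuous functions with values in
`[-∞, ∞)`, not identically `-∞` on any connected component of `Ω`, that satisfy the sub-mean value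
inequality on every closed disc contained in `Ω`. -/
structure IsSubharmonic (V : ℂ → EReal) (Ω : Opens ℂ) : Prop where
  upperSemicontinuousOn : UpperSemicontinuousOn V (Ω : Set ℂ)
  ne_top : ∀ z ∈ Ω, V z ≠ ⊤
  exists_ne_bot : ∀ z ∈ Ω, ∃ w ∈ connectedComponentIn (Ω : Set ℂ) z, V w ≠ ⊥
  le_circleMean : ∀ (c : ℂ) (r : ℝ), 0 < r → Metric.closedBall c r ⊆ (Ω : Set ℂ) →
    V c ≤ circleMeanEReal V c r

/-- The distributional Laplacian of `V` in `Ω`, as a functional on real test functions: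
`φ ↦ ∫ V Δφ`. (Subharmonic functions are locally integrable; in particular the set where such a
function is `-∞` is Lebesgue null.) -/
noncomputable def distribLaplacian (V : ℂ → EReal) (Ω : Opens ℂ) (φ : 𝓓(Ω, ℝ)) : ℝ :=
  ∫ z, (V z).toReal * Laplacian.laplacian (φ : ℂ → ℝ) z

/-- The support `supp Δ(V)` of the distributional Laplacian, a relatively closed subset of `Ω`. -/
def suppLaplacian (V : ℂ → EReal) (Ω : Opens ℂ) : Set ℂ :=
  (Ω : Set ℂ) ∩ Distribution.dsupport (distribLaplacian V Ω)

/-- The class `SH₀(Ω)`: subharmonic functions in `Ω` such that the support of the Laplacian has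
Lebesgue measure zero. -/
structure IsSH0 (V : ℂ → EReal) (Ω : Opens ℂ) : Prop where
  isSubharmonic : IsSubharmonic V Ω
  volume_suppLaplacian : volume (suppLaplacian V Ω) = 0

/-- The classical Wirtinger derivative `∂f/∂z = (∂f/∂x - i ∂f/∂y) / 2` of a real function. -/
noncomputable def wirtingerDz (f : ℂ → ℝ) (z : ℂ) : ℂ :=
  (1 / 2 : ℂ) * ((fderiv ℝ f z 1 : ℂ) - Complex.I * (fderiv ℝ f z Complex.I : ℂ))

/-- The distribution derivative `∂V/∂z` coincides with the function `g` in the open set `W ⊆ Ω`: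
`∫ g φ = - ∫ V ∂φ/∂z` for all test functions `φ` supported in `W`. -/
def HasDistribDz (V : ℂ → EReal) (Ω : Opens ℂ) (g : ℂ → ℂ) (W : Set ℂ) : Prop :=
  ∀ φ : 𝓓(Ω, ℝ), tsupport (φ : ℂ → ℝ) ⊆ W →
    ∫ z, g z * (φ z : ℂ) = - ∫ z, ((V z).toReal : ℂ) * wirtingerDz (φ : ℂ → ℝ) z

/-- `∂V/∂z` is piecewise holomorphic in `Ω` with respect to the family `g`: the `g j` are
holomorphic in `Ω` and in each connected component of `Ω ∖ supp Δ(V)` the derivative `∂V/∂z`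
equals one of them. -/
structure IsPiecewiseHolomorphicDz {ι : Type*} (V : ℂ → EReal) (Ω : Opens ℂ) (g : ι → ℂ → ℂ) :
    Prop where
  differentiableOn : ∀ j, DifferentiableOn ℂ (g j) (Ω : Set ℂ)
  exists_eq : ∀ z ∈ (Ω : Set ℂ) \ suppLaplacian V Ω, ∃ j,
    HasDistribDz V Ω (g j) (connectedComponentIn ((Ω : Set ℂ) \ suppLaplacian V Ω) z)

/-- `V` is piecewise harmonic in `Ω` with respect to the finite family `H`: it belongs to
`SH₀(Ω)`, the `H j` are harmonic in `Ω`, and in each connected component of `Ω ∖ supp Δ(V)` the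
function `V` equals one of them. -/
structure IsPiecewiseHarmonic {ι : Type*} [Finite ι] (V : ℂ → EReal) (Ω : Opens ℂ)
    (H : ι → ℂ → ℝ) : Prop where
  isSH0 : IsSH0 V Ω
  harmonic : ∀ j, HarmonicOnNhd (H j) (Ω : Set ℂ)
  exists_eq : ∀ z ∈ (Ω : Set ℂ) \ suppLaplacian V Ω, ∃ j,
    ∀ w ∈ connectedComponentIn ((Ω : Set ℂ) \ suppLaplacian V Ω) z, V w = (H j w : EReal)

/-! Let `Φ i` be a primitive of `2 * g i` on a simply connected `U`. Since `∂(Re Φ)/∂z = Φ'/2`, the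
candidates are `H i = Re (Φ i)`. On a component of the complement of `supp ΔV` in `U₀`, the
difference `V - Re (Φ j)` has zero distributional gradient for some `j`, hence is a constant. There
may be infinitely many components, so the content of the theorem is that near each point only
finitely many constants occur (`IsPiecewiseRe.exists_finite_const`); compactness then finishes the
proof.

Regularity. A bound for the gradient off a null set does not by itself control a function (Cantor
functions), so subharmonicity has to be used. The function `E = exp V` is bounded and subharmonic,
and off a null set its classical gradient is at most `L * E`. An energy estimate
(`exists_energy_bound`) bounds the difference quotients of `E` in `L²`, so the classical gradient is
the weak one (`integral_mul_fderiv_eq_neg`). Gronwall's inequality for mollifications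
(`exists_null_le_exp_mul`) bounds `E z / E w` by `exp (L ‖z - w‖)`, so `V` is finite and locally
Lipschitz (`IsSubharmonic.exists_isPiecewiseRe`).

Semiconvexity. Near a point where any two of the `deriv (Φ j)` either coincide locally or differ, a
generic direction orders the slopes of the branches. The maximum principle then shows that `V` can
leave a branch along such a line only upwards (`le_of_agreesNear_line`). Hence second differences of
`V` are at least `-O(t²)`, so `V` plus a multiple of `‖z‖²` is convex, and the gradients of its
branches are monotone up to a quadratic error (`gradient_monotone`).

Paths. Along a curve on which every `Re (Φ l - Φ i)` with `Φ l' ≠ Φ i'` is strictly monotone,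
semiconvexity prevents `V - Re (Φ i)` from ceasing to increase once it has begun to. So `V` cannot
come back to the branch `i` with a larger constant, nor, by reversing the curve, with a smaller one
(`const_eq_of_path`). If infinitely many constants occurred near `p`, there would be points tending
to `p` with distinct constants. The zero sets of the functions `Re (Φ l - Φ i)`, normalized to
vanish at `p`, are finitely many analytic arcs near `p`. Two of the points lie in the same gap
between arcs and are joined by a curve of the above kind (`exists_monotonePath`), a contradiction.
-/

/-! ### Primitives on simply connected domains, by lifting to the covering of germs. -/

/-- The complex numbers with the discrete topology, the fibre of the covering of germs of
primitives. -/
@[ext]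
structure DiscreteComplex where
  /-- The underlying complex number. -/
  val : ℂ

instance : TopologicalSpace DiscreteComplex := ⊥

instance : DiscreteTopology DiscreteComplex := ⟨rfl⟩

/-- Two primitives of the same function on balls differ by a constant on the intersection. -/
theorem primitive_sub_const_on_inter_balls {g F₁ F₂ : ℂ → ℂ} {a b : ℂ} {r s : ℝ}
    (h₁ : ∀ z ∈ Metric.ball a r, HasDerivAt F₁ (g z) z)
    (h₂ : ∀ z ∈ Metric.ball b s, HasDerivAt F₂ (g z) z) :
    ∃ c : ℂ, ∀ z ∈ Metric.ball a r ∩ Metric.ball b s, F₁ z - F₂ z = c := by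
  rcases (Metric.ball a r ∩ Metric.ball b s).eq_empty_or_nonempty with he | ⟨w, hw⟩
  · exact ⟨0, fun z hz => by simp [he] at hz⟩
  refine ⟨F₁ w - F₂ w, fun z hz => ?_⟩
  have hconv : Convex ℝ (Metric.ball a r ∩ Metric.ball b s) :=
    (convex_ball a r).inter (convex_ball b s)
  refine hconv.is_const_of_fderivWithin_eq_zero (𝕜 := ℂ) (f := fun z => F₁ z - F₂ z) ?_ ?_ hz hw
  · intro x hx
    exact ((h₁ x hx.1).sub (h₂ x hx.2)).differentiableAt.differentiableWithinAt
  · intro x hx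
    have hd : HasDerivAt (fun z => F₁ z - F₂ z) 0 x :=
      ((h₁ x hx.1).sub (h₂ x hx.2)).congr_deriv (sub_self _)
    have ho : IsOpen (Metric.ball a r ∩ Metric.ball b s) :=
      Metric.isOpen_ball.inter Metric.isOpen_ball
    rw [fderivWithin_of_isOpen ho hx]
    simpa using hd.hasFDerivAt.fderiv

/-- A holomorphic function on a simply connected open set has a primitive. -/
theorem exists_primitive_of_isSimplyConnected {U : Set ℂ} (hUo : IsOpen U)
    (hU : IsSimplyConnected U) {g : ℂ → ℂ} (hg : DifferentiableOn ℂ g U) :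
    ∃ G : ℂ → ℂ, ∀ z ∈ U, HasDerivAt G (g z) z := by
  classical
  have := hU.simplyConnectedSpace
  have := hUo.locallyPathConnectedSpace
  have hball : ∀ x : U, ∃ r : ℝ, 0 < r ∧ Metric.ball (x : ℂ) r ⊆ U := fun x =>
    Metric.isOpen_iff.1 hUo x x.2
  choose r hr0 hrU using hball
  have hprim : ∀ x : U, ∃ F : ℂ → ℂ, ∀ z ∈ Metric.ball (x : ℂ) (r x), HasDerivAt F (g z) z :=
    fun x => (hg.mono (hrU x)).isExactOn_ball
  choose F hF using hprim
  -- The coordinate `v` in the chart `i` stands for the germ of the primitive `F i + v`; the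
  -- coordinate change keeps this germ fixed. It is locally constant in `x` because two primitives
  -- differ by a constant on the intersection of two balls.
  let Z : FiberBundleCore U U DiscreteComplex :=
    { baseSet := fun i => {x | (x : ℂ) ∈ Metric.ball (i : ℂ) (r i)}
      isOpen_baseSet := fun i => Metric.isOpen_ball.preimage continuous_subtype_val
      indexAt := id
      mem_baseSet_at := fun x => Metric.mem_ball_self (hr0 x)
      coordChange := fun i j x v => ⟨v.val + (F i x - F j x)⟩
      coordChange_self := fun i x _ v => by
        ext
        simp
      continuousOn_coordChange := by
        intro i j
        obtain ⟨c, hc⟩ := primitive_sub_const_on_inter_balls (hF i) (hF j)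
        have hcont : Continuous (fun p : U × DiscreteComplex =>
            (⟨p.2.val + c⟩ : DiscreteComplex)) :=
          (continuous_of_discreteTopology
            (f := fun v : DiscreteComplex => (⟨v.val + c⟩ : DiscreteComplex))).comp
            continuous_snd
        refine hcont.continuousOn.congr ?_
        rintro ⟨x, v⟩ hx
        simp only
        rw [hc x ⟨hx.1.1, hx.1.2⟩]
      coordChange_comp := fun i j k x _ v => by
        ext
        simp only
        ring }
  have hcov : IsCoveringMap (Bundle.TotalSpace.proj : Z.TotalSpace → U) :=
    FiberBundle.isCoveringMap (F := DiscreteComplex) (E := Z.Fiber)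
  obtain ⟨x₀, hx₀⟩ := hU.nonempty
  -- Lifting the identity of the simply connected `U` gives a global continuous choice of germs.
  obtain ⟨s, ⟨-, hs⟩, -⟩ := hcov.existsUnique_continuousMap_lifts (ContinuousMap.id U)
    ⟨x₀, hx₀⟩ (⟨⟨x₀, hx₀⟩, (⟨0⟩ : DiscreteComplex)⟩ : Z.TotalSpace) rfl
  have hs' : ∀ x : U, (s x).proj = x := fun x => congrFun hs x
  let v : U → U → ℂ := fun i x => ((Z.localTriv i (s x)).2 : DiscreteComplex).val
  have hv : ∀ i x, v i x = DiscreteComplex.val (s x).2 + (F x x - F i x) := by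
    intro i x
    have h1 : Z.localTriv i (s x) =
        ((s x).proj, Z.coordChange (Z.indexAt (s x).proj) i (s x).proj (s x).2) :=
      rfl
    change ((Z.localTriv i (s x)).2 : DiscreteComplex).val = _
    rw [h1]
    change DiscreteComplex.val (s x).2 + (F (s x).proj (s x).proj - F i (s x).proj) = _
    rw [hs' x]
  let G : ℂ → ℂ := fun z =>
    if hz : z ∈ U then DiscreteComplex.val (s ⟨z, hz⟩).2 + F ⟨z, hz⟩ z else 0
  refine ⟨G, fun z hz => ?_⟩
  let i : U := ⟨z, hz⟩
  -- The fibre is discrete, so the coordinate of the section in a fixed chart is locally constant;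
  -- near `z` the function `G` is therefore `F i` plus a constant.
  have hcontv : ∀ᶠ x in nhds i, v i x = v i i := by
    have hmem : s i ∈ (Z.localTriv i).source := by
      rw [Z.mem_localTriv_source, hs' i]
      exact Metric.mem_ball_self (hr0 i)
    have h1 : ContinuousAt (fun x => (Z.localTriv i (s x)).2) i :=
      continuous_snd.continuousAt.comp
        (((Z.localTriv i).continuousOn.continuousAt
          ((Z.localTriv i).open_source.mem_nhds hmem)).comp s.continuous.continuousAt)
    have h2 := h1.eventually (show ∀ᶠ y in nhds ((Z.localTriv i (s i)).2 : DiscreteComplex),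
      y = (Z.localTriv i (s i)).2 by simp [nhds_discrete])
    filter_upwards [h2] with x hx
    exact congrArg DiscreteComplex.val hx
  have hev : G =ᶠ[nhds z] fun w => v i i + F i w := by
    have h3 : ∀ᶠ w in nhds z, ∀ hw : w ∈ U, v i ⟨w, hw⟩ = v i i := by
      rw [nhds_subtype_eq_comap, Filter.eventually_comap] at hcontv
      filter_upwards [hcontv] with w hw hwU
      exact hw ⟨w, hwU⟩ rfl
    filter_upwards [h3, hUo.mem_nhds hz] with w hw hwU
    have h4 := hw hwU
    rw [hv i ⟨w, hwU⟩] at h4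
    simp only [G, hwU, dite_true]
    rw [← h4]
    ring
  exact ((hF i z (Metric.mem_ball_self (hr0 i))).const_add (v i i)).congr_of_eventuallyEq hev

/-! ### Curves near the origin along which finitely many harmonic functions are strictly monotone.
-/

open Filter Topology in
/-- A real analytic function vanishing at `0` is, to the right of `0`, either identically zero or
of constant sign together with its derivative. -/
theorem AnalyticAt.sign_trichotomy {f : ℝ → ℝ} (hf : AnalyticAt ℝ f 0) (h0 : f 0 = 0) :
    ∀ᶠ ε in 𝓝[>] (0 : ℝ), (∀ x ∈ Set.Ioo 0 ε, f x = 0 ∧ deriv f x = 0) ∨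
      (∀ x ∈ Set.Ioo 0 ε, 0 < f x ∧ 0 < deriv f x) ∨
      (∀ x ∈ Set.Ioo 0 ε, f x < 0 ∧ deriv f x < 0) := by
  have han : ∀ᶠ x in 𝓝 (0 : ℝ), AnalyticAt ℝ f x := hf.eventually_analyticAt
  obtain ⟨δ, hδ, hδan⟩ := Metric.eventually_nhds_iff.1 han
  -- The zeros of the analytic function `deriv f` do not accumulate at `0` unless it vanishes near
  -- `0`. The sign of the derivative passes to `f` by the mean value theorem, as `f 0 = 0`.
  have hgood : ∃ δ' > 0, δ' ≤ δ ∧ ((∀ x ∈ Set.Ioo 0 δ', deriv f x = 0) ∨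
      (∀ x ∈ Set.Ioo 0 δ', deriv f x ≠ 0)) := by
    rcases hf.deriv.eventually_eq_zero_or_eventually_ne_zero with h | h
    · obtain ⟨δ', hδ', h'⟩ := Metric.eventually_nhds_iff.1 h
      refine ⟨min δ δ', lt_min hδ hδ', min_le_left _ _, Or.inl fun x hx => h' ?_⟩
      rw [Real.dist_eq, sub_zero, abs_of_pos hx.1]
      exact hx.2.trans_le (min_le_right _ _)
    · rw [eventually_nhdsWithin_iff] at h
      obtain ⟨δ', hδ', h'⟩ := Metric.eventually_nhds_iff.1 h
      refine ⟨min δ δ', lt_min hδ hδ', min_le_left _ _, Or.inr fun x hx => h' ?_ hx.1.ne'⟩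
      rw [Real.dist_eq, sub_zero, abs_of_pos hx.1]
      exact hx.2.trans_le (min_le_right _ _)
  obtain ⟨δ', hδ', hle, hcase⟩ := hgood
  have hdiff : ∀ x, |x| < δ' → DifferentiableAt ℝ f x := fun x hx =>
    (hδan (by rw [Real.dist_eq, sub_zero]; exact hx.trans_le hle)).differentiableAt
  have hmvt : ∀ x ∈ Set.Ioo 0 δ', ∃ y ∈ Set.Ioo 0 x, f x = deriv f y * x := by
    intro x hx
    obtain ⟨y, hy, hyx⟩ := exists_deriv_eq_slope f hx.1
      (fun t ht => (hdiff t (by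
        rw [abs_of_nonneg ht.1]; exact ht.2.trans_lt hx.2)).continuousAt.continuousWithinAt)
      (fun t ht => (hdiff t (by
        rw [abs_of_pos ht.1]; exact ht.2.trans hx.2)).differentiableWithinAt)
    refine ⟨y, hy, ?_⟩
    rw [hyx, h0, sub_zero, sub_zero, div_mul_cancel₀ _ hx.1.ne']
  filter_upwards [Ioo_mem_nhdsGT hδ'] with ε hε
  have hsub : ∀ x ∈ Set.Ioo 0 ε, x ∈ Set.Ioo 0 δ' := fun x hx => ⟨hx.1, hx.2.trans hε.2⟩
  have hsub' : ∀ x ∈ Set.Ioo 0 δ', ∀ y ∈ Set.Ioo 0 x, y ∈ Set.Ioo 0 δ' :=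
    fun x hx y hy => ⟨hy.1, hy.2.trans hx.2⟩
  rcases hcase with hz | hnz
  · left
    intro x hx
    refine ⟨?_, hz x (hsub x hx)⟩
    obtain ⟨y, hy, hxy⟩ := hmvt x (hsub x hx)
    rw [hxy, hz y (hsub' x (hsub x hx) y hy), zero_mul]
  · right
    have hcont : ContinuousOn (deriv f) (Set.Ioo 0 δ') := fun x hx =>
      ((hδan (by
        rw [Real.dist_eq, sub_zero, abs_of_pos hx.1]; exact hx.2.trans_le hle)).deriv.continuousAt
        ).continuousWithinAt
    have hsign : (∀ x ∈ Set.Ioo 0 δ', 0 < deriv f x) ∨ (∀ x ∈ Set.Ioo 0 δ', deriv f x < 0) := by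
      by_contra hcon
      push Not at hcon
      obtain ⟨⟨x, hx, hx'⟩, y, hy, hy'⟩ := hcon
      have hpre : IsPreconnected (Set.Ioo 0 δ') := isPreconnected_Ioo
      obtain ⟨w, hw, hw0⟩ := hpre.intermediate_value hx hy hcont ⟨hx', hy'⟩
      exact hnz w hw hw0
    rcases hsign with hp | hn
    · left
      intro x hx
      refine ⟨?_, hp x (hsub x hx)⟩
      obtain ⟨y, hy, hxy⟩ := hmvt x (hsub x hx)
      rw [hxy]
      exact mul_pos (hp y (hsub' x (hsub x hx) y hy)) hx.1
    · right
      intro x hx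
      refine ⟨?_, hn x (hsub x hx)⟩
      obtain ⟨y, hy, hxy⟩ := hmvt x (hsub x hx)
      rw [hxy]
      exact mul_neg_of_neg_of_pos (hn y (hsub' x (hsub x hx) y hy)) hx.1

open Filter Topology in
/-- The derivative of `z ^ (N + 1) * e z` is of the form `z ^ N * e₁ z`. -/
theorem eventually_deriv_eq_pow_mul {F e : ℂ → ℂ} {N : ℕ} (he : AnalyticAt ℂ e 0)
    (hF : ∀ᶠ z in 𝓝 0, F z = z ^ (N + 1) * e z) :
    ∃ e₁ : ℂ → ℂ, AnalyticAt ℂ e₁ 0 ∧ e₁ 0 = (N + 1) * e 0 ∧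
      ∀ᶠ z in 𝓝 0, deriv F z = z ^ N * e₁ z := by
  refine ⟨fun z => (N + 1) * e z + z * deriv e z, ?_, by simp, ?_⟩
  · exact (analyticAt_const.mul he).add (analyticAt_id.mul he.deriv)
  · filter_upwards [hF.eventually_nhds, he.eventually_analyticAt] with z hz hez
    have h1 : F =ᶠ[𝓝 z] fun w => w ^ (N + 1) * e w := hz
    rw [h1.deriv_eq]
    have h2 : HasDerivAt (fun w : ℂ => w ^ (N + 1) * e w)
        (((N + 1 : ℕ) : ℂ) * z ^ N * e z + z ^ (N + 1) * deriv e z) z :=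
      ((hasDerivAt_pow (N + 1) z).mul hez.differentiableAt.hasDerivAt).congr_deriv (by simp)
    rw [h2.deriv]
    push_cast
    ring

open Filter Topology in
/-- Sign of the real part of `F z * d * (1 + i κ)` in a thin sector around the positive real axis,
for a function `F z = z ^ N * e z`. -/
theorem exists_thin_sector_pos {F e : ℂ → ℂ} {N : ℕ} (he : ContinuousAt e 0)
    (hF : ∀ᶠ z in 𝓝 0, F z = z ^ N * e z) {d : ℂ} {s : ℝ} (hs : 0 < s * (e 0 * d).re) :
    ∀ᶠ η in 𝓝[>] (0 : ℝ), ∀ x y κ : ℝ, 0 < x → x < η → |y| ≤ η * x → |κ| ≤ η →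
      0 < s * (F (x + Complex.I * y) * d * (1 + Complex.I * κ)).re := by
  -- Writing `z = x (1 + i y / x)` splits off the positive factor `x ^ N`. What remains is a
  -- continuous function of the slope `y / x`, the point `z` and `κ`, positive at the origin.
  let G : ℝ × ℂ × ℝ → ℝ := fun p =>
    s * ((1 + Complex.I * p.1) ^ N * e p.2.1 * d * (1 + Complex.I * p.2.2)).re
  have hG : ContinuousAt G (0, 0, 0) := by
    have h1 : ContinuousAt (fun p : ℝ × ℂ × ℝ => e p.2.1) (0, 0, 0) :=
      ContinuousAt.comp (f := fun p : ℝ × ℂ × ℝ => p.2.1) (g := e) he (by fun_prop)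
    have h2 : ContinuousAt (fun p : ℝ × ℂ × ℝ => (1 + Complex.I * (p.1 : ℂ)) ^ N) (0, 0, 0) := by
      fun_prop
    have h3 : ContinuousAt (fun p : ℝ × ℂ × ℝ => (1 + Complex.I * (p.2.2 : ℂ))) (0, 0, 0) := by
      fun_prop
    have h4 := ((h2.mul h1).mul (continuousAt_const (y := d))).mul h3
    exact continuousAt_const.mul (Complex.continuous_re.continuousAt.comp h4)
  have hG0 : 0 < G (0, 0, 0) := by simpa [G] using hs
  have hev := (hG.eventually (lt_mem_nhds hG0)).and
    ((show ContinuousAt (fun p : ℝ × ℂ × ℝ => p.2.1) (0, 0, 0) by fun_prop).eventually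
      (show ∀ᶠ z in 𝓝 ((0, 0, 0) : ℝ × ℂ × ℝ).2.1, F z = z ^ N * e z from hF))
  obtain ⟨δ, hδ, hδG⟩ := Metric.eventually_nhds_iff.1 hev
  have hδ2 : 0 < min (δ / 2) 1 := lt_min (by linarith) one_pos
  filter_upwards [Ioo_mem_nhdsGT hδ2] with η hη x y κ hx hxη hy hκ
  have hη1 : η < 1 := hη.2.trans_le (min_le_right _ _)
  have hη2 : η < δ / 2 := hη.2.trans_le (min_le_left _ _)
  have hzn : ‖(x : ℂ) + Complex.I * y‖ < δ := by
    calc ‖(x : ℂ) + Complex.I * y‖ ≤ ‖(x : ℂ)‖ + ‖Complex.I * (y : ℂ)‖ := norm_add_le _ _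
      _ = |x| + |y| := by simp
      _ < δ := by rw [abs_of_pos hx]; nlinarith
  have hv : |y / x| < δ := by
    rw [abs_div, abs_of_pos hx, div_lt_iff₀ hx]
    nlinarith
  have hmem : dist ((y / x, (x : ℂ) + Complex.I * y, κ) : ℝ × ℂ × ℝ) (0, 0, 0) < δ := by
    rw [Prod.dist_eq, Prod.dist_eq]
    simp only [dist_zero_right, Real.norm_eq_abs]
    exact max_lt hv (max_lt hzn (by linarith))
  obtain ⟨hpos, hFz⟩ := hδG hmem
  simp only [G] at hpos
  simp only at hFz
  have hfac : F (x + Complex.I * y) * d * (1 + Complex.I * κ) = ((x ^ N : ℝ) : ℂ) *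
      ((1 + Complex.I * ((y / x : ℝ) : ℂ)) ^ N * e (x + Complex.I * y) * d *
        (1 + Complex.I * κ)) := by
    rw [hFz]
    have hxy : (x : ℂ) + Complex.I * y = x * (1 + Complex.I * ((y / x : ℝ) : ℂ)) := by
      have hxC : (x : ℂ) ≠ 0 := by exact_mod_cast hx.ne'
      push_cast
      field_simp
    have hpow : ((x : ℂ) + Complex.I * y) ^ N =
        (x : ℂ) ^ N * (1 + Complex.I * ((y / x : ℝ) : ℂ)) ^ N := by
      rw [hxy, mul_pow]
    rw [hpow]
    push_cast
    ring
  rw [hfac, Complex.re_ofReal_mul]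
  have := mul_pos (pow_pos hx N) hpos
  linarith

open Filter Topology in
/-- If `φ z = z ^ M * e z` with `e 0` purely imaginary, the zero set of `Re φ` contains an analytic
arc tangent to the real axis. -/
theorem exists_zero_branch {φ e : ℂ → ℂ} {M : ℕ} (hM : M ≠ 0) (he : AnalyticAt ℂ e 0)
    (he0 : e 0 ≠ 0) (hre : (e 0).re = 0) (hφ : ∀ᶠ z in 𝓝 0, φ z = z ^ M * e z) :
    ∃ b : ℝ → ℝ, AnalyticAt ℝ b 0 ∧ b 0 = 0 ∧ deriv b 0 = 0 ∧
      ∀ᶠ x in 𝓝 (0 : ℝ), (φ (x + Complex.I * b x)).re = 0 := by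
  set c := e 0 with hc
  -- `ρ` is the holomorphic `M`-th root of `e / c`. In the coordinate `t = z * ρ z` the function
  -- becomes `c * t ^ M`, whose real part vanishes for real `t` because `c` is imaginary. The branch
  -- is the image of the real axis under the inverse coordinate `χ`.
  let ρ : ℂ → ℂ := fun z => Complex.exp (Complex.log (e z / c) / M)
  have hquot : AnalyticAt ℂ (fun z => e z / c) 0 := he.div_const
  have hslit : e 0 / c ∈ Complex.slitPlane := by
    rw [← hc, div_self he0]; exact Complex.one_mem_slitPlane
  have hρ : AnalyticAt ℂ ρ 0 := (hquot.clog hslit).div_const.cexp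
  have hρ0 : ρ 0 = 1 := by simp [ρ, ← hc, div_self he0]
  have hρpow : ∀ᶠ z in 𝓝 (0 : ℂ), ρ z ^ M * c = e z := by
    filter_upwards [he.continuousAt.eventually_ne he0] with z hz
    have hMC : (M : ℂ) ≠ 0 := by exact_mod_cast hM
    simp only [ρ]
    rw [← Complex.exp_nat_mul, mul_div_cancel₀ _ hMC, Complex.exp_log (div_ne_zero hz he0),
      div_mul_cancel₀ _ he0]
  let ψ : ℂ → ℂ := fun z => z * ρ z
  have hψ : AnalyticAt ℂ ψ 0 := analyticAt_id.mul hρ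
  have hψ0 : ψ 0 = 0 := by simp [ψ]
  have hψd : HasDerivAt ψ 1 0 := by
    have := (hasDerivAt_id (0 : ℂ)).mul hρ.differentiableAt.hasDerivAt
    refine this.congr_deriv ?_
    simp [hρ0]
  have hψd' : deriv ψ 0 ≠ 0 := by rw [hψd.deriv]; exact one_ne_zero
  have hψs : HasStrictDerivAt ψ (deriv ψ 0) 0 := hψ.hasStrictDerivAt
  let χ : ℂ → ℂ := hψs.localInverse ψ (deriv ψ 0) 0 hψd'
  have hχ : AnalyticAt ℂ χ 0 := by
    have := hψ.analyticAt_localInverse hψd'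
    rwa [hψ0] at this
  have hχr : ∀ᶠ t in 𝓝 (0 : ℂ), ψ (χ t) = t := by
    have := hψs.eventually_right_inverse (hf' := hψd')
    rwa [hψ0] at this
  have hχ0 : χ 0 = 0 := by
    have := HasStrictFDerivAt.localInverse_apply_image (hψs.hasStrictFDerivAt_equiv hψd')
    rw [hψ0] at this
    exact this
  have hχd : HasDerivAt χ 1 0 := by
    have h1 := (hψs.to_localInverse hψd').hasDerivAt
    rw [hψ0] at h1
    exact h1.congr_deriv (by rw [hψd.deriv, inv_one])
  have hφχ : ∀ᶠ t in 𝓝 (0 : ℂ), φ (χ t) = c * t ^ M := by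
    have hlim : Tendsto χ (𝓝 0) (𝓝 0) := by
      simpa [hχ0] using hχ.continuousAt.tendsto
    filter_upwards [hlim.eventually hφ, hlim.eventually hρpow, hχr] with t h1 h2 h3
    rw [h1, ← h2]
    have h4 : χ t * ρ (χ t) = t := h3
    calc χ t ^ M * (ρ (χ t) ^ M * c) = c * (χ t * ρ (χ t)) ^ M := by rw [mul_pow]; ring
      _ = c * t ^ M := by rw [h4]
  have hχR : AnalyticAt ℝ (fun t : ℝ => χ t) 0 := by
    have h1 : AnalyticAt ℝ χ ((0 : ℝ) : ℂ) := by simpa using hχ.restrictScalars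
    exact h1.comp (Complex.ofRealCLM.analyticAt 0)
  let X : ℝ → ℝ := fun t => (χ t).re
  let Y : ℝ → ℝ := fun t => (χ t).im
  have hX : AnalyticAt ℝ X 0 := (Complex.reCLM.analyticAt _).comp hχR
  have hY : AnalyticAt ℝ Y 0 := (Complex.imCLM.analyticAt _).comp hχR
  have hχRd : HasDerivAt (fun t : ℝ => χ t) 1 0 := by
    have : HasDerivAt χ 1 ((0 : ℝ) : ℂ) := by simpa using hχd
    exact this.comp_ofReal
  have hXd : HasDerivAt X 1 0 :=
    (Complex.reCLM.hasFDerivAt.comp_hasDerivAt (0 : ℝ) hχRd).congr_deriv (by simp)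
  have hYd : HasDerivAt Y 0 0 :=
    (Complex.imCLM.hasFDerivAt.comp_hasDerivAt (0 : ℝ) hχRd).congr_deriv (by simp)
  have hX0 : X 0 = 0 := by simp [X, hχ0]
  have hXd' : deriv X 0 ≠ 0 := by rw [hXd.deriv]; exact one_ne_zero
  have hXs : HasStrictDerivAt X (deriv X 0) 0 := hX.hasStrictDerivAt
  -- Inverting the real part of `t ↦ χ t` turns the arc into a graph over the real axis.
  let ξ : ℝ → ℝ := hXs.localInverse X (deriv X 0) 0 hXd'
  have hξ : AnalyticAt ℝ ξ 0 := by
    have := hX.analyticAt_localInverse hXd'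
    rwa [hX0] at this
  have hξr : ∀ᶠ t in 𝓝 (0 : ℝ), X (ξ t) = t := by
    have := hXs.eventually_right_inverse (hf' := hXd')
    rwa [hX0] at this
  have hξ0 : ξ 0 = 0 := by
    have := HasStrictFDerivAt.localInverse_apply_image (hXs.hasStrictFDerivAt_equiv hXd')
    rw [hX0] at this
    exact this
  have hξlim : Tendsto ξ (𝓝 0) (𝓝 0) := by simpa [hξ0] using hξ.continuousAt.tendsto
  refine ⟨fun x => Y (ξ x), ?_, by simp [Y, hξ0, hχ0], ?_, ?_⟩
  · have : AnalyticAt ℝ Y (ξ 0) := by rwa [hξ0]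
    exact this.comp hξ
  · have h1 : HasDerivAt Y 0 (ξ 0) := by rwa [hξ0]
    have h2 := h1.comp (0 : ℝ) hξ.differentiableAt.hasDerivAt
    exact h2.deriv.trans (by simp)
  · have h5 : ∀ᶠ t : ℝ in 𝓝 0, φ (χ t) = c * (t : ℂ) ^ M := by
      have : Tendsto (fun t : ℝ => (t : ℂ)) (𝓝 0) (𝓝 0) := by
        simpa using Complex.continuous_ofReal.tendsto (0 : ℝ)
      exact this.eventually hφχ
    filter_upwards [hξr, hξlim.eventually h5] with x hx hx5
    have hzx : (x : ℂ) + Complex.I * (Y (ξ x) : ℝ) = χ (ξ x) := by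
      apply Complex.ext
      · simpa [Y] using hx.symm
      · simp [Y]
    rw [hzx, hx5, ← Complex.ofReal_pow, mul_comm, Complex.re_ofReal_mul, hre, mul_zero]

open Filter Topology in
theorem eventually_forall_Ioo_of_eventually_nhds {p : ℝ → Prop} (h : ∀ᶠ x in 𝓝 (0 : ℝ), p x) :
    ∀ᶠ η in 𝓝[>] (0 : ℝ), ∀ x, 0 < x → x < η → p x := by
  obtain ⟨δ, hδ, h⟩ := Metric.eventually_nhds_iff.1 h
  filter_upwards [Ioo_mem_nhdsGT hδ] with η hη x hx hxη
  exact h (by rw [Real.dist_eq, sub_zero, abs_of_pos hx]; exact hxη.trans hη.2)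

theorem HasDerivAt.real_add_I_mul {b : ℝ → ℝ} {b' x : ℝ} (hb : HasDerivAt b b' x) :
    HasDerivAt (fun x : ℝ => (x : ℂ) + Complex.I * b x) (1 + Complex.I * b') x :=
  Complex.ofRealCLM.hasDerivAt.add
    ((Complex.ofRealCLM.hasFDerivAt.comp_hasDerivAt x hb).const_mul Complex.I)

open Filter Topology in
/-- In a thin sector around the positive real axis, either `Re φ` is strictly monotone in all nearly
horizontal directions, or its zero set there is a graph and `Re φ` is strictly monotone along all
nearly horizontal curves which move away from that graph. -/
theorem thin_sector_dichotomy {φ e : ℂ → ℂ} {N : ℕ} (hφa : AnalyticAt ℂ φ 0)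
    (he : AnalyticAt ℂ e 0) (he0 : e 0 ≠ 0) (hφ : ∀ᶠ z in 𝓝 0, φ z = z ^ (N + 2) * e z) :
    (∀ᶠ η in 𝓝[>] (0 : ℝ), ∀ x y κ : ℝ, 0 < x → x < η → |y| ≤ η * x → |κ| ≤ η →
      (deriv φ (x + Complex.I * y) * (1 + Complex.I * κ)).re ≠ 0) ∨
    ∃ b : ℝ → ℝ, AnalyticAt ℝ b 0 ∧ b 0 = 0 ∧ deriv b 0 = 0 ∧
      (∀ᶠ x in 𝓝 (0 : ℝ), (φ (x + Complex.I * b x)).re = 0) ∧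
      ∀ᶠ η in 𝓝[>] (0 : ℝ), ∀ x y κ : ℝ, 0 < x → x < η → |y| ≤ η * x → |κ| ≤ η →
        |b x| ≤ η * x → |deriv b x| ≤ η →
        (b x < y ∧ deriv b x ≤ κ ∨ y < b x ∧ κ ≤ deriv b x) →
        (deriv φ (x + Complex.I * y) * (1 + Complex.I * κ)).re ≠ 0 := by
  obtain ⟨e₁, he₁, he₁0, hd₁⟩ := eventually_deriv_eq_pow_mul (N := N + 1) he hφ
  obtain ⟨e₂, he₂, he₂0, hd₂⟩ := eventually_deriv_eq_pow_mul (N := N) he₁ hd₁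
  by_cases hre : (e 0).re = 0
  · right
    have him : (e 0).im ≠ 0 := fun h => he0 (Complex.ext hre h)
    obtain ⟨b, hb, hb0, hb', hbz⟩ := exists_zero_branch (by omega) he he0 hre hφ
    refine ⟨b, hb, hb0, hb', hbz, ?_⟩
    -- `s` is the real part of `e 0 * I`; multiplying by it makes the vertical derivatives of `Re φ`
    -- and of `Re φ'` positive in the sector. For `φ'` this uses that `φ` vanishes to order at least
    -- two, so that `φ''` is still a power of `z` times a function that does not vanish at `0`.
    set s : ℝ := -(e 0).im with hs
    have hs0 : 0 < s * s := by
      have : s ≠ 0 := by simpa [hs] using him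
      exact mul_self_pos.2 this
    have h1 := exists_thin_sector_pos (d := Complex.I) (s := s) he₁.continuousAt hd₁ (by
      rw [he₁0]
      have : ((((N + 1 : ℕ) : ℂ) + 1) * e 0 * Complex.I).re = ((N : ℝ) + 2) * s := by
        have h : ((((N + 1 : ℕ) : ℂ) + 1)) = (((N : ℝ) + 2 : ℝ) : ℂ) := by push_cast; ring
        rw [h, mul_assoc, Complex.re_ofReal_mul]
        simp [hs]
      rw [this]
      nlinarith [mul_pos (show (0 : ℝ) < (N : ℝ) + 2 by positivity) hs0])
    have h2 := exists_thin_sector_pos (d := Complex.I) (s := s) he₂.continuousAt hd₂ (by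
      rw [he₂0, he₁0]
      have : (((N : ℂ) + 1) * ((((N + 1 : ℕ) : ℂ) + 1) * e 0) * Complex.I).re =
          (((N : ℝ) + 1) * ((N : ℝ) + 2)) * s := by
        have h : (((N : ℂ) + 1) * ((((N + 1 : ℕ) : ℂ) + 1) * e 0) * Complex.I) =
          ((((N : ℝ) + 1) * ((N : ℝ) + 2) : ℝ) : ℂ) * (e 0 * Complex.I) := by push_cast; ring
        rw [h, Complex.re_ofReal_mul]
        simp [hs]
      rw [this]
      nlinarith [mul_pos (show (0 : ℝ) < ((N : ℝ) + 1) * ((N : ℝ) + 2) by positivity) hs0])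
    have hana : ∀ᶠ r in 𝓝[>] (0 : ℝ), ∀ z : ℂ, ‖z‖ < 2 * r → AnalyticAt ℂ φ z := by
      obtain ⟨δ, hδ, h⟩ := Metric.eventually_nhds_iff.1 hφa.eventually_analyticAt
      filter_upwards [Ioo_mem_nhdsGT (half_pos hδ)] with r hr z hz
      exact h (by rw [dist_zero_right]; linarith [hr.2])
    have hb1 := eventually_forall_Ioo_of_eventually_nhds hbz.eventually_nhds
    have hb2 := eventually_forall_Ioo_of_eventually_nhds hb.eventually_analyticAt
    filter_upwards [h1, h2, hana, hb1, hb2, self_mem_nhdsWithin, Ioo_mem_nhdsGT one_pos]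
      with η h1 h2 hana hb1 hb2 hη hη1 x y κ hx hxη hy hκ hbx hbx' hcond
    have hη0 : 0 < η := hη
    have hmem : ∀ t : ℝ, |t| ≤ η * x → AnalyticAt ℂ φ (x + Complex.I * t) := by
      intro t ht
      apply hana
      calc ‖(x : ℂ) + Complex.I * t‖ ≤ ‖(x : ℂ)‖ + ‖Complex.I * (t : ℂ)‖ := norm_add_le _ _
        _ = |x| + |t| := by simp
        _ < 2 * η := by rw [abs_of_pos hx]; nlinarith [hη1.2]
    -- the derivative along the zero branch vanishes
    have hzero : (deriv φ (x + Complex.I * b x) * (1 + Complex.I * (deriv b x : ℝ))).re = 0 := by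
      have hd : HasDerivAt (fun t : ℝ => (φ (t + Complex.I * b t)).re)
          (deriv φ (x + Complex.I * b x) * (1 + Complex.I * (deriv b x : ℝ))).re x := by
        have h3 := (hb2 x hx hxη).differentiableAt.hasDerivAt.real_add_I_mul
        have h4 := (hmem (b x) hbx).differentiableAt.hasDerivAt.comp x h3
        exact (Complex.reCLM.hasFDerivAt.comp_hasDerivAt x h4).congr_deriv (by simp)
      have hc : HasDerivAt (fun t : ℝ => (φ (t + Complex.I * b t)).re) 0 x := by
        refine (hasDerivAt_const x (0 : ℝ)).congr_of_eventuallyEq ?_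
        exact hb1 x hx hxη
      exact hd.unique hc
    let Ξ : ℝ → ℝ := fun t =>
      s * (deriv φ (x + Complex.I * t) * (1 + Complex.I * (deriv b x : ℝ))).re
    have hΞd : ∀ t, |t| ≤ η * x → HasDerivAt Ξ
        (s * (deriv (deriv φ) (x + Complex.I * t) * Complex.I *
          (1 + Complex.I * (deriv b x : ℝ))).re) t := by
      intro t ht
      have h3 : HasDerivAt (fun t : ℝ => (x : ℂ) + Complex.I * t) Complex.I t :=
        ((Complex.ofRealCLM.hasDerivAt.const_mul Complex.I).const_add (x : ℂ)).congr_deriv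
          (by simp)
      have h4 := ((hmem t ht).deriv.differentiableAt.hasDerivAt.comp t h3).mul_const
        (1 + Complex.I * ((deriv b x : ℝ) : ℂ))
      exact ((Complex.reCLM.hasFDerivAt.comp_hasDerivAt t h4).const_mul s).congr_deriv (by simp)
    have hmono : StrictMonoOn Ξ (Set.Icc (-(η * x)) (η * x)) := by
      refine strictMonoOn_of_deriv_pos (convex_Icc _ _)
        (fun t ht => (hΞd t (abs_le.2 ht)).continuousAt.continuousWithinAt) fun t ht => ?_
      rw [interior_Icc] at ht
      have ht' : |t| ≤ η * x := abs_le.2 ⟨ht.1.le, ht.2.le⟩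
      rw [(hΞd t ht').deriv]
      exact h2 x t (deriv b x) hx hxη ht' hbx'
    have hΞ0 : Ξ (b x) = 0 := by simp only [Ξ, hzero, mul_zero]
    -- `Ξ` vanishes on the branch and increases with `y`. On the allowed sides `y - b x` and `κ -
    -- deriv b x` do not have opposite signs, so the two terms cannot cancel.
    have hsplit : s * (deriv φ (x + Complex.I * y) * (1 + Complex.I * κ)).re =
        Ξ y + (κ - deriv b x) *
          (s * (deriv φ (x + Complex.I * y) * Complex.I * (1 + Complex.I * (0 : ℝ))).re) := by
      have : deriv φ (x + Complex.I * y) * (1 + Complex.I * κ) =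
          deriv φ (x + Complex.I * y) * (1 + Complex.I * (deriv b x : ℝ)) +
          ((κ - deriv b x : ℝ) : ℂ) *
            (deriv φ (x + Complex.I * y) * Complex.I * (1 + Complex.I * (0 : ℝ))) := by
        push_cast
        ring
      rw [this, Complex.add_re, Complex.re_ofReal_mul]
      simp only [Ξ]
      ring
    have hvert := h1 x y 0 hx hxη hy (by simpa using hη0.le)
    intro hcon
    rw [hcon, mul_zero] at hsplit
    rcases hcond with ⟨h3, h4⟩ | ⟨h3, h4⟩
    · have := hmono (abs_le.1 hbx) (abs_le.1 hy) h3
      rw [hΞ0] at this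
      nlinarith [mul_nonneg (sub_nonneg.2 h4) hvert.le]
    · have := hmono (abs_le.1 hy) (abs_le.1 hbx) h3
      rw [hΞ0] at this
      nlinarith [mul_nonneg (sub_nonneg.2 h4) hvert.le]
  · left
    have h1 := exists_thin_sector_pos (d := 1) (s := (e 0).re) he₁.continuousAt hd₁ (by
      rw [he₁0]
      have : ((((N + 1 : ℕ) : ℂ) + 1) * e 0 * 1).re = ((N : ℝ) + 2) * (e 0).re := by
        have h : ((((N + 1 : ℕ) : ℂ) + 1)) = (((N : ℝ) + 2 : ℝ) : ℂ) := by push_cast; ring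
        rw [h, mul_one, Complex.re_ofReal_mul]
      rw [this]
      have := mul_self_pos.2 hre
      nlinarith [mul_pos (show (0 : ℝ) < (N : ℝ) + 2 by positivity) this])
    filter_upwards [h1] with η h1 x y κ hx hxη hy hκ hcon
    have := h1 x y κ hx hxη hy hκ
    rw [mul_one, hcon, mul_zero] at this
    exact lt_irrefl _ this

open Filter Topology in
/-- A finite family of analytic functions vanishing at `0` is totally ordered to the right of `0`,
and the derivatives are ordered in the same way. -/
theorem exists_ordered_family {ι : Type*} [Finite ι] {b : ι → ℝ → ℝ}
    (hb : ∀ i, AnalyticAt ℝ (b i) 0) (hb0 : ∀ i, b i 0 = 0) :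
    ∀ᶠ ε in 𝓝[>] (0 : ℝ), ∀ i j, ∀ x₁ ∈ Set.Ioo 0 ε, b i x₁ ≤ b j x₁ →
      ∀ x ∈ Set.Ioo 0 ε, b i x ≤ b j x ∧ deriv (b i) x ≤ deriv (b j) x := by
  rw [eventually_all]
  intro i
  rw [eventually_all]
  intro j
  have hd := ((hb j).sub (hb i)).sign_trichotomy (by simp [hb0])
  have hdi : ∀ᶠ ε in 𝓝[>] (0 : ℝ), ∀ x, 0 < x → x < ε → DifferentiableAt ℝ (b i) x :=
    eventually_forall_Ioo_of_eventually_nhds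
      ((hb i).eventually_analyticAt.mono fun x h => h.differentiableAt)
  have hdj : ∀ᶠ ε in 𝓝[>] (0 : ℝ), ∀ x, 0 < x → x < ε → DifferentiableAt ℝ (b j) x :=
    eventually_forall_Ioo_of_eventually_nhds
      ((hb j).eventually_analyticAt.mono fun x h => h.differentiableAt)
  filter_upwards [hd, hdi, hdj] with ε hd hdi hdj x₁ hx₁ hle x hx
  have hder : deriv (b j - b i) x = deriv (b j) x - deriv (b i) x :=
    deriv_sub (hdj x hx.1 hx.2) (hdi x hx.1 hx.2)
  rcases hd with h | h | h
  · have h1 := h x hx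
    rw [hder, Pi.sub_apply] at h1
    exact ⟨by linarith [h1.1], by linarith [h1.2]⟩
  · have h1 := h x hx
    rw [hder, Pi.sub_apply] at h1
    exact ⟨by linarith [h1.1], by linarith [h1.2]⟩
  · have h1 := (h x₁ hx₁).1
    rw [Pi.sub_apply] at h1
    linarith

/-- A smooth path from `p` to `q` inside the punctured ball of radius `r` along which all the
functions `Re (φ j)` are strictly monotone. -/
def HasMonotonePath {ι : Type*} (φ : ι → ℂ → ℂ) (r : ℝ) (p q : ℂ) : Prop :=
  ∃ (a b : ℝ) (γ : ℝ → ℂ), a < b ∧ γ a = p ∧ γ b = q ∧ ∀ t ∈ Set.Icc a b,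
    ContDiffAt ℝ 2 γ t ∧ γ t ≠ 0 ∧ ‖γ t‖ < r ∧
    ∀ j, (deriv (φ j) (γ t) * deriv γ t).re ≠ 0

open Filter Topology in
/-- Among the points of a sequence tending to `0` tangentially to the positive real axis, two can be
joined by a path along which finitely many given harmonic functions are strictly monotone. -/
theorem exists_monotonePath_of_tangent {ι : Type*} [Finite ι] {φ : ι → ℂ → ℂ}
    (hφa : ∀ j, AnalyticAt ℂ (φ j) 0)
    (hφ : ∀ j, ∃ (N : ℕ) (e : ℂ → ℂ), AnalyticAt ℂ e 0 ∧ e 0 ≠ 0 ∧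
      ∀ᶠ z in 𝓝 0, φ j z = z ^ (N + 2) * e z)
    {x y : ℕ → ℝ} (hx : ∀ n, 0 < x n) (hx0 : Tendsto x atTop (𝓝 0))
    (hy : Tendsto (fun n => y n / x n) atTop (𝓝 0))
    (hne : ∀ j n, (φ j (x n + Complex.I * y n)).re ≠ 0) {r : ℝ} (hr : 0 < r) :
    ∃ m n, m ≠ n ∧
      HasMonotonePath φ r (x m + Complex.I * y m) (x n + Complex.I * y n) := by
  classical
  choose N e he he0 hform using hφ
  have hdich := fun j => thin_sector_dichotomy (hφa j) (he j) (he0 j) (hform j)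
  let P : ι → Prop := fun j => ∀ᶠ η in 𝓝[>] (0 : ℝ), ∀ x y κ : ℝ, 0 < x → x < η →
    |y| ≤ η * x → |κ| ≤ η → (deriv (φ j) (x + Complex.I * y) * (1 + Complex.I * κ)).re ≠ 0
  let J : Type _ := {j : ι // ¬ P j}
  have hJ := fun j : J => (hdich j.1).resolve_left j.2
  choose β hβ hβ0 hβ' hβz hβη using hJ
  -- a common aperture for the sector
  have hη₁ : ∀ᶠ η in 𝓝[>] (0 : ℝ), ∀ j, P j → ∀ x y κ : ℝ, 0 < x → x < η →
      |y| ≤ η * x → |κ| ≤ η →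
      (deriv (φ j) (x + Complex.I * y) * (1 + Complex.I * κ)).re ≠ 0 := by
    rw [eventually_all]
    intro j
    by_cases h : P j
    · filter_upwards [h] with η h1 _ using h1
    · exact Eventually.of_forall fun η h1 => absurd h1 h
  have hη₂ := eventually_all.2 hβη
  obtain ⟨η, hη₁, hη₂, hη0, hηr⟩ := (hη₁.and (hη₂.and (Ioo_mem_nhdsGT one_pos))).exists
  -- the branches together with the two sides of the sector
  let b : J ⊕ Bool → ℝ → ℝ := Sum.elim β fun s t => if s then η * t else -(η * t)
  have hb : ∀ i, AnalyticAt ℝ (b i) 0 := by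
    rintro (j | s)
    · exact hβ j
    · cases s
      · exact (analyticAt_const.mul analyticAt_id).neg
      · exact analyticAt_const.mul analyticAt_id
  have hb0 : ∀ i, b i 0 = 0 := by
    rintro (j | s)
    · exact hβ0 j
    · cases s <;> simp [b]
  have hderT : ∀ t, deriv (b (Sum.inr true)) t = η := by
    intro t
    simp [b]
  have hderF : ∀ t, deriv (b (Sum.inr false)) t = -η := by
    intro t
    simp [b]
  have hε₁ := exists_ordered_family hb hb0
  have hε₂ : ∀ᶠ ε in 𝓝[>] (0 : ℝ), ∀ i, ∀ t, 0 < t → t < ε →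
      ContDiffAt ℝ 2 (b i) t := by
    rw [eventually_all]
    intro i
    exact eventually_forall_Ioo_of_eventually_nhds
      ((hb i).eventually_analyticAt.mono fun x h => h.contDiffAt)
  have hε₃ : ∀ᶠ ε in 𝓝[>] (0 : ℝ), ∀ j : J, ∀ t, 0 < t → t < ε → |deriv (β j) t| < η := by
    rw [eventually_all]
    intro j
    refine eventually_forall_Ioo_of_eventually_nhds ?_
    have h1 : Tendsto (fun t => |deriv (β j) t|) (𝓝 0) (𝓝 0) := by
      have := (hβ j).deriv.continuousAt.tendsto.abs
      rwa [hβ' j, abs_zero] at this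
    exact h1.eventually (gt_mem_nhds hη0)
  have hε₄ : ∀ᶠ ε in 𝓝[>] (0 : ℝ), ∀ j : J, ∀ t, 0 < t → t < ε →
      (φ j.1 (t + Complex.I * β j t)).re = 0 := by
    rw [eventually_all]
    intro j
    exact eventually_forall_Ioo_of_eventually_nhds (hβz j)
  have hmin : 0 < min η (r / 2) := lt_min hη0 (half_pos hr)
  obtain ⟨ε, hε₁, hε₂, hε₃, hε₄, hε0, hεη⟩ :=
    (hε₁.and (hε₂.and (hε₃.and (hε₄.and (Ioo_mem_nhdsGT hmin))))).exists
  have hεη' : ε < η := hεη.trans_le (min_le_left _ _)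
  have hεr : ε < r / 2 := hεη.trans_le (min_le_right _ _)
  -- the branches stay in the sector
  have hβsec : ∀ j : J, ∀ t ∈ Set.Ioo 0 ε, |β j t| ≤ η * t := by
    intro j t ht
    rw [abs_le]
    constructor
    · by_contra hcon
      push Not at hcon
      have h1 := (hε₁ (Sum.inl j) (Sum.inr false) t ht (by simpa [b] using hcon.le) t ht).2
      rw [hderF] at h1
      have h2 := abs_lt.1 (hε₃ j t ht.1 ht.2)
      simp only [b, Sum.elim_inl] at h1
      linarith [h2.1]
    · by_contra hcon
      push Not at hcon
      have h1 := (hε₁ (Sum.inr true) (Sum.inl j) t ht (by simpa [b] using hcon.le) t ht).2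
      rw [hderT] at h1
      have h2 := abs_lt.1 (hε₃ j t ht.1 ht.2)
      simp only [b, Sum.elim_inl] at h1
      linarith [h2.2]
  -- a subsequence on which the position relative to the branches is constant
  have hev : ∀ᶠ n in atTop, x n < ε ∧ |y n / x n| < η := by
    have h1 : ∀ᶠ n in atTop, |y n / x n| < η := by
      have := hy.abs
      rw [abs_zero] at this
      exact this.eventually (gt_mem_nhds hη0)
    exact (hx0.eventually (gt_mem_nhds hε0)).and h1
  let Λ : ℕ → Set (J ⊕ Bool) := fun n => {i | b i (x n) < y n}
  obtain ⟨L, hL⟩ : ∃ L, ∃ᶠ n in atTop, Λ n = L := by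
    by_contra hcon
    push Not at hcon
    have h1 : ∀ L, ∀ᶠ n in atTop, Λ n ≠ L := fun L => hcon L
    have h2 : ∀ᶠ n in atTop, ∀ L, Λ n ≠ L := eventually_all.2 h1
    obtain ⟨n, hn⟩ := h2.exists
    exact hn _ rfl
  obtain ⟨n, hnL, hnε, hnη⟩ := (hL.and_eventually hev).exists
  have hyb : ∀ n, |y n / x n| < η → |y n| < η * x n := by
    intro n h
    rwa [abs_div, abs_of_pos (hx n), div_lt_iff₀ (hx n)] at h
  have hFL : Sum.inr false ∈ L := by
    rw [← hnL]
    have := abs_lt.1 (hyb n hnη)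
    simp only [Λ, Set.mem_ofPred_eq, b, Sum.elim_inr]
    simpa using this.1
  have hTL : Sum.inr true ∉ L := by
    rw [← hnL]
    have := abs_lt.1 (hyb n hnη)
    simp only [Λ, Set.mem_ofPred_eq, b, Sum.elim_inr]
    simpa using this.2.le
  obtain ⟨lo, hlo, hlomax⟩ := Set.exists_max_image L (fun i => b i (x n)) (Set.toFinite L) ⟨_, hFL⟩
  obtain ⟨up, hup, hupmin⟩ :=
    Set.exists_min_image Lᶜ (fun i => b i (x n)) (Set.toFinite _) ⟨_, hTL⟩
  have hxn : x n ∈ Set.Ioo 0 ε := ⟨hx n, hnε⟩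
  have hlo' : ∀ i ∈ L, ∀ t ∈ Set.Ioo 0 ε, b i t ≤ b lo t ∧ deriv (b i) t ≤ deriv (b lo) t :=
    fun i hi => hε₁ i lo (x n) hxn (hlomax i hi)
  have hup' : ∀ i ∉ L, ∀ t ∈ Set.Ioo 0 ε, b up t ≤ b i t ∧ deriv (b up) t ≤ deriv (b i) t :=
    fun i hi => hε₁ up i (x n) hxn (hupmin i hi)
  have hstrict : ∀ m, Λ m = L → x m < ε → |y m / x m| < η →
      b lo (x m) < y m ∧ y m < b up (x m) := by
    intro m hm hmε hmη
    refine ⟨by rw [← hm] at hlo; exact hlo, ?_⟩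
    have h1 : ¬ b up (x m) < y m := by rw [← hm] at hup; exact hup
    refine lt_of_le_of_ne (not_lt.1 h1) fun heq => ?_
    rcases up with j | s
    · apply hne j.1 m
      rw [heq]
      exact hε₄ j (x m) (hx m) hmε
    · have h2 := abs_lt.1 (hyb m hmη)
      cases s
      · exact hup hFL
      · simp only [b, Sum.elim_inr, if_true] at heq
        linarith [h2.2]
  obtain ⟨hn1, hn2⟩ := hstrict n hnL hnε hnη
  let u : ℝ → ℝ := fun t => b up t - b lo t
  -- the second point is chosen much closer to the origin
  have hu0 : Tendsto (fun m => u (x m)) atTop (𝓝 0) := by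
    have h1 : ContinuousAt u 0 := (hb up).continuousAt.sub (hb lo).continuousAt
    have h2 : u 0 = 0 := by simp [u, hb0]
    have h3 := h1.tendsto.comp hx0
    rwa [h2] at h3
  have hpos : 0 < min (y n - b lo (x n)) (b up (x n) - y n) :=
    lt_min (by linarith) (by linarith)
  obtain ⟨m, hmL, ⟨hmε, hmη⟩, hmu, hmx⟩ := (hL.and_eventually (hev.and
    ((hu0.eventually (gt_mem_nhds hpos)).and (hx0.eventually (gt_mem_nhds (hx n)))))).exists
  obtain ⟨hm1, hm2⟩ := hstrict m hmL hmε hmη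
  have hmu1 : u (x m) < y n - b lo (x n) := hmu.trans_le (min_le_left _ _)
  have hmu2 : u (x m) < b up (x n) - y n := hmu.trans_le (min_le_right _ _)
  refine ⟨m, n, fun h => by rw [h] at hmx; exact lt_irrefl _ hmx, ?_⟩
  set hM : ℝ := y m - b lo (x m) with hMdef
  set hN : ℝ := y n - b lo (x n) with hNdef
  have hden : 0 < u (x n) - u (x m) := by simp only [u] at *; linarith
  -- The path has height `b lo + hM + σ (u - u (x m))`, where `u` is the width of the gap, and `σ`
  -- is forced by the endpoint at `x n`. Choosing `x m` so small that `u (x m)` is below both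
  -- distances of the `n`-th point from the branches gives `0 < σ < 1`, so the slope of the path
  -- lies between those of `b lo` and `b up`.
  set σ : ℝ := (hN - hM) / (u (x n) - u (x m)) with hσ
  have hσ0 : 0 < σ := div_pos (by simp only [u] at *; linarith) hden
  have hσ1 : σ < 1 := by rw [hσ, div_lt_one hden]; simp only [u] at *; linarith
  let Y : ℝ → ℝ := fun t => b lo t + hM + σ * (u t - u (x m))
  have hIcc : ∀ t ∈ Set.Icc (x m) (x n), t ∈ Set.Ioo 0 ε := fun t ht =>
    ⟨(hx m).trans_le ht.1, ht.2.trans_lt hnε⟩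
  have hdiff : ∀ i, ∀ t ∈ Set.Ioo 0 ε, DifferentiableAt ℝ (b i) t := fun i t ht =>
    (hε₂ i t ht.1 ht.2).differentiableAt (by norm_num)
  have hlu : ∀ t ∈ Set.Ioo 0 ε, b lo t ≤ b up t ∧ deriv (b lo) t ≤ deriv (b up) t :=
    hε₁ lo up (x n) hxn (by linarith)
  have humono : MonotoneOn u (Set.Icc (x m) (x n)) := by
    refine monotoneOn_of_deriv_nonneg (convex_Icc _ _)
      (fun t ht => ((hdiff up t (hIcc t ht)).sub
        (hdiff lo t (hIcc t ht))).continuousAt.continuousWithinAt)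
      (fun t ht => ((hdiff up t (hIcc t (interior_subset ht))).sub
        (hdiff lo t (hIcc t (interior_subset ht)))).differentiableWithinAt) fun t ht => ?_
    have h1 : deriv u t = deriv (b up) t - deriv (b lo) t :=
      deriv_sub (hdiff up t (hIcc t (interior_subset ht)))
        (hdiff lo t (hIcc t (interior_subset ht)))
    rw [h1]
    linarith [(hlu t (hIcc t (interior_subset ht))).2]
  have hYd : ∀ t ∈ Set.Ioo 0 ε, HasDerivAt Y
      (deriv (b lo) t + σ * (deriv (b up) t - deriv (b lo) t)) t := by
    intro t ht
    have h1 := (hdiff lo t ht).hasDerivAt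
    have h2 := (hdiff up t ht).hasDerivAt
    exact (h1.add_const hM).add (((h2.sub h1).sub_const (u (x m))).const_mul σ)
  refine ⟨x m, x n, fun t => t + Complex.I * Y t, hmx, ?_, ?_, fun t ht => ?_⟩
  · have : Y (x m) = y m := by simp [Y, hMdef]
    simp only [this]
  · have : Y (x n) = y n := by
      simp only [Y, hσ]
      rw [div_mul_cancel₀ _ hden.ne', hNdef]
      ring
    simp only [this]
  · have ht' := hIcc t ht
    have ht0 := ht'.1
    have hut : u (x m) ≤ u t := humono ⟨le_rfl, hmx.le⟩ ht ht.1
    have hYlo : b lo t < Y t := by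
      have := mul_nonneg hσ0.le (sub_nonneg.2 hut)
      simp only [Y, hMdef]; linarith
    have hYup : Y t < b up t := by
      have h1 := mul_nonneg (sub_nonneg.2 hσ1.le) (sub_nonneg.2 hut)
      have h2 : hM < u (x m) := by simp only [hMdef, u]; linarith
      have h3 : b up t = b lo t + u t := by simp only [u]; ring
      rw [h3]
      simp only [Y]
      nlinarith
    set κ : ℝ := deriv (b lo) t + σ * (deriv (b up) t - deriv (b lo) t) with hκ
    have hκlo : deriv (b lo) t ≤ κ := by
      have := mul_nonneg hσ0.le (sub_nonneg.2 (hlu t ht').2)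
      rw [hκ]; linarith
    have hκup : κ ≤ deriv (b up) t := by
      have := mul_nonneg (sub_nonneg.2 hσ1.le) (sub_nonneg.2 (hlu t ht').2)
      rw [hκ]; nlinarith
    have hF := hlo' _ hFL t ht'
    have hT := hup' _ hTL t ht'
    rw [hderF] at hF
    rw [hderT] at hT
    have hF1 : b (Sum.inr false) t = -(η * t) := by simp [b]
    have hT1 : b (Sum.inr true) t = η * t := by simp [b]
    rw [hF1] at hF
    rw [hT1] at hT
    have hYabs : |Y t| ≤ η * t := abs_le.2 ⟨by linarith [hF.1], by linarith [hT.1]⟩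
    have hκabs : |κ| ≤ η := abs_le.2 ⟨by linarith [hF.2], by linarith [hT.2]⟩
    have htη : t < η := ht'.2.trans hεη'
    have hder : deriv (fun t : ℝ => (t : ℂ) + Complex.I * Y t) t = 1 + Complex.I * κ :=
      (hYd t ht').real_add_I_mul.deriv
    refine ⟨?_, ?_, ?_, fun j => ?_⟩
    · have h1 : ContDiffAt ℝ 2 Y t :=
        ((hε₂ lo t ht'.1 ht'.2).add contDiffAt_const).add
          (contDiffAt_const.mul (((hε₂ up t ht'.1 ht'.2).sub (hε₂ lo t ht'.1 ht'.2)).sub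
            contDiffAt_const))
      exact Complex.ofRealCLM.contDiff.contDiffAt.add
        (contDiffAt_const.mul (Complex.ofRealCLM.contDiff.contDiffAt.comp t h1))
    · intro h
      have := congrArg Complex.re h
      simp at this
      linarith
    · calc ‖(t : ℂ) + Complex.I * Y t‖ ≤ ‖(t : ℂ)‖ + ‖Complex.I * (Y t : ℂ)‖ := norm_add_le _ _
        _ = |t| + |Y t| := by simp
        _ < r := by rw [abs_of_pos ht0]; nlinarith [ht'.2]
    · rw [hder]
      by_cases hPj : P j
      · exact hη₁ j hPj t (Y t) κ ht0 htη hYabs hκabs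
      · refine hη₂ ⟨j, hPj⟩ t (Y t) κ ht0 htη hYabs hκabs (hβsec _ t ht')
          (hε₃ ⟨j, hPj⟩ t ht0 ht'.2).le ?_
        by_cases hjL : (Sum.inl ⟨j, hPj⟩ : J ⊕ Bool) ∈ L
        · left
          have := hlo' _ hjL t ht'
          simp only [b, Sum.elim_inl] at this
          exact ⟨this.1.trans_lt hYlo, this.2.trans hκlo⟩
        · right
          have := hup' _ hjL t ht'
          simp only [b, Sum.elim_inl] at this
          exact ⟨hYup.trans_le this.1, hκup.trans this.2⟩

open Filter Topology in
/-- Among the points of a sequence tending to `0` and avoiding the zero sets of finitely many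
harmonic functions `Re (φ j)` vanishing at `0`, two can be joined by a path along which these
functions are strictly monotone. -/
theorem exists_monotonePath {ι : Type*} [Finite ι] {φ : ι → ℂ → ℂ}
    (hφa : ∀ j, AnalyticAt ℂ (φ j) 0) (hφ0 : ∀ j, φ j 0 = 0)
    (hnz : ∀ j, ¬ ∀ᶠ z in 𝓝 0, φ j z = 0) {z : ℕ → ℂ} (hz : Tendsto z atTop (𝓝 0))
    (hz0 : ∀ n, z n ≠ 0) (hne : ∀ j n, (φ j (z n)).re ≠ 0) {r : ℝ} (hr : 0 < r) :
    ∃ m n, m ≠ n ∧ HasMonotonePath φ r (z m) (z n) := by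
  -- Pulling back by squaring doubles the order of vanishing of each `φ j`, which becomes at least
  -- two, as `thin_sector_dichotomy` requires.
  have hsq : ∀ n, ∃ w : ℂ, w ^ 2 = z n := fun n => IsAlgClosed.exists_pow_nat_eq (z n) two_pos
  choose w hw using hsq
  have hw0 : ∀ n, w n ≠ 0 := fun n h => hz0 n (by rw [← hw, h]; simp)
  have hwlim : Tendsto w atTop (𝓝 0) := by
    rw [tendsto_zero_iff_norm_tendsto_zero]
    have h1 : Tendsto (fun n => Real.sqrt ‖z n‖) atTop (𝓝 0) := by
      have := (Real.continuous_sqrt.tendsto 0).comp (tendsto_zero_iff_norm_tendsto_zero.1 hz)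
      rw [Real.sqrt_zero] at this
      exact this
    refine h1.congr fun n => ?_
    rw [← hw, norm_pow, Real.sqrt_sq (norm_nonneg _)]
  have hdir : ∀ n, w n / ‖w n‖ ∈ Metric.sphere (0 : ℂ) 1 := fun n => by
    have : ‖w n‖ ≠ 0 := norm_ne_zero_iff.2 (hw0 n)
    simp [this]
  -- A subsequence of the square roots has a limiting direction `ω`; dividing by `ω` makes it
  -- tangent to the positive real axis.
  obtain ⟨ω, hω, s, hs, hlim⟩ := (isCompact_sphere (0 : ℂ) 1).tendsto_subseq hdir
  have hω1 : ‖ω‖ = 1 := by simpa using hω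
  have hω0 : ω ≠ 0 := fun h => by simp [h] at hω1
  let v : ℕ → ℂ := fun n => w (s n) / ω
  have hv0 : ∀ n, v n ≠ 0 := fun n => div_ne_zero (hw0 _) hω0
  have hvlim : Tendsto v atTop (𝓝 0) := by
    have := (hwlim.comp hs.tendsto_atTop).div_const ω
    simpa using this
  have hvdir : Tendsto (fun n => v n / ‖v n‖) atTop (𝓝 1) := by
    have h1 := hlim.div_const ω
    rw [div_self hω0] at h1
    refine h1.congr fun n => ?_
    simp only [v, Function.comp_apply, norm_div, hω1, div_one]
    rw [div_right_comm]
  have hre : Tendsto (fun n => (v n).re / ‖v n‖) atTop (𝓝 1) := by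
    have := (Complex.continuous_re.tendsto 1).comp hvdir
    refine (this.congr fun n => ?_)
    simp only [Function.comp_apply, Complex.div_ofReal_re]
  have him : Tendsto (fun n => (v n).im / ‖v n‖) atTop (𝓝 0) := by
    have := (Complex.continuous_im.tendsto 1).comp hvdir
    refine (this.congr fun n => ?_)
    simp only [Function.comp_apply, Complex.div_ofReal_im]
  have hev : ∀ᶠ n in atTop, 0 < (v n).re := by
    filter_upwards [hre.eventually (lt_mem_nhds one_pos)] with n hn
    have hpos : 0 < ‖v n‖ := norm_pos_iff.2 (hv0 n)
    have := mul_pos hn hpos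
    rwa [div_mul_cancel₀ _ hpos.ne'] at this
  obtain ⟨n₀, hn₀⟩ := eventually_atTop.1 hev
  let q : ℂ → ℂ := fun w => (ω * w) ^ 2
  have hqa : AnalyticAt ℂ q 0 := by fun_prop
  have hq0 : q 0 = 0 := by simp [q]
  have hqlim : Tendsto q (𝓝 0) (𝓝 0) := by simpa [hq0] using hqa.continuousAt.tendsto
  have hφq : ∀ j, AnalyticAt ℂ (φ j) (q 0) := fun j => by rw [hq0]; exact hφa j
  have hqv : ∀ n, q (v n) = z (s n) := fun n => by
    simp only [q, v]
    rw [mul_div_cancel₀ _ hω0, hw]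
  have hform : ∀ j, ∃ (N : ℕ) (e : ℂ → ℂ), AnalyticAt ℂ e 0 ∧ e 0 ≠ 0 ∧
      ∀ᶠ z in 𝓝 0, (φ j ∘ q) z = z ^ (N + 2) * e z := by
    intro j
    obtain ⟨M, e, he, he0, hM⟩ :=
      (hφa j).exists_eventuallyEq_pow_smul_nonzero_iff.2 (hnz j)
    have hM0 : M ≠ 0 := by
      rintro rfl
      have := hM.self_of_nhds
      simp [hφ0 j] at this
      exact he0 this.symm
    obtain ⟨M', rfl⟩ := Nat.exists_eq_succ_of_ne_zero hM0
    refine ⟨2 * M', fun z => ω ^ (2 * (M' + 1)) * e (q z), ?_, ?_, ?_⟩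
    · have : AnalyticAt ℂ e (q 0) := by rwa [hq0]
      exact analyticAt_const.mul (this.comp hqa)
    · simp only [hq0]
      exact mul_ne_zero (pow_ne_zero _ hω0) he0
    · filter_upwards [hqlim.eventually hM] with z hz
      simp only [Function.comp_apply]
      rw [hz]
      simp only [q, smul_eq_mul, sub_zero, Nat.succ_eq_add_one]
      rw [← pow_mul, mul_pow]
      ring
  have hana : ∀ᶠ z in 𝓝 (0 : ℂ), ∀ j, AnalyticAt ℂ (φ j) z :=
    eventually_all.2 fun j => (hφa j).eventually_analyticAt
  obtain ⟨δ, hδ, hδa⟩ := Metric.eventually_nhds_iff.1 hana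
  have hr' : 0 < min (min r δ) 1 := lt_min (lt_min hr hδ) one_pos
  have hxy : ∀ n, (((v n).re : ℂ) + Complex.I * ((v n).im : ℂ)) = v n := fun n => by
    rw [mul_comm]; exact Complex.re_add_im _
  obtain ⟨m, n, hmn, a, b, γ, hab, hγa, hγb, hγ⟩ := exists_monotonePath_of_tangent
    (φ := fun j => φ j ∘ q) (fun j => (hφq j).comp hqa) hform
    (x := fun n => (v (n + n₀)).re) (y := fun n => (v (n + n₀)).im)
    (fun n => hn₀ _ (Nat.le_add_left _ _))
    (by
      have := (Complex.continuous_re.tendsto 0).comp (hvlim.comp (tendsto_add_atTop_nat n₀))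
      rw [Complex.zero_re] at this
      exact this)
    (by
      have h1 := (him.div hre one_ne_zero).comp (tendsto_add_atTop_nat n₀)
      rw [zero_div] at h1
      refine h1.congr fun n => ?_
      have hpos : ‖v (n + n₀)‖ ≠ 0 := norm_ne_zero_iff.2 (hv0 _)
      simp only [Function.comp_apply, Pi.div_apply]
      rw [div_div_div_cancel_right₀ hpos])
    (fun j n => by
      simp only [hxy, Function.comp_apply]
      rw [hqv]
      exact hne j _) hr'
  simp only [hxy] at hγa hγb
  refine ⟨s (m + n₀), s (n + n₀), fun h => hmn (by simpa using hs.injective h), a, b,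
    q ∘ γ, hab, by rw [Function.comp_apply, hγa, hqv],
    by rw [Function.comp_apply, hγb, hqv], fun t ht => ?_⟩
  obtain ⟨h1, h2, h3, h4⟩ := hγ t ht
  have hnorm : ‖q (γ t)‖ < min r δ := by
    have h5 : ‖γ t‖ < 1 := h3.trans_le (min_le_right _ _)
    have h6 : ‖γ t‖ < min r δ := h3.trans_le (min_le_left _ _)
    simp only [q, norm_pow, norm_mul, hω1, one_mul]
    nlinarith [norm_nonneg (γ t)]
  have hγd : HasDerivAt γ (deriv γ t) t := (h1.differentiableAt (by norm_num)).hasDerivAt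
  have hqd : HasDerivAt q (deriv q (γ t)) (γ t) :=
    (show DifferentiableAt ℂ q (γ t) by fun_prop).hasDerivAt
  refine ⟨?_, ?_, hnorm.trans_le (min_le_left _ _), fun j => ?_⟩
  · exact (contDiffAt_const.mul h1).pow 2
  · exact pow_ne_zero _ (mul_ne_zero hω0 h2)
  · have h5 := h4 j
    have h6 : HasDerivAt (φ j) (deriv (φ j) (q (γ t))) (q (γ t)) :=
      (hδa (by rw [dist_zero_right]; exact hnorm.trans_le (min_le_right _ _))
        j).differentiableAt.hasDerivAt
    rw [(h6.comp (γ t) hqd).deriv] at h5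
    rw [(hqd.comp t hγd).deriv, Function.comp_apply]
    rwa [mul_assoc] at h5

/-! ### Absolute continuity along curves and generic translates. -/

/-- An absolutely continuous function which becomes positive has a positive derivative at some
generic point where it is positive. -/
theorem AbsolutelyContinuousOnInterval.exists_pos_of_pos_deriv {f : ℝ → ℝ} {a b : ℝ} (hab : a ≤ b)
    (hf : AbsolutelyContinuousOnInterval f a b) (ha : f a ≤ 0) (hb : 0 < f b) {G : ℝ → Prop}
    (hG : ∀ᵐ t, t ∈ Set.Icc a b → G t) :
    ∃ t ∈ Set.Ioo a b, G t ∧ 0 < f t ∧ 0 < deriv f t := by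
  have hcont : ContinuousOn f (Set.Icc a b) := by
    have := hf.continuousOn
    rwa [Set.uIcc_of_le hab] at this
  let S : Set ℝ := {t ∈ Set.Icc a b | f t ≤ 0}
  have hScl : IsClosed S := hcont.preimage_isClosed_of_isClosed isClosed_Icc isClosed_Iic
  have hSne : S.Nonempty := ⟨a, ⟨le_rfl, hab⟩, ha⟩
  have hSbd : BddAbove S := ⟨b, fun t ht => ht.1.2⟩
  -- After the last time `t₀` with `f ≤ 0` the function is positive. If its derivative were
  -- nonpositive at almost every later time, the fundamental theorem of calculus would give `f b ≤ f
  -- t₀ ≤ 0`.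
  set t₀ := sSup S with ht₀
  have ht₀S : t₀ ∈ S := hScl.csSup_mem hSne hSbd
  have hpos : ∀ t ∈ Set.Ioc t₀ b, 0 < f t := by
    intro t ht
    by_contra hcon
    have : t ∈ S := ⟨⟨ht₀S.1.1.trans ht.1.le, ht.2⟩, not_lt.1 hcon⟩
    exact absurd (le_csSup hSbd this) (not_le.2 ht.1)
  have hlt : t₀ < b := lt_of_le_of_ne ht₀S.1.2 fun h => by
    have := ht₀S.2
    rw [h] at this
    linarith
  by_contra hcon
  push Not at hcon
  have hft : AbsolutelyContinuousOnInterval f t₀ b := by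
    refine hf.mono ?_
    rw [Set.uIcc_of_le hlt.le, Set.uIcc_of_le hab]
    exact Set.Icc_subset_Icc_left ht₀S.1.1
  have hint := hft.integral_deriv_eq_sub
  have hle : ∫ t in t₀..b, deriv f t ≤ 0 := by
    rw [intervalIntegral.integral_of_le hlt.le]
    refine integral_nonpos_of_ae ?_
    have hne : ∀ᵐ t : ℝ, t ≠ b := by simp [ae_iff]
    rw [Filter.EventuallyLE, ae_restrict_iff' measurableSet_Ioc]
    filter_upwards [hG, hne] with t ht htb htI
    have h1 : t ∈ Set.Ioo a b := ⟨ht₀S.1.1.trans_lt htI.1, lt_of_le_of_ne htI.2 htb⟩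
    exact hcon t h1 (ht ⟨h1.1.le, h1.2.le⟩) (hpos t htI)
  have := ht₀S.2
  linarith

/-- A `C¹` curve is Lipschitz on compact intervals. -/
theorem exists_lipschitzOnWith_of_contDiffAt {E : Type*} [NormedAddCommGroup E] [NormedSpace ℝ E]
    {γ : ℝ → E} {a b : ℝ} (hγ : ∀ t ∈ Set.Icc a b, ContDiffAt ℝ 1 γ t) :
    ∃ K, LipschitzOnWith K γ (Set.Icc a b) := by
  have h : ContDiffOn ℝ 1 γ (Set.Icc a b) := fun t ht => (hγ t ht).contDiffWithinAt
  exact h.exists_lipschitzOnWith one_ne_zero (convex_Icc a b) isCompact_Icc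

/-- Almost every translate of a curve meets a null set only in a null set of times. -/
theorem ae_ae_add_notMem_of_null {N : Set ℂ} (hN : volume N = 0) {γ : ℝ → ℂ}
    (hγ : Measurable γ) : ∀ᵐ s : ℂ, ∀ᵐ t : ℝ, s + γ t ∉ N := by
  let N' := toMeasurable volume N
  have hN' : volume N' = 0 := by rw [measure_toMeasurable, hN]
  have hmeas : MeasurableSet {p : ℂ × ℝ | p.1 + γ p.2 ∈ N'} :=
    (measurable_fst.add (hγ.comp measurable_snd)) (measurableSet_toMeasurable _ _)
  -- For fixed `t` the bad shifts form a translate of a null set; Fubini's theorem exchanges the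
  -- order.
  have h0 : (volume.prod volume : Measure (ℂ × ℝ)) {p : ℂ × ℝ | p.1 + γ p.2 ∈ N'} = 0 := by
    rw [Measure.prod_apply_symm hmeas, lintegral_eq_zero_iff' ]
    · refine Filter.Eventually.of_forall fun t => ?_
      change volume ((fun s : ℂ => s + γ t) ⁻¹' N') = 0
      rw [measure_preimage_add_right, hN']
    · exact (measurable_measure_prodMk_right hmeas).aemeasurable
  have h1 : ∀ᵐ p : ℂ × ℝ ∂(volume.prod volume), p.1 + γ p.2 ∉ N' := by
    rw [ae_iff]
    simpa using h0
  filter_upwards [Measure.ae_ae_of_ae_prod h1] with s hs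
  filter_upwards [hs] with t ht hmem
  exact ht (subset_toMeasurable _ _ hmem)

/-! ### Functions that are piecewise real parts: maximum principle and behaviour along generic
lines. -/

/-- `u` agrees with `Re Φ + c` near `z`. -/
def AgreesNear (u : ℂ → ℝ) (Φ : ℂ → ℂ) (c : ℝ) (z : ℂ) : Prop :=
  ∀ᶠ w in nhds z, u w = (Φ w).re + c

theorem AgreesNear.eventually {u : ℂ → ℝ} {Φ : ℂ → ℂ} {c : ℝ} {z : ℂ} (h : AgreesNear u Φ c z) :
    ∀ᶠ w in nhds z, AgreesNear u Φ c w :=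
  eventually_eventually_nhds.2 h

theorem AgreesNear.eq {u : ℂ → ℝ} {Φ : ℂ → ℂ} {c : ℝ} {z : ℂ} (h : AgreesNear u Φ c z) :
    u z = (Φ z).re + c :=
  h.self_of_nhds

/-- A Lipschitz function `u` on the open set `O` with the sub-mean value property, which agrees,
near almost every point, with the real part of one of the holomorphic functions `Φ j` up to an
additive constant. -/
structure IsPiecewiseRe {ι : Type*} (O : Set ℂ) (u : ℂ → ℝ) (Φ : ι → ℂ → ℂ) : Prop where
  isOpen : IsOpen O
  lipschitz : ∃ L, LipschitzOnWith L u O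
  le_circleAverage : ∀ c r, 0 < r → Metric.closedBall c r ⊆ O → u c ≤ Real.circleAverage u c r
  differentiableOn : ∀ j, DifferentiableOn ℂ (Φ j) O
  null : volume {z ∈ O | ∀ j c, ¬ AgreesNear u (Φ j) c z} = 0

namespace IsPiecewiseRe

variable {ι : Type*} {O : Set ℂ} {u : ℂ → ℝ} {Φ : ι → ℂ → ℂ}

theorem continuousOn (h : IsPiecewiseRe O u Φ) : ContinuousOn u O :=
  h.lipschitz.elim fun _ hL => hL.continuousOn

theorem continuousAt (h : IsPiecewiseRe O u Φ) {z : ℂ} (hz : z ∈ O) : ContinuousAt u z :=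
  h.continuousOn.continuousAt (h.isOpen.mem_nhds hz)

theorem analyticAt (h : IsPiecewiseRe O u Φ) (j : ι) {z : ℂ} (hz : z ∈ O) :
    AnalyticAt ℂ (Φ j) z :=
  (h.differentiableOn j).analyticAt (h.isOpen.mem_nhds hz)

theorem hasDerivAt (h : IsPiecewiseRe O u Φ) (j : ι) {z : ℂ} (hz : z ∈ O) :
    HasDerivAt (Φ j) (deriv (Φ j) z) z :=
  (h.analyticAt j hz).differentiableAt.hasDerivAt

theorem hasDerivAt_re_comp (h : IsPiecewiseRe O u Φ) (j : ι) {γ : ℝ → ℂ} {γ' : ℂ} {t : ℝ}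
    (ht : γ t ∈ O) (hγ : HasDerivAt γ γ' t) :
    HasDerivAt (fun t => (Φ j (γ t)).re) (deriv (Φ j) (γ t) * γ').re t :=
  (Complex.reCLM.hasFDerivAt.comp_hasDerivAt t ((h.hasDerivAt j ht).comp t hγ)).congr_deriv
    (by simp)

/-- The strong maximum principle for `u - Re Φ`. -/
theorem agreesNear_of_le (h : IsPiecewiseRe O u Φ) {j : ι} {c : ℝ} {q : ℂ} (hq : q ∈ O)
    (hqe : u q = (Φ j q).re + c) (hle : ∀ᶠ w in nhds q, u w ≤ (Φ j w).re + c) :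
    AgreesNear u (Φ j) c q := by
  obtain ⟨ρ, hρ, hρO⟩ := Metric.mem_nhds_iff.1 ((h.isOpen.mem_nhds hq))
  obtain ⟨ρ', hρ', hρle⟩ := Metric.eventually_nhds_iff.1 hle
  refine Metric.eventually_nhds_iff.2 ⟨min ρ ρ', lt_min hρ hρ', fun w hw => ?_⟩
  rcases eq_or_ne w q with rfl | hwq
  · exact hqe
  set r := dist w q with hr
  have hr0 : 0 < r := dist_pos.2 hwq
  have hcb : Metric.closedBall q r ⊆ O := fun z hz =>
    hρO (lt_of_le_of_lt hz (hw.trans_le (min_le_left _ _)))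
  have hharm : HarmonicOnNhd (fun z => (Φ j z).re) (Metric.closedBall q |r|) := by
    rw [abs_of_pos hr0]
    exact fun z hz => (h.analyticAt j (hcb hz)).harmonicAt_re
  have hmean := hharm.circleAverage_eq
  have hsph : ∀ θ : ℝ, circleMap q r θ ∈ Metric.closedBall q r := fun θ =>
    circleMap_mem_closedBall q hr0.le θ
  have hcu : Continuous fun θ => u (circleMap q r θ) := by
    refine continuous_iff_continuousAt.2 fun θ => ?_
    exact (h.continuousAt (hcb (hsph θ))).comp (continuous_circleMap q r).continuousAt
  have hcΦ : Continuous fun θ => (Φ j (circleMap q r θ)).re := by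
    refine continuous_iff_continuousAt.2 fun θ => ?_
    exact Complex.continuous_re.continuousAt.comp
      ((h.analyticAt j (hcb (hsph θ))).continuousAt.comp (continuous_circleMap q r).continuousAt)
  have hcΦc : Continuous fun θ => (Φ j (circleMap q r θ)).re + c := by fun_prop
  have hcd : Continuous fun θ => (Φ j (circleMap q r θ)).re + c - u (circleMap q r θ) :=
    hcΦc.sub hcu
  have hsub := h.le_circleAverage q r hr0 hcb
  have hpi : 0 < 2 * Real.pi := Real.two_pi_pos
  -- The integrand is continuous and nonnegative, while the sub-mean value property makes its
  -- integral nonpositive. Hence it vanishes on every small circle around `q`.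
  have hint : ∫ θ in (0 : ℝ)..2 * Real.pi,
      ((Φ j (circleMap q r θ)).re + c - u (circleMap q r θ)) ≤ 0 := by
    rw [intervalIntegral.integral_sub (hcΦc.intervalIntegrable _ _)
      (hcu.intervalIntegrable _ _), intervalIntegral.integral_add (hcΦ.intervalIntegrable _ _)
      (by simp), intervalIntegral.integral_const]
    rw [Real.circleAverage_def, smul_eq_mul] at hmean hsub
    rw [inv_mul_eq_div, div_eq_iff hpi.ne'] at hmean
    rw [inv_mul_eq_div, le_div_iff₀ hpi, hqe] at hsub
    rw [hmean, sub_zero, smul_eq_mul]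
    linarith
  obtain ⟨θ, hθ⟩ : ∃ θ, circleMap q r θ = w := by
    have : w ∈ Set.range (circleMap q r) := by
      rw [range_circleMap, abs_of_pos hr0]
      exact Metric.mem_sphere.2 hr.symm
    exact this
  have hnn : ∀ θ, 0 ≤ (Φ j (circleMap q r θ)).re + c - u (circleMap q r θ) := fun θ =>
    sub_nonneg.2 (hρle (lt_of_le_of_lt (hsph θ) (hw.trans_le (min_le_right _ _))))
  by_contra hcon
  obtain ⟨θ', hθ', hθe⟩ : ∃ θ' ∈ Set.Ico 0 (2 * Real.pi), circleMap q r θ = circleMap q r θ' := by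
    obtain ⟨y, hy, h⟩ := (periodic_circleMap q r).exists_mem_Ico₀ hpi θ
    exact ⟨y, hy, h⟩
  have hpos := intervalIntegral.integral_pos hpi
    hcd.continuousOn (fun θ _ => hnn θ)
    ⟨θ', ⟨hθ'.1, hθ'.2.le⟩, lt_of_le_of_ne (hnn θ') fun h0 => hcon (by
      rw [← hθ, hθe]
      linarith)⟩
  exact absurd hint (not_le.2 hpos)

end IsPiecewiseRe

/-- Sets of full measure are dense. This is the device by which an open condition at a given point
is moved to a generic point nearby. -/
theorem exists_of_eventually_nhds_of_ae {p q : ℂ → Prop} {w : ℂ} (hp : ∀ᶠ z in nhds w, p z)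
    (hq : ∀ᵐ z : ℂ, q z) : ∃ z, p z ∧ q z := by
  obtain ⟨z, h1, h2⟩ := (Measure.dense_of_ae hq).inter_nhds_nonempty hp
  exact ⟨z, h2, h1⟩

theorem Convex.add_smul_mem_of_mem_Icc {B : Set ℂ} (hB : Convex ℝ B) {p v : ℂ} {a b t : ℝ}
    (ha : p + a • v ∈ B) (hb : p + b • v ∈ B) (ht : t ∈ Set.Icc a b) : p + t • v ∈ B :=
  (((hB.translate_preimage_right p).linear_preimage
    (LinearMap.toSpanSingleton ℝ ℂ v)).ordConnected.out ha hb ht :)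

theorem hasDerivAt_add_smul (p v : ℂ) (t : ℝ) : HasDerivAt (fun t : ℝ => p + t • v) v t :=
  (((hasDerivAt_id t).smul_const v).const_add p).congr_deriv (by simp)

namespace IsPiecewiseRe

variable {ι : Type*} {O : Set ℂ} {u : ℂ → ℝ} {Φ : ι → ℂ → ℂ}

/-- Both terms are Lipschitz along a `C¹` curve. Thus the difference is controlled by its derivative
at almost every time, where `u` is one of the branches. -/
theorem absolutelyContinuousOnInterval_sub (h : IsPiecewiseRe O u Φ) (m : ι) (c : ℝ) {γ : ℝ → ℂ}
    {a b : ℝ} (hab : a ≤ b) (hγ : ∀ t ∈ Set.Icc a b, ContDiffAt ℝ 1 γ t)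
    (hγO : ∀ t ∈ Set.Icc a b, γ t ∈ O) :
    AbsolutelyContinuousOnInterval (fun t => u (γ t) - ((Φ m (γ t)).re + c)) a b := by
  obtain ⟨L, hL⟩ := h.lipschitz
  obtain ⟨K, hK⟩ := exists_lipschitzOnWith_of_contDiffAt hγ
  have h1 : LipschitzOnWith (L * K) (fun t => u (γ t)) (Set.uIcc a b) := by
    rw [Set.uIcc_of_le hab]
    exact hL.comp hK hγO
  have h2 : ∀ t ∈ Set.Icc a b, ContDiffAt ℝ 1 (fun t => (Φ m (γ t)).re + c) t := fun t ht =>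
    (((Complex.reCLM.contDiff.contDiffAt).comp t
      (((h.analyticAt m (hγO t ht)).contDiffAt (n := 1)).restrict_scalars ℝ |>.comp t
        (hγ t ht)))).add contDiffAt_const
  obtain ⟨K', hK'⟩ := exists_lipschitzOnWith_of_contDiffAt h2
  rw [← Set.uIcc_of_le hab] at hK'
  exact (h1.absolutelyContinuousOnInterval).sub hK'.absolutelyContinuousOnInterval

theorem hasDerivAt_sub_of_agreesNear (h : IsPiecewiseRe O u Φ) (m : ι) (c : ℝ) {l : ι} {c' : ℝ}
    {γ : ℝ → ℂ} {γ' : ℂ} {t : ℝ} (ht : γ t ∈ O) (hγ : HasDerivAt γ γ' t)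
    (hl : AgreesNear u (Φ l) c' (γ t)) :
    HasDerivAt (fun t => u (γ t) - ((Φ m (γ t)).re + c))
      ((deriv (Φ l) (γ t) * γ').re - (deriv (Φ m) (γ t) * γ').re) t := by
  have h1 : HasDerivAt (fun t => ((Φ l (γ t)).re + c') - ((Φ m (γ t)).re + c))
      ((deriv (Φ l) (γ t) * γ').re - (deriv (Φ m) (γ t) * γ').re) t :=
    ((h.hasDerivAt_re_comp l ht hγ).add_const c').sub ((h.hasDerivAt_re_comp m ht hγ).add_const c)
  refine h1.congr_of_eventuallyEq ?_
  filter_upwards [hγ.continuousAt.eventually hl] with s hs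
  rw [hs]

theorem exists_agreesNear {z : ℂ} (hz : z ∈ O)
    (hN : z ∉ {z ∈ O | ∀ j c, ¬ AgreesNear u (Φ j) c z}) : ∃ j c, AgreesNear u (Φ j) c z := by
  by_contra hcon
  push Not at hcon
  exact hN ⟨hz, hcon⟩

/-- The difference of two branches increases in the directions in which its slope is positive. -/
theorem sub_le_sub_of_slope_le (h : IsPiecewiseRe O u Φ) {B : Set ℂ} (hBO : B ⊆ O)
    (hB : Convex ℝ B) {v : ℂ} {m l : ι}
    (hs : ∀ z ∈ B, (deriv (Φ m) z * v).re ≤ (deriv (Φ l) z * v).re) {z : ℂ} {t : ℝ} (ht : 0 ≤ t)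
    (hz : z ∈ B) (hzt : z + t • v ∈ B) :
    (Φ l z).re - (Φ m z).re ≤ (Φ l (z + t • v)).re - (Φ m (z + t • v)).re := by
  have hmem : ∀ τ ∈ Set.Icc 0 t, z + τ • v ∈ B := fun τ hτ =>
    hB.add_smul_mem_of_mem_Icc (by simpa using hz) hzt hτ
  have hd : ∀ τ ∈ Set.Icc 0 t, HasDerivAt
      (fun τ : ℝ => (Φ l (z + τ • v)).re - (Φ m (z + τ • v)).re)
      ((deriv (Φ l) (z + τ • v) * v).re - (deriv (Φ m) (z + τ • v) * v).re) τ := fun τ hτ =>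
    (h.hasDerivAt_re_comp l (γ := fun τ : ℝ => z + τ • v) (hBO (hmem τ hτ))
      (hasDerivAt_add_smul z v τ)).sub
    (h.hasDerivAt_re_comp m (γ := fun τ : ℝ => z + τ • v) (hBO (hmem τ hτ))
      (hasDerivAt_add_smul z v τ))
  have hmono := monotoneOn_of_deriv_nonneg (convex_Icc 0 t)
    (fun τ hτ => (hd τ hτ).continuousAt.continuousWithinAt)
    (fun τ hτ => (hd τ (interior_subset hτ)).differentiableAt.differentiableWithinAt)
    (fun τ hτ => by
      rw [(hd τ (interior_subset hτ)).deriv]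
      exact sub_nonneg.2 (hs _ (hmem τ (interior_subset hτ))))
  simpa using hmono ⟨le_rfl, ht⟩ ⟨ht, le_rfl⟩ ht

/-- In a direction in which the slopes of the branches are strictly ordered, `u` lies above the
continuation of each of its branches. -/
theorem le_of_agreesNear_line [Finite ι] (h : IsPiecewiseRe O u Φ) {B : Set ℂ} (hBo : IsOpen B)
    (hBO : B ⊆ O) (hB : Convex ℝ B) {v : ℂ}
    (htri : ∀ j l, (∀ z ∈ B, (deriv (Φ j) z * v).re < (deriv (Φ l) z * v).re) ∨
      (∀ z ∈ B, (deriv (Φ j) z * v).re = (deriv (Φ l) z * v).re) ∨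
      (∀ z ∈ B, (deriv (Φ l) z * v).re < (deriv (Φ j) z * v).re)) (m : ι) {c : ℝ} {z : ℂ} {t : ℝ}
    (ht : 0 ≤ t) (hz : z ∈ B) (hzt : z + t • v ∈ B) (hm : AgreesNear u (Φ m) c z) :
    (Φ m (z + t • v)).re + c ≤ u (z + t • v) := by
  -- The induction descends through the slopes: when branch `m` is treated, all branches of larger
  -- slope are already settled.
  have hR : WellFounded fun l m : ι => (deriv (Φ m) z * v).re < (deriv (Φ l) z * v).re := by
    have h1 : IsTrans ι fun l m : ι => (deriv (Φ m) z * v).re < (deriv (Φ l) z * v).re :=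
      ⟨fun a b c hab hbc => lt_trans hbc hab⟩
    have h2 : Std.Irrefl fun l m : ι => (deriv (Φ m) z * v).re < (deriv (Φ l) z * v).re :=
      ⟨fun a => lt_irrefl _⟩
    exact Finite.wellFounded_of_trans_of_irrefl _
  suffices key : ∀ (m : ι) (c : ℝ) (p : ℂ) (t : ℝ), 0 ≤ t → p ∈ B → p + t • v ∈ B →
      AgreesNear u (Φ m) c p → (Φ m (p + t • v)).re + c ≤ u (p + t • v) from
    key m c z t ht hz hzt hm
  clear hm hzt ht t c m
  intro m
  induction m using hR.induction with
  | h m ih =>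
  intro c p t₀ ht₀ hp hpt hm
  by_contra hcon
  push Not at hcon
  have hmem : ∀ τ ∈ Set.Icc 0 t₀, p + τ • v ∈ B := fun τ hτ =>
    hB.add_smul_mem_of_mem_Icc (by simpa using hp) hpt hτ
  have hWcont : ∀ w ∈ B, ContinuousAt (fun w => u w - ((Φ m w).re + c)) w := fun w hw =>
    (h.continuousAt (hBO hw)).sub
      ((Complex.continuous_re.continuousAt.comp (h.analyticAt m (hBO hw)).continuousAt).add
        continuousAt_const)
  have hline : Continuous fun τ : ℝ => p + τ • v := by fun_prop
  let S : Set ℝ := {τ ∈ Set.Icc 0 t₀ | ¬ AgreesNear u (Φ m) c (p + τ • v)}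
  have hScl : IsClosed S := by
    have : IsOpen {w | AgreesNear u (Φ m) c w} := isOpen_iff_mem_nhds.2 fun w hw =>
      AgreesNear.eventually hw
    exact isClosed_Icc.inter (this.preimage hline).isClosed_compl
  have hSne : S.Nonempty := ⟨t₀, ⟨ht₀, le_rfl⟩, fun hag => hcon.ne hag.eq⟩
  have hSbd : BddBelow S := ⟨0, fun τ hτ => hτ.1.1⟩
  set T := sInf S with hT
  have hTS : T ∈ S := hScl.csInf_mem hSne hSbd
  have hT0 : 0 < T := lt_of_le_of_ne hTS.1.1 fun h0 => hTS.2 (by rw [← h0]; simpa using hm)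
  have hbefore : ∀ τ ∈ Set.Ico 0 T, AgreesNear u (Φ m) c (p + τ • v) := by
    intro τ hτ
    by_contra hn
    exact absurd (csInf_le hSbd (show τ ∈ S from ⟨⟨hτ.1, hτ.2.le.trans hTS.1.2⟩, hn⟩))
      (not_le.2 hτ.2)
  have hqB := hmem T hTS.1
  have hqe : u (p + T • v) = (Φ m (p + T • v)).re + c := by
    have h1 : Filter.Tendsto (fun τ : ℝ => u (p + τ • v) - ((Φ m (p + τ • v)).re + c))
        (nhdsWithin T (Set.Iio T)) (nhds (u (p + T • v) - ((Φ m (p + T • v)).re + c))) :=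
      ((hWcont _ hqB).comp (f := fun τ : ℝ => p + τ • v) hline.continuousAt).tendsto.mono_left
        nhdsWithin_le_nhds
    have h2 : Filter.Tendsto (fun τ : ℝ => u (p + τ • v) - ((Φ m (p + τ • v)).re + c))
        (nhdsWithin T (Set.Iio T)) (nhds 0) := by
      refine tendsto_const_nhds.congr' ?_
      filter_upwards [Ico_mem_nhdsLT hT0] with τ hτ
      rw [(hbefore τ hτ).eq, sub_self]
    exact sub_eq_zero.1 (tendsto_nhds_unique h1 h2)
  -- At the first time `T` at which the branch is left, the strong maximum principle forces `u` to
  -- exceed it at points arbitrarily close to `p + T • v`.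
  have hfreq : ∃ᶠ w in nhds (p + T • v), ¬ u w ≤ (Φ m w).re + c := fun hev =>
    hTS.2 (h.agreesNear_of_le (hBO hqB) hqe (by simpa using hev))
  -- near the first bad point, the translated segment starts where the branch is attained and
  -- runs towards a point where it is not
  have hev : ∀ᶠ w in nhds (p + T • v), w ∈ B ∧ w + (-T) • v ∈ B ∧
      AgreesNear u (Φ m) c (w + (-T) • v) ∧ w + (t₀ - T) • v ∈ B ∧
      u (w + (t₀ - T) • v) - ((Φ m (w + (t₀ - T) • v)).re + c) < 0 := by
    have hc1 : Continuous fun w : ℂ => w + (-T) • v := by fun_prop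
    have hc2 : Continuous fun w : ℂ => w + (t₀ - T) • v := by fun_prop
    have e1 : p + T • v + (-T) • v = p := by rw [add_assoc, ← add_smul]; simp
    have e2 : p + T • v + (t₀ - T) • v = p + t₀ • v := by rw [add_assoc, ← add_smul]; simp
    have t1 : Filter.Tendsto (fun w : ℂ => w + (-T) • v) (nhds (p + T • v)) (nhds p) := by
      have := hc1.tendsto (p + T • v)
      rwa [e1] at this
    have t2 : Filter.Tendsto (fun w : ℂ => w + (t₀ - T) • v) (nhds (p + T • v))
        (nhds (p + t₀ • v)) := by
      have := hc2.tendsto (p + T • v)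
      rwa [e2] at this
    filter_upwards [hBo.mem_nhds hqB, t1.eventually (hBo.mem_nhds hp), t1.eventually hm.eventually,
      t2.eventually (hBo.mem_nhds hpt),
      t2.eventually ((hWcont _ hpt).eventually_lt_const (sub_neg.2 hcon))] with w h1 h2 h3 h4 h5
    exact ⟨h1, h2, h3, h4, h5⟩
  obtain ⟨w₀, hw₀, hw₀e⟩ := (hfreq.and_eventually hev.eventually_nhds).exists
  have hw₀pos : ∀ᶠ w in nhds w₀, 0 < u w - ((Φ m w).re + c) :=
    (hWcont _ hw₀e.self_of_nhds.1).eventually_const_lt (sub_pos.2 (not_le.1 hw₀))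
  obtain ⟨w, ⟨hwpos, hwB, hwB0, hwag, hwB1, hwneg⟩, hwgen⟩ := exists_of_eventually_nhds_of_ae
    (hw₀pos.and hw₀e) (ae_ae_add_notMem_of_null h.null (γ := fun τ : ℝ => τ • v)
      (by fun_prop))
  have hwmem : ∀ τ ∈ Set.Icc (-T) 0, w + τ • v ∈ B := fun τ hτ =>
    hB.add_smul_mem_of_mem_Icc hwB0 (by simpa using hwB) hτ
  have hAC := h.absolutelyContinuousOnInterval_sub m c (γ := fun τ : ℝ => w + τ • v)
    (a := -T) (b := 0) (by linarith) (fun τ _ => by fun_prop) (fun τ hτ => hBO (hwmem τ hτ))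
  -- The difference rises from `0` to a positive value, so somewhere `u` is above branch `m` and
  -- follows a branch `l` of larger slope. By induction `u` stays above `l`, which moves away from
  -- `m`; this contradicts `hwneg` at the far end.
  obtain ⟨τ, hτ, hgen, hfpos, hfd⟩ := hAC.exists_pos_of_pos_deriv (by linarith)
    (by rw [hwag.eq, sub_self]) (by simpa using hwpos)
    (hwgen.mono fun τ hτ _ => hτ)
  have hτB := hwmem τ ⟨hτ.1.le, hτ.2.le⟩
  obtain ⟨l, c', hl⟩ := exists_agreesNear (hBO hτB) hgen
  rw [(h.hasDerivAt_sub_of_agreesNear m c (γ := fun τ : ℝ => w + τ • v) (hBO hτB)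
    (hasDerivAt_add_smul w v τ) hl).deriv, sub_pos] at hfd
  have hsl : ∀ z ∈ B, (deriv (Φ m) z * v).re < (deriv (Φ l) z * v).re := by
    rcases htri m l with h1 | h1 | h1
    · exact h1
    · exact absurd (h1 _ hτB) hfd.ne
    · exact absurd (h1 _ hτB) hfd.not_gt
  have hee : w + τ • v + (t₀ - T - τ) • v = w + (t₀ - T) • v := by
    rw [add_assoc, ← add_smul]; simp
  have hTt := hTS.1.2
  have htt : 0 ≤ t₀ - T - τ := by linarith [hτ.2]
  have h1 := ih l (hsl z hz) c' (w + τ • v) (t₀ - T - τ) htt hτB (by rwa [hee]) hl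
  have h2 := h.sub_le_sub_of_slope_le hBO hB (fun z hz => (hsl z hz).le) htt hτB (by rwa [hee])
  rw [hl.eq] at hfpos
  rw [hee] at h1 h2
  linarith

end IsPiecewiseRe

/-! ### Second differences, semiconvexity and monotone gradients. -/

/-- A continuous function on `[0, 1]` lies below its chord if its symmetric second differences
are positive off a countable set, and bounded below by `-o(s)` everywhere. -/
theorem le_chord_of_second_difference {f : ℝ → ℝ} (hf : ContinuousOn f (Set.Icc 0 1)) {S : Set ℝ}
    (hS : S.Countable)
    (h1 : ∀ t ∈ Set.Ioo (0 : ℝ) 1, t ∉ S →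
      ∀ᶠ s in nhdsWithin 0 (Set.Ioi 0), 2 * f t < f (t + s) + f (t - s))
    (h2 : ∀ t ∈ Set.Ioo (0 : ℝ) 1, ∀ ε > 0,
      ∀ᶠ s in nhdsWithin 0 (Set.Ioi 0), 2 * f t - ε * s ≤ f (t + s) + f (t - s))
    {y : ℝ} (hy : y ∈ Set.Icc (0 : ℝ) 1) : f y ≤ (1 - y) * f 0 + y * f 1 := by
  by_contra hcon
  push Not at hcon
  set d := f y - ((1 - y) * f 0 + y * f 1) with hd
  have hd0 : 0 < d := sub_pos.2 hcon
  -- After subtraction of the chord and of `κ * s` there is still an interior maximum `T κ`, where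
  -- second differences are nonpositive; so `T κ ∈ S`. The `-o(s)` bound excludes a common maximum
  -- for two values of `κ`, so an interval would inject into the countable set `S`.
  have hex : ∀ κ : ℝ, κ ∈ Set.Ioo 0 d → ∃ t ∈ Set.Ioo (0 : ℝ) 1, ∀ s ∈ Set.Icc (0 : ℝ) 1,
      f s - ((1 - s) * f 0 + s * f 1) - κ * s ≤ f t - ((1 - t) * f 0 + t * f 1) - κ * t := by
    intro κ hκ
    obtain ⟨t, ht, hmax⟩ := isCompact_Icc.exists_isMaxOn (Set.nonempty_Icc.2 zero_le_one)
      (f := fun s => f s - ((1 - s) * f 0 + s * f 1) - κ * s) (by fun_prop)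
    have hpos : 0 < f t - ((1 - t) * f 0 + t * f 1) - κ * t := by
      refine lt_of_lt_of_le ?_ (hmax hy)
      change 0 < f y - ((1 - y) * f 0 + y * f 1) - κ * y
      rw [← hd]
      nlinarith [hκ.1, hκ.2, hy.2]
    refine ⟨t, ⟨lt_of_le_of_ne ht.1 ?_, lt_of_le_of_ne ht.2 ?_⟩, fun s hs => hmax hs⟩
    · rintro rfl
      simp at hpos
    · rintro rfl
      have := hκ.1
      simp at hpos
      linarith
  choose! T hT hmax using hex
  have hIcc : ∀ t ∈ Set.Ioo (0 : ℝ) 1, ∀ᶠ s in nhdsWithin 0 (Set.Ioi 0),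
      t + s ∈ Set.Icc (0 : ℝ) 1 ∧ t - s ∈ Set.Icc (0 : ℝ) 1 ∧ 0 < s := by
    intro t ht
    filter_upwards [Ioo_mem_nhdsGT (show (0 : ℝ) < min t (1 - t) from
      lt_min ht.1 (sub_pos.2 ht.2))] with s hs
    have h1 := hs.2.trans_le (min_le_left _ _)
    have h2 := hs.2.trans_le (min_le_right _ _)
    have h3 := hs.1
    exact ⟨⟨by linarith [ht.1], by linarith⟩, ⟨by linarith, by linarith [ht.2]⟩, h3⟩
  have hTS : ∀ κ ∈ Set.Ioo 0 d, T κ ∈ S := by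
    intro κ hκ
    by_contra hn
    obtain ⟨s, hs1, hs2, hs3, -⟩ := ((h1 _ (hT κ hκ) hn).and (hIcc _ (hT κ hκ))).exists
    have a1 := hmax κ hκ _ hs2
    have a2 := hmax κ hκ _ hs3
    linarith
  have hlt : ∀ κ₁ ∈ Set.Ioo 0 d, ∀ κ₂ ∈ Set.Ioo 0 d, κ₁ < κ₂ → T κ₁ ≠ T κ₂ := by
    intro κ₁ hκ₁ κ₂ hκ₂ hlt heq
    obtain ⟨s, hs1, hs2, hs3, hs4⟩ :=
      ((h2 _ (hT κ₁ hκ₁) ((κ₂ - κ₁) / 2) (half_pos (sub_pos.2 hlt))).and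
        (hIcc _ (hT κ₁ hκ₁))).exists
    have a1 := hmax κ₁ hκ₁ _ hs2
    have a2 := hmax κ₂ hκ₂ (T κ₁ - s) hs3
    rw [← heq] at a2
    nlinarith
  have hinj : Set.InjOn T (Set.Ioo 0 d) := by
    intro κ₁ hκ₁ κ₂ hκ₂ heq
    rcases lt_trichotomy κ₁ κ₂ with h | h | h
    · exact absurd heq (hlt _ hκ₁ _ hκ₂ h)
    · exact h
    · exact absurd heq.symm (hlt _ hκ₂ _ hκ₁ h)
  have hcount : (Set.Ioo 0 d).Countable :=
    Set.countable_of_injective_of_countable_image hinj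
      (hS.mono (Set.image_subset_iff.2 fun κ hκ => hTS κ hκ))
  have := hcount.measure_zero volume
  rw [Real.volume_Ioo, ENNReal.ofReal_eq_zero] at this
  linarith

/-- The exceptional `v` form a proper real subspace, which is Lebesgue null. -/
theorem ae_re_mul_ne_zero {a : ℂ} (ha : a ≠ 0) : ∀ᵐ v : ℂ, (a * v).re ≠ 0 := by
  let p : Submodule ℝ ℂ := LinearMap.ker (Complex.reLm ∘ₗ LinearMap.mulLeft ℝ a)
  have hp : p ≠ ⊤ := by
    intro h
    have : a⁻¹ ∈ p := by rw [h]; trivial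
    simp [p, ha] at this
  rw [ae_iff]
  refine measure_mono_null ?_ (Measure.addHaar_submodule volume p hp)
  intro v hv
  simpa [p] using hv

section Generic

variable {ι : Type*} (Φ : ι → ℂ → ℂ)

/-- Any two of the derivatives of the `Φ j` either coincide near `q` or differ at `q`. -/
def IsNondegenerateAt (q : ℂ) : Prop :=
  ∀ j l, (∀ᶠ z in nhds q, deriv (Φ j) z = deriv (Φ l) z) ∨ deriv (Φ j) q ≠ deriv (Φ l) q

/-- The slopes at `q` of the real parts of the `Φ j` in the direction `v` differ whenever the
derivatives do. -/
def IsGenericDirection (q v : ℂ) : Prop :=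
  ∀ j l, deriv (Φ j) q ≠ deriv (Φ l) q → ((deriv (Φ j) q - deriv (Φ l) q) * v).re ≠ 0

theorem ae_isGenericDirection [Finite ι] (q : ℂ) : ∀ᵐ v : ℂ, IsGenericDirection Φ q v := by
  have := Finite.to_countable (α := ι)
  refine ae_all_iff.2 fun j => ae_all_iff.2 fun l => ?_
  by_cases h : deriv (Φ j) q = deriv (Φ l) q
  · exact Filter.Eventually.of_forall fun v hv => absurd h hv
  · filter_upwards [ae_re_mul_ne_zero (sub_ne_zero.2 h)] with v hv _ using hv

end Generic

/-- Second order Taylor estimate with locally uniform constants. -/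
theorem exists_taylor_bound {f : ℂ → ℂ} {q : ℂ} (hf : AnalyticAt ℂ f q) :
    ∃ C : ℝ, 0 ≤ C ∧ ∃ ρ > 0, ∀ z ∈ Metric.ball q ρ, ∀ w ∈ Metric.ball q ρ,
      ‖f w - f z - deriv f z * (w - z)‖ ≤ C * ‖w - z‖ ^ 2 := by
  obtain ⟨K, s, hs, hK⟩ := (hf.deriv.contDiffAt (n := 1)).exists_lipschitzOnWith
  obtain ⟨ρ, hρ, hball⟩ := Metric.eventually_nhds_iff_ball.1
    (hf.eventually_analyticAt.and hs)
  refine ⟨K, K.2, ρ, hρ, fun z hz w hw => ?_⟩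
  have hseg : segment ℝ z w ⊆ Metric.ball q ρ := (convex_ball q ρ).segment_subset hz hw
  have hd : ∀ x ∈ segment ℝ z w, HasDerivWithinAt (fun x => f x - deriv f z * x)
      (deriv f x - deriv f z) (segment ℝ z w) x := fun x hx =>
    (((hball x (hseg hx)).1.differentiableAt.hasDerivAt).sub
      (((hasDerivAt_id x).const_mul (deriv f z)).congr_deriv (by simp))).hasDerivWithinAt
  have hbd : ∀ x ∈ segment ℝ z w, ‖deriv f x - deriv f z‖ ≤ K * ‖w - z‖ := fun x hx => by
    refine (hK.norm_sub_le (hball x (hseg hx)).2 (hball z hz).2).trans ?_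
    gcongr
    exact norm_sub_le_of_mem_segment hx |>.trans (by rw [norm_sub_rev])
  have := (convex_segment z w).norm_image_sub_le_of_norm_hasDerivWithin_le hd hbd
    (left_mem_segment ℝ z w) (right_mem_segment ℝ z w)
  calc ‖f w - f z - deriv f z * (w - z)‖
      = ‖f w - deriv f z * w - (f z - deriv f z * z)‖ := by congr 1; ring
    _ ≤ K * ‖w - z‖ * ‖w - z‖ := this
    _ = K * ‖w - z‖ ^ 2 := by ring

theorem eventually_forall_mem_ball {p : ℂ → Prop} {q : ℂ} (hp : ∀ᶠ z in nhds q, p z) :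
    ∀ᶠ r in nhdsWithin (0 : ℝ) (Set.Ioi 0), ∀ z ∈ Metric.ball q r, p z := by
  obtain ⟨ε, hε, h⟩ := Metric.eventually_nhds_iff_ball.1 hp
  filter_upwards [Ioo_mem_nhdsGT hε] with r hr z hz
  exact h z (Metric.ball_subset_ball hr.2.le hz)

theorem tendsto_add_smul_nhdsGT (q v : ℂ) :
    Filter.Tendsto (fun t : ℝ => q + t • v) (nhdsWithin 0 (Set.Ioi 0)) (nhds q) := by
  have h : Continuous fun t : ℝ => q + t • v := by fun_prop
  have := h.tendsto 0
  rw [zero_smul, add_zero] at this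
  exact this.mono_left nhdsWithin_le_nhds

namespace IsPiecewiseRe

variable {ι : Type*} {O : Set ℂ} {u : ℂ → ℝ} {Φ : ι → ℂ → ℂ}

theorem ae_agreesNear (h : IsPiecewiseRe O u Φ) :
    ∀ᵐ z : ℂ, z ∈ O → ∃ j c, AgreesNear u (Φ j) c z := by
  have h1 : ∀ᵐ z : ℂ, z ∉ {z ∈ O | ∀ j c, ¬ AgreesNear u (Φ j) c z} :=
    measure_eq_zero_iff_ae_notMem.1 h.null
  filter_upwards [h1] with z hz hzO using exists_agreesNear hzO hz

/-- By continuity a strict order of the slopes at `q` persists on a small ball. This supplies the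
hypothesis `htri` of `le_of_agreesNear_line`. -/
theorem trichotomy_near [Finite ι] (h : IsPiecewiseRe O u Φ) {q v : ℂ} (hq : q ∈ O)
    (hnd : IsNondegenerateAt Φ q) (hv : IsGenericDirection Φ q v) :
    ∀ᶠ r in nhdsWithin (0 : ℝ) (Set.Ioi 0), ∀ j l,
      (∀ z ∈ Metric.ball q r, (deriv (Φ j) z * v).re < (deriv (Φ l) z * v).re) ∨
      (∀ z ∈ Metric.ball q r, (deriv (Φ j) z * v).re = (deriv (Φ l) z * v).re) ∨
      (∀ z ∈ Metric.ball q r, (deriv (Φ l) z * v).re < (deriv (Φ j) z * v).re) := by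
  refine Filter.eventually_all.2 fun j => Filter.eventually_all.2 fun l => ?_
  have hcont : ∀ j, ContinuousAt (fun z => (deriv (Φ j) z * v).re) q := fun j =>
    Complex.continuous_re.continuousAt.comp
      ((h.analyticAt j hq).deriv.continuousAt.mul continuousAt_const)
  rcases hnd j l with heq | hne
  · filter_upwards [eventually_forall_mem_ball heq] with r hr
    exact Or.inr (Or.inl fun z hz => by rw [hr z hz])
  · have := hv j l hne
    rw [sub_mul, Complex.sub_re] at this
    rcases lt_or_gt_of_ne (sub_ne_zero.1 this) with hlt | hlt
    · filter_upwards [eventually_forall_mem_ball ((hcont j).eventually_lt (hcont l) hlt)] with r hr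
      exact Or.inl hr
    · filter_upwards [eventually_forall_mem_ball ((hcont l).eventually_lt (hcont j) hlt)] with r hr
      exact Or.inr (Or.inr hr)

/-- At a generic `z` near `q`, `u` lies above the continuation of its own branch both along `v` and
along `-v`. The linear Taylor terms of that branch cancel, and continuity carries the inequality
over to `q`. -/
theorem second_difference_ge [Finite ι] (h : IsPiecewiseRe O u Φ) {D : Set ℂ} (hDO : D ⊆ O)
    {C : ℝ} (hC : ∀ j, ∀ z ∈ D, ∀ w ∈ D,
      ‖Φ j w - Φ j z - deriv (Φ j) z * (w - z)‖ ≤ C * ‖w - z‖ ^ 2)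
    {q v : ℂ} (hDq : D ∈ nhds q) (hnd : IsNondegenerateAt Φ q) (hv : IsGenericDirection Φ q v) :
    ∀ᶠ t in nhdsWithin (0 : ℝ) (Set.Ioi 0),
      2 * u q - 2 * C * (t ^ 2 * ‖v‖ ^ 2) ≤ u (q + t • v) + u (q + t • -v) := by
  have hq := hDO (mem_of_mem_nhds hDq)
  obtain ⟨r, htri, hrD, hr0⟩ := ((h.trichotomy_near hq hnd hv).and
    ((eventually_forall_mem_ball hDq).and self_mem_nhdsWithin)).exists
  have hr0 : 0 < r := hr0
  have hrD : Metric.ball q r ⊆ D := hrD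
  have htri' : ∀ j l,
      (∀ z ∈ Metric.ball q r, (deriv (Φ j) z * -v).re < (deriv (Φ l) z * -v).re) ∨
      (∀ z ∈ Metric.ball q r, (deriv (Φ j) z * -v).re = (deriv (Φ l) z * -v).re) ∨
      (∀ z ∈ Metric.ball q r, (deriv (Φ l) z * -v).re < (deriv (Φ j) z * -v).re) := by
    intro j l
    simp only [mul_neg, Complex.neg_re, neg_lt_neg_iff, neg_inj]
    rcases htri j l with h1 | h1 | h1
    · exact Or.inr (Or.inr h1)
    · exact Or.inr (Or.inl h1)
    · exact Or.inl h1
  have hball := Metric.ball_mem_nhds q hr0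
  filter_upwards [(tendsto_add_smul_nhdsGT q v).eventually hball,
    (tendsto_add_smul_nhdsGT q (-v)).eventually hball, self_mem_nhdsWithin] with t ht1 ht2 ht0
  have ht0 : 0 < t := ht0
  have ht1 : q + t • v ∈ Metric.ball q r := ht1
  have ht2 : q + t • -v ∈ Metric.ball q r := ht2
  by_contra hcon
  push Not at hcon
  have c1 : ContinuousAt (fun z => u (z + t • v)) q :=
    (h.continuousAt (hDO (hrD ht1))).comp (f := fun z => z + t • v) (by fun_prop)
  have c2 : ContinuousAt (fun z => u (z + t • -v)) q :=
    (h.continuousAt (hDO (hrD ht2))).comp (f := fun z => z + t • -v) (by fun_prop)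
  have c3 : ContinuousAt (fun z => 2 * u z - 2 * C * (t ^ 2 * ‖v‖ ^ 2)) q :=
    (continuousAt_const.mul (h.continuousAt hq)).sub continuousAt_const
  have hm1 : ∀ᶠ z in nhds q, z + t • v ∈ Metric.ball q r := by
    have : ContinuousAt (fun z : ℂ => z + t • v) q := by fun_prop
    exact this.eventually (Metric.isOpen_ball.mem_nhds ht1)
  have hm2 : ∀ᶠ z in nhds q, z + t • -v ∈ Metric.ball q r := by
    have : ContinuousAt (fun z : ℂ => z + t • -v) q := by fun_prop
    exact this.eventually (Metric.isOpen_ball.mem_nhds ht2)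
  obtain ⟨z, ⟨⟨hz1, hz2, hz3⟩, hz4⟩, hz5⟩ := exists_of_eventually_nhds_of_ae
    ((hm1.and (hm2.and hball)).and ((c1.add c2).eventually_lt c3 hcon)) h.ae_agreesNear
  have hz3 : z ∈ Metric.ball q r := hz3
  obtain ⟨m, c, hm⟩ := hz5 (hDO (hrD hz3))
  have b1 := h.le_of_agreesNear_line Metric.isOpen_ball (hrD.trans hDO) (convex_ball q r) htri m
    ht0.le hz3 hz1 hm
  have b2 := h.le_of_agreesNear_line Metric.isOpen_ball (hrD.trans hDO) (convex_ball q r) htri' m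
    ht0.le hz3 hz2 hm
  have tay : ∀ w : ℂ, z + t • w ∈ D → ‖w‖ = ‖v‖ →
      (Φ m z).re + t * (deriv (Φ m) z * w).re - C * (t ^ 2 * ‖v‖ ^ 2) ≤ (Φ m (z + t • w)).re := by
    intro w hw hwv
    have e1 := hC m z (hrD hz3) _ hw
    have e2 := (abs_le.1 ((Complex.abs_re_le_norm _).trans e1)).1
    have e3 : ‖t • w‖ ^ 2 = t ^ 2 * ‖v‖ ^ 2 := by
      rw [norm_smul, hwv, mul_pow, Real.norm_eq_abs, sq_abs]
    rw [add_sub_cancel_left, e3] at e2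
    have e4 : (deriv (Φ m) z * t • w).re = t * (deriv (Φ m) z * w).re := by
      rw [mul_smul_comm, Complex.smul_re, smul_eq_mul]
    rw [Complex.sub_re, Complex.sub_re, e4] at e2
    linarith
  have t1 := tay v (hrD hz1) rfl
  have t2 := tay (-v) (hrD hz2) (norm_neg v)
  rw [mul_neg, Complex.neg_re] at t2
  have := hm.eq
  change u (z + t • v) + u (z + t • -v) < 2 * u z - 2 * C * (t ^ 2 * ‖v‖ ^ 2) at hz4
  linarith

/-- An arbitrary direction is approximated by a generic one `v'`. Since `u` is Lipschitz, the error
at time `t` is at most `L * t * ‖v' - v‖` at each of the two points, which is why only a bound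
linear in `t` results. -/
theorem second_difference_ge_neg [Finite ι] (h : IsPiecewiseRe O u Φ) {D : Set ℂ} (hDO : D ⊆ O)
    {C : ℝ} (hC : ∀ j, ∀ z ∈ D, ∀ w ∈ D,
      ‖Φ j w - Φ j z - deriv (Φ j) z * (w - z)‖ ≤ C * ‖w - z‖ ^ 2)
    {q : ℂ} (v : ℂ) (hDq : D ∈ nhds q) (hnd : IsNondegenerateAt Φ q) {ε : ℝ} (hε : 0 < ε) :
    ∀ᶠ t in nhdsWithin (0 : ℝ) (Set.Ioi 0),
      2 * u q - ε * t ≤ u (q + t • v) + u (q + t • -v) := by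
  obtain ⟨L, hL⟩ := h.lipschitz
  have hOq : O ∈ nhds q := Filter.mem_of_superset hDq hDO
  have hnear : ∀ᶠ v' in nhds v, L * ‖v' - v‖ < ε / 4 := by
    have : Filter.Tendsto (fun v' => L * ‖v' - v‖) (nhds v) (nhds (L * ‖v - v‖)) :=
      Continuous.tendsto (by fun_prop) v
    rw [sub_self, norm_zero, mul_zero] at this
    exact this.eventually_lt_const (by positivity)
  obtain ⟨v', hv', hgen⟩ := exists_of_eventually_nhds_of_ae hnear (ae_isGenericDirection Φ q)
  have hsmall : ∀ᶠ t in nhdsWithin (0 : ℝ) (Set.Ioi 0), 2 * C * (t * ‖v'‖ ^ 2) < ε / 4 := by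
    have : Filter.Tendsto (fun t : ℝ => 2 * C * (t * ‖v'‖ ^ 2)) (nhds 0)
        (nhds (2 * C * (0 * ‖v'‖ ^ 2))) := Continuous.tendsto (by fun_prop) 0
    rw [zero_mul, mul_zero] at this
    exact (this.mono_left nhdsWithin_le_nhds).eventually_lt_const (by positivity)
  have hlip : ∀ w w' : ℂ, ‖w' - w‖ = ‖v' - v‖ → ∀ᶠ t in nhdsWithin (0 : ℝ) (Set.Ioi 0),
      u (q + t • w') - ε / 4 * t ≤ u (q + t • w) := by
    intro w w' hww
    filter_upwards [(tendsto_add_smul_nhdsGT q w).eventually hOq,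
      (tendsto_add_smul_nhdsGT q w').eventually hOq, self_mem_nhdsWithin] with t h1 h2 ht
    have ht : 0 < t := ht
    have := hL.dist_le_mul _ h2 _ h1
    rw [Real.dist_eq, dist_eq_norm, add_sub_add_left_eq_sub, ← smul_sub, norm_smul,
      Real.norm_eq_abs, abs_of_pos ht, hww] at this
    have h3 := (abs_le.1 this).2
    nlinarith
  filter_upwards [h.second_difference_ge hDO hC hDq hnd hgen, hsmall, hlip v v' rfl,
    hlip (-v) (-v') (by rw [neg_sub_neg, norm_sub_rev]), self_mem_nhdsWithin] with t h1 h2 h3 h4 ht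
  have ht : 0 < t := ht
  nlinarith

/-- Zeros of the slope difference of two branches along a line are countable. -/
theorem countable_not_isGenericDirection [Finite ι] (h : IsPiecewiseRe O u Φ) {D : Set ℂ}
    (hDc : Convex ℝ D) (hDO : D ⊆ O) {x v : ℂ} (hx : x ∈ D) (hxv : x + v ∈ D)
    (hnd : IsNondegenerateAt Φ x) (hv : IsGenericDirection Φ x v) :
    {t ∈ Set.Icc (0 : ℝ) 1 | ¬ IsGenericDirection Φ (x + t • v) v}.Countable := by
  have := Finite.to_countable (α := ι)
  have hmem : ∀ t ∈ Set.Icc (0 : ℝ) 1, x + t • v ∈ D := fun t ht =>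
    hDc.add_smul_mem_of_mem_Icc (by simpa using hx) (by simpa using hxv) ht
  have hpair : ∀ p : ι × ι, {t ∈ Set.Icc (0 : ℝ) 1 |
      deriv (Φ p.1) (x + t • v) ≠ deriv (Φ p.2) (x + t • v) ∧
      ((deriv (Φ p.1) (x + t • v) - deriv (Φ p.2) (x + t • v)) * v).re = 0}.Countable := by
    rintro ⟨j, l⟩
    rcases hnd j l with heq | hne
    · have hA : ∀ j, AnalyticOnNhd ℂ (deriv (Φ j)) D := fun j z hz =>
        (h.analyticAt j (hDO hz)).deriv
      have hEq := (hA j).eqOn_of_preconnected_of_eventuallyEq (hA l) hDc.isPreconnected hx heq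
      convert Set.countable_empty
      refine Set.eq_empty_of_forall_notMem fun t ht => ht.2.1 (hEq (hmem t ht.1))
    -- The slope difference is real analytic along the segment and nonzero at `t = 0`, so it has
    -- finitely many zeros in `[0, 1]`.
    · let f : ℝ → ℝ := fun t => ((deriv (Φ j) (x + t • v) - deriv (Φ l) (x + t • v)) * v).re
      have hfa : AnalyticOnNhd ℝ f (Set.Icc 0 1) := by
        intro t ht
        have hg : AnalyticAt ℂ (fun z => (deriv (Φ j) z - deriv (Φ l) z) * v) (x + t • v) :=
          ((h.analyticAt j (hDO (hmem t ht))).deriv.sub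
            (h.analyticAt l (hDO (hmem t ht))).deriv).mul analyticAt_const
        have hline : AnalyticAt ℝ (fun t : ℝ => x + t • v) t := by fun_prop
        exact (Complex.reCLM.analyticAt _).comp
          ((hg.restrictScalars (𝕜 := ℝ)).comp (f := fun t : ℝ => x + t • v) hline)
      have hf0 : f 0 ≠ 0 := by simpa [f] using hv j l hne
      have hcod := hfa.preimage_zero_mem_codiscreteWithin hf0 ⟨le_rfl, zero_le_one⟩
        (isConnected_Icc zero_le_one)
      refine ((isCompact_Icc.finite_sdiff_of_mem_codiscreteWithin hcod).subset ?_).countable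
      intro t ht
      refine ⟨ht.1, fun hne => hne ?_⟩
      exact ht.2.2
  refine (Set.countable_iUnion hpair).mono ?_
  rintro t ⟨ht, hg⟩
  unfold IsGenericDirection at hg
  push Not at hg
  obtain ⟨j, l, h1, h2⟩ := hg
  exact Set.mem_iUnion.2 ⟨(j, l), ht, h1, h2⟩

end IsPiecewiseRe

namespace IsPiecewiseRe

variable {ι : Type*} {O : Set ℂ} {u : ℂ → ℝ} {Φ : ι → ℂ → ℂ}

/-- By the parallelogram law the quadratic term contributes `2 (C + 1) s² ‖v‖²` to the second
difference, which outweighs the loss `2 C s² ‖v‖²` of `u` at all but countably many points of the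
segment. The centre `a` is free because changing it only adds an affine function. -/
theorem add_sq_le_chord_of_generic [Finite ι] (h : IsPiecewiseRe O u Φ) {D : Set ℂ}
    (hDo : IsOpen D) (hDc : Convex ℝ D) (hDO : D ⊆ O) {C : ℝ}
    (hC : ∀ j, ∀ z ∈ D, ∀ w ∈ D, ‖Φ j w - Φ j z - deriv (Φ j) z * (w - z)‖ ≤ C * ‖w - z‖ ^ 2)
    (hC0 : 0 ≤ C) (hnd : ∀ z ∈ D, IsNondegenerateAt Φ z) (a : ℂ) {x v : ℂ} (hx : x ∈ D)
    (hxv : x + v ∈ D) (hv : IsGenericDirection Φ x v) {y : ℝ} (hy : y ∈ Set.Icc (0 : ℝ) 1) :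
    u (x + y • v) + (C + 1) * ‖x + y • v - a‖ ^ 2 ≤
      (1 - y) * (u x + (C + 1) * ‖x - a‖ ^ 2) + y * (u (x + v) + (C + 1) * ‖x + v - a‖ ^ 2) := by
  rcases eq_or_ne v 0 with rfl | hv0
  · simp only [smul_zero, add_zero]
    apply le_of_eq
    ring
  have hvn : 0 < ‖v‖ := norm_pos_iff.2 hv0
  have hmem : ∀ t ∈ Set.Icc (0 : ℝ) 1, x + t • v ∈ D := fun t ht =>
    hDc.add_smul_mem_of_mem_Icc (by simpa using hx) (by simpa using hxv) ht
  let f : ℝ → ℝ := fun t => u (x + t • v) + (C + 1) * ‖x + t • v - a‖ ^ 2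
  have hf : ContinuousOn f (Set.Icc 0 1) := by
    have h1 : ContinuousOn (fun t : ℝ => u (x + t • v)) (Set.Icc 0 1) :=
      h.continuousOn.comp (f := fun t : ℝ => x + t • v)
        (Continuous.continuousOn (by fun_prop)) fun t ht => hDO (hmem t ht)
    exact h1.add (Continuous.continuousOn (by fun_prop))
  have hpar : ∀ t s : ℝ, f (t + s) + f (t - s) - 2 * f t =
      u (x + t • v + s • v) + u (x + t • v + s • -v) - 2 * u (x + t • v) +
        2 * (C + 1) * (s ^ 2 * ‖v‖ ^ 2) := by
    intro t s
    have e1 : x + (t + s) • v = x + t • v + s • v := by rw [add_smul]; ring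
    have e2 : x + (t - s) • v = x + t • v + s • -v := by rw [sub_smul, smul_neg]; ring
    have e3 : x + (t + s) • v - a = (x + t • v - a) + s • v := by rw [e1]; ring
    have e4 : x + (t - s) • v - a = (x + t • v - a) - s • v := by rw [e2, smul_neg]; ring
    have e5 := parallelogram_law_with_norm ℝ (x + t • v - a) (s • v)
    have e6 : ‖s • v‖ ^ 2 = s ^ 2 * ‖v‖ ^ 2 := by
      rw [norm_smul, mul_pow, Real.norm_eq_abs, sq_abs]
    simp only [f]
    rw [e3, e4, e1, e2]
    rw [e6] at e5
    linear_combination (C + 1) * e5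
  have key := le_chord_of_second_difference hf
    (h.countable_not_isGenericDirection hDc hDO hx hxv (hnd x hx) hv) ?_ ?_ hy
  · simpa [f] using key
  · intro t ht htS
    have hgen : IsGenericDirection Φ (x + t • v) v := by
      by_contra hn
      exact htS ⟨⟨ht.1.le, ht.2.le⟩, hn⟩
    have htD := hmem t ⟨ht.1.le, ht.2.le⟩
    filter_upwards [h.second_difference_ge hDO hC (hDo.mem_nhds htD) (hnd _ htD) hgen,
      self_mem_nhdsWithin] with s h1 hs
    have hs : 0 < s := hs
    have h2 := hpar t s
    have h3 : 0 < s ^ 2 * ‖v‖ ^ 2 := by positivity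
    linarith
  · intro t ht ε hε
    have htD := hmem t ⟨ht.1.le, ht.2.le⟩
    filter_upwards [h.second_difference_ge_neg hDO hC v (hDo.mem_nhds htD) (hnd _ htD) hε]
      with s h1
    have h2 := hpar t s
    have h3 : 0 ≤ 2 * (C + 1) * (s ^ 2 * ‖v‖ ^ 2) := by positivity
    linarith

/-- Near a nondegenerate point, `u` is convex up to a quadratic term. -/
theorem add_sq_le_chord [Finite ι] (h : IsPiecewiseRe O u Φ) {D : Set ℂ}
    (hDo : IsOpen D) (hDc : Convex ℝ D) (hDO : D ⊆ O) {C : ℝ}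
    (hC : ∀ j, ∀ z ∈ D, ∀ w ∈ D, ‖Φ j w - Φ j z - deriv (Φ j) z * (w - z)‖ ≤ C * ‖w - z‖ ^ 2)
    (hC0 : 0 ≤ C) (hnd : ∀ z ∈ D, IsNondegenerateAt Φ z) (a : ℂ) {x v : ℂ} (hx : x ∈ D)
    (hxv : x + v ∈ D) {y : ℝ} (hy : y ∈ Set.Icc (0 : ℝ) 1) :
    u (x + y • v) + (C + 1) * ‖x + y • v - a‖ ^ 2 ≤
      (1 - y) * (u x + (C + 1) * ‖x - a‖ ^ 2) + y * (u (x + v) + (C + 1) * ‖x + v - a‖ ^ 2) := by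
  by_contra hcon
  push Not at hcon
  have hmem : x + y • v ∈ D :=
    hDc.add_smul_mem_of_mem_Icc (a := 0) (b := 1) (by simpa using hx) (by simpa using hxv) hy
  have c1 : ContinuousAt (fun v => u (x + y • v)) v :=
    (h.continuousAt (hDO hmem)).comp (f := fun v => x + y • v) (by fun_prop)
  have c2 : ContinuousAt (fun v => u (x + v)) v :=
    (h.continuousAt (hDO hxv)).comp (f := fun v => x + v) (by fun_prop)
  have c3 : ContinuousAt (fun v => u (x + y • v) + (C + 1) * ‖x + y • v - a‖ ^ 2) v :=
    c1.add (by fun_prop)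
  have c4 : ContinuousAt (fun v => (1 - y) * (u x + (C + 1) * ‖x - a‖ ^ 2) +
      y * (u (x + v) + (C + 1) * ‖x + v - a‖ ^ 2)) v :=
    continuousAt_const.add (continuousAt_const.mul (c2.add (by fun_prop)))
  have c5 : ∀ᶠ v in nhds v, x + v ∈ D := by
    have : ContinuousAt (fun v : ℂ => x + v) v := by fun_prop
    exact this.eventually (hDo.mem_nhds hxv)
  -- Strict failure of the inequality is an open condition on `v`, so it would also occur in a
  -- generic direction.
  obtain ⟨v', ⟨h1, h2⟩, h3⟩ := exists_of_eventually_nhds_of_ae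
    ((c4.eventually_lt c3 hcon).and c5) (ae_isGenericDirection Φ x)
  exact absurd (h.add_sq_le_chord_of_generic hDo hDc hDO hC hC0 hnd a hx h2 h3 hy) (not_le.2 h1)

/-- Near a nondegenerate point, the branches of `u` support it from below up to a quadratic
term. -/
theorem support_le [Finite ι] (h : IsPiecewiseRe O u Φ) {D : Set ℂ}
    (hDo : IsOpen D) (hDc : Convex ℝ D) (hDO : D ⊆ O) {C : ℝ}
    (hC : ∀ j, ∀ z ∈ D, ∀ w ∈ D, ‖Φ j w - Φ j z - deriv (Φ j) z * (w - z)‖ ≤ C * ‖w - z‖ ^ 2)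
    (hC0 : 0 ≤ C) (hnd : ∀ z ∈ D, IsNondegenerateAt Φ z) {m : ι} {c : ℝ} {z w : ℂ} (hz : z ∈ D)
    (hw : w ∈ D) (hm : AgreesNear u (Φ m) c z) :
    u z + (deriv (Φ m) z * (w - z)).re - (C + 1) * ‖w - z‖ ^ 2 ≤ u w := by
  have hline : HasDerivAt (fun t : ℝ => z + t • (w - z)) (w - z) 0 := hasDerivAt_add_smul z _ 0
  have hd := h.hasDerivAt_sub_of_agreesNear (l := m) (c' := c) m c
    (γ := fun t : ℝ => z + t • (w - z)) (t := 0) (by simpa using hDO hz) hline (by simpa using hm)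
  have hre := h.hasDerivAt_re_comp m (γ := fun t : ℝ => z + t • (w - z)) (t := 0)
    (by simpa using hDO hz) hline
  have hu : HasDerivAt (fun t : ℝ => u (z + t • (w - z))) (deriv (Φ m) z * (w - z)).re 0 := by
    refine ((hd.add (hre.add_const c)).congr_deriv (by simp)).congr_of_eventuallyEq ?_
    exact Filter.Eventually.of_forall fun t => by simp
  have hq : HasDerivAt (fun t : ℝ => t * ((C + 1) * ‖w - z‖ ^ 2)) ((C + 1) * ‖w - z‖ ^ 2) 0 :=
    ((hasDerivAt_id (0 : ℝ)).mul_const _).congr_deriv (by simp)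
  -- The difference quotients of `u` from `z` towards `w` are bounded by convexity of `u + (C + 1)
  -- ‖· - z‖²`; their limit is the slope of the branch at `z`.
  have hlim := (hasDerivAt_iff_tendsto_slope.1 hu).mono_left
    (nhdsWithin_mono 0 (s := Set.Ioi 0) fun t ht => (Set.mem_Ioi.1 ht).ne')
  have hlim2 : Filter.Tendsto (fun t : ℝ => u w - u z + (C + 1) * ‖w - z‖ ^ 2 -
      t * ((C + 1) * ‖w - z‖ ^ 2)) (nhdsWithin 0 (Set.Ioi 0))
      (nhds (u w - u z + (C + 1) * ‖w - z‖ ^ 2)) := by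
    have : Continuous fun t : ℝ => u w - u z + (C + 1) * ‖w - z‖ ^ 2 -
      t * ((C + 1) * ‖w - z‖ ^ 2) := by fun_prop
    have := this.tendsto 0
    rw [zero_mul, sub_zero] at this
    exact this.mono_left nhdsWithin_le_nhds
  have hle := le_of_tendsto_of_tendsto hlim hlim2 ?_
  · linarith
  filter_upwards [Ioo_mem_nhdsGT zero_lt_one] with t ht
  have h1 := h.add_sq_le_chord hDo hDc hDO hC hC0 hnd z (v := w - z) hz (by simpa using hw)
    ⟨ht.1.le, ht.2.le⟩
  have e1 : ‖z + t • (w - z) - z‖ ^ 2 = t ^ 2 * ‖w - z‖ ^ 2 := by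
    rw [add_sub_cancel_left, norm_smul, mul_pow, Real.norm_eq_abs, sq_abs]
  rw [e1, add_sub_cancel, sub_self, norm_zero] at h1
  have ht0 := ht.1
  simp only [slope_def_field, zero_smul, add_zero, sub_zero]
  rw [div_le_iff₀ ht0]
  nlinarith

/-- Monotonicity, up to a quadratic term, of the gradients of the branches of `u`. -/
theorem gradient_monotone [Finite ι] (h : IsPiecewiseRe O u Φ) {D : Set ℂ}
    (hDo : IsOpen D) (hDc : Convex ℝ D) (hDO : D ⊆ O) {C : ℝ}
    (hC : ∀ j, ∀ z ∈ D, ∀ w ∈ D, ‖Φ j w - Φ j z - deriv (Φ j) z * (w - z)‖ ≤ C * ‖w - z‖ ^ 2)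
    (hC0 : 0 ≤ C) (hnd : ∀ z ∈ D, IsNondegenerateAt Φ z) {m l : ι} {c c' : ℝ} {z w : ℂ}
    (hz : z ∈ D) (hw : w ∈ D) (hm : AgreesNear u (Φ m) c z) (hl : AgreesNear u (Φ l) c' w) :
    (deriv (Φ m) z * (w - z)).re - 2 * (C + 1) * ‖w - z‖ ^ 2 ≤ (deriv (Φ l) w * (w - z)).re := by
  -- In the sum of the support inequalities at `z` and at `w` the values of `u` cancel.
  have h1 := h.support_le hDo hDc hDO hC hC0 hnd hz hw hm
  have h2 := h.support_le hDo hDc hDO hC hC0 hnd hw hz hl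
  rw [← neg_sub w z, mul_neg, Complex.neg_re, norm_neg] at h2
  linarith

end IsPiecewiseRe

namespace IsPiecewiseRe

variable {ι : Type*} {O : Set ℂ} {u : ℂ → ℝ} {Φ : ι → ℂ → ℂ}

theorem eventually_isNondegenerateAt [Finite ι] (h : IsPiecewiseRe O u Φ) {q : ℂ} (hq : q ∈ O)
    (hnd : IsNondegenerateAt Φ q) : ∀ᶠ z in nhds q, IsNondegenerateAt Φ z := by
  refine Filter.eventually_all.2 fun j => Filter.eventually_all.2 fun l => ?_
  rcases hnd j l with h1 | h1
  · filter_upwards [eventually_eventually_nhds.2 h1] with z hz using Or.inl hz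
  · filter_upwards [((h.analyticAt j hq).deriv.continuousAt.sub
      (h.analyticAt l hq).deriv.continuousAt).eventually_ne (sub_ne_zero.2 h1)] with z hz
    exact Or.inr (sub_ne_zero.1 hz)

theorem exists_gradient_monotone [Finite ι] (h : IsPiecewiseRe O u Φ) {q : ℂ} (hq : q ∈ O)
    (hnd : IsNondegenerateAt Φ q) :
    ∃ D ∈ nhds q, ∃ K : ℝ, ∀ z ∈ D, ∀ w ∈ D, ∀ m l c c', AgreesNear u (Φ m) c z →
      AgreesNear u (Φ l) c' w →
      (deriv (Φ m) z * (w - z)).re - K * ‖w - z‖ ^ 2 ≤ (deriv (Φ l) w * (w - z)).re := by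
  have := Fintype.ofFinite ι
  choose C hC0 ρ hρ hC using fun j => exists_taylor_bound (h.analyticAt j hq)
  have hball : ∀ᶠ r in nhdsWithin (0 : ℝ) (Set.Ioi 0), ∀ j, Metric.ball q r ⊆ Metric.ball q (ρ j) :=
    Filter.eventually_all.2 fun j => eventually_forall_mem_ball (Metric.ball_mem_nhds q (hρ j))
  obtain ⟨r, ⟨⟨hr1, hr2⟩, hr3⟩, hr0⟩ := (((eventually_forall_mem_ball
    (h.eventually_isNondegenerateAt hq hnd)).and (eventually_forall_mem_ball
      (h.isOpen.mem_nhds hq))).and hball |>.and self_mem_nhdsWithin).exists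
  refine ⟨Metric.ball q r, Metric.ball_mem_nhds q hr0, 2 * ((∑ j, C j) + 1),
    fun z hz w hw m l c c' hm hl => ?_⟩
  refine h.gradient_monotone Metric.isOpen_ball (convex_ball q r) hr2 (fun j z hz w hw => ?_)
    (Finset.sum_nonneg fun j _ => hC0 j) hr1 hz hw hm hl
  refine (hC j z (hr3 j hz) w (hr3 j hw)).trans ?_
  gcongr
  exact Finset.single_le_sum (fun j _ => hC0 j) (Finset.mem_univ j)

end IsPiecewiseRe

/-! ### Additive constants along curves. -/

/-- Both endpoints of the chord vary, which is why strict differentiability is needed. It is used to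
compare the gradients of `u` at two neighbouring times of a curve. -/
theorem HasStrictDerivAt.tendsto_slope {γ : ℝ → ℂ} {v : ℂ} {τ : ℝ} (h : HasStrictDerivAt γ v τ) :
    Filter.Tendsto (fun p : ℝ × ℝ => (p.2 - p.1)⁻¹ • (γ p.2 - γ p.1))
      (nhdsWithin (τ, τ) {p | p.1 < p.2}) (nhds v) := by
  have h1 := h.isLittleO
  rw [Metric.tendsto_nhds]
  intro ε hε
  have h2 := (h1.def (half_pos hε))
  have h3 : Filter.Tendsto (fun p : ℝ × ℝ => (p.2, p.1)) (nhds (τ, τ)) (nhds (τ, τ)) :=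
    Continuous.tendsto (by fun_prop) (τ, τ)
  filter_upwards [nhdsWithin_le_nhds (h3.eventually h2), self_mem_nhdsWithin] with p hp hlt
  have hlt : p.1 < p.2 := hlt
  have hpos : 0 < p.2 - p.1 := sub_pos.2 hlt
  simp only [Real.norm_eq_abs, abs_of_pos hpos] at hp
  rw [dist_eq_norm]
  have e : (p.2 - p.1)⁻¹ • (γ p.2 - γ p.1) - v =
      (p.2 - p.1)⁻¹ • (γ p.2 - γ p.1 - (p.2 - p.1) • v) := by
    rw [smul_sub _ (γ p.2 - γ p.1), smul_smul, inv_mul_cancel₀ hpos.ne', one_smul]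
  rw [e, norm_smul, norm_inv, Real.norm_eq_abs, abs_of_pos hpos, inv_mul_lt_iff₀ hpos]
  refine lt_of_le_of_lt (by simpa using hp) ?_
  nlinarith

theorem ContDiffAt.continuousAt_deriv_of_two_le {γ : ℝ → ℂ} {t : ℝ} (h : ContDiffAt ℝ 2 γ t) :
    ContinuousAt (deriv γ) t := by
  have h1 : ContDiffAt ℝ 1 (fderiv ℝ γ) t := h.fderiv_right (by norm_num)
  exact (h1.continuousAt.clm_apply continuousAt_const : ContinuousAt (fun t => fderiv ℝ γ t 1) t)

namespace IsPiecewiseRe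

variable {ι : Type*} {O : Set ℂ} {u : ℂ → ℝ} {Φ : ι → ℂ → ℂ}

/-- Locally along a curve, translated slightly, the slope of `u - Re (Φ i)` stays positive once it
is positive. -/
theorem eventually_slope_pos [Finite ι] (h : IsPiecewiseRe O u Φ) {i : ι} {γ : ℝ → ℂ} {τ : ℝ}
    (hτ : γ τ ∈ O) (hnd : IsNondegenerateAt Φ (γ τ)) (hγ : ContDiffAt ℝ 2 γ τ)
    (hsep : ∀ l, (∀ᶠ z in nhds (γ τ), deriv (Φ l) z = deriv (Φ i) z) ∨
      ((deriv (Φ l) (γ τ) - deriv (Φ i) (γ τ)) * deriv γ τ).re ≠ 0) :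
    ∀ᶠ p : (ℝ × ℝ) × ℂ in nhds ((τ, τ), 0), p.1.1 < p.1.2 → ∀ l l' c c',
      AgreesNear u (Φ l) c (p.2 + γ p.1.1) → AgreesNear u (Φ l') c' (p.2 + γ p.1.2) →
      0 < ((deriv (Φ l) (p.2 + γ p.1.1) - deriv (Φ i) (p.2 + γ p.1.1)) * deriv γ p.1.1).re →
      0 < ((deriv (Φ l') (p.2 + γ p.1.2) - deriv (Φ i) (p.2 + γ p.1.2)) * deriv γ p.1.2).re := by
  have hstrict : HasStrictDerivAt γ (deriv γ τ) τ := hγ.hasStrictDerivAt (by norm_num)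
  have hpt : ContinuousAt (fun p : ℝ × ℂ => p.2 + γ p.1) (τ, 0) :=
    continuousAt_snd.add (hγ.continuousAt.comp_of_eq continuousAt_fst rfl)
  have hpt' : Filter.Tendsto (fun p : ℝ × ℂ => p.2 + γ p.1) (nhds (τ, 0)) (nhds (γ τ)) := by
    have := hpt.tendsto
    rwa [zero_add] at this
  have hΦ : ∀ l, Filter.Tendsto (fun p : ℝ × ℂ => deriv (Φ l) (p.2 + γ p.1)) (nhds (τ, 0))
      (nhds (deriv (Φ l) (γ τ))) := fun l =>
    (h.analyticAt l hτ).deriv.continuousAt.tendsto.comp hpt'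
  have hγ' : Filter.Tendsto (fun p : ℝ × ℂ => deriv γ p.1) (nhds (τ, 0)) (nhds (deriv γ τ)) :=
    (hγ.continuousAt_deriv_of_two_le.tendsto).comp (continuousAt_fst (p := (τ, (0 : ℂ))))
  -- By `hsep` the relative slope of each branch is either identically zero near `γ τ` or nonzero at
  -- `τ`, so its positivity is locally constant.
  have hsign : ∀ l, ∀ᶠ p : ℝ × ℂ in nhds (τ, 0),
      (0 < ((deriv (Φ l) (p.2 + γ p.1) - deriv (Φ i) (p.2 + γ p.1)) * deriv γ p.1).re ↔
        0 < ((deriv (Φ l) (γ τ) - deriv (Φ i) (γ τ)) * deriv γ τ).re) := by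
    intro l
    rcases hsep l with heq | hne
    · filter_upwards [hpt'.eventually heq] with p hp
      rw [hp, heq.self_of_nhds, sub_self, sub_self, zero_mul, zero_mul]
    · have hlim := (Complex.continuous_re.tendsto _).comp (((hΦ l).sub (hΦ i)).mul hγ')
      rcases lt_or_gt_of_ne hne with hlt | hlt
      · filter_upwards [hlim.eventually_lt_const hlt] with p hp
        exact ⟨fun h0 => absurd h0 (not_lt.2 hp.le), fun h0 => absurd h0 (not_lt.2 hlt.le)⟩
      · filter_upwards [hlim.eventually_const_lt hlt] with p hp
        exact ⟨fun _ => hlt, fun _ => hp⟩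
  obtain ⟨D, hD, K, hK⟩ := h.exists_gradient_monotone hτ hnd
  have hfst : Filter.Tendsto (fun p : (ℝ × ℝ) × ℂ => (p.1.1, p.2)) (nhds ((τ, τ), 0))
      (nhds (τ, 0)) := Continuous.tendsto (by fun_prop) ((τ, τ), (0 : ℂ))
  have hsnd : Filter.Tendsto (fun p : (ℝ × ℝ) × ℂ => (p.1.2, p.2)) (nhds ((τ, τ), 0))
      (nhds (τ, 0)) := Continuous.tendsto (by fun_prop) ((τ, τ), (0 : ℂ))
  -- A passage from a branch `l` of positive relative slope to a branch `l'` of nonpositive one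
  -- would decrease the slope of `u` by a definite amount. Gradient monotonicity allows only a
  -- decrease proportional to the elapsed time.
  have hcmp : ∀ l l', 0 < ((deriv (Φ l) (γ τ) - deriv (Φ i) (γ τ)) * deriv γ τ).re →
      ¬ 0 < ((deriv (Φ l') (γ τ) - deriv (Φ i) (γ τ)) * deriv γ τ).re →
      ∀ᶠ p : (ℝ × ℝ) × ℂ in nhds ((τ, τ), 0), p.1.1 < p.1.2 → ∀ c c',
        AgreesNear u (Φ l) c (p.2 + γ p.1.1) → AgreesNear u (Φ l') c' (p.2 + γ p.1.2) →
        False := by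
    intro l l' hl hl'
    have hle : nhdsWithin ((τ, τ), (0 : ℂ)) {p : (ℝ × ℝ) × ℂ | p.1.1 < p.1.2} ≤
      nhds ((τ, τ), (0 : ℂ)) := nhdsWithin_le_nhds
    have hQ : Filter.Tendsto
        (fun p : (ℝ × ℝ) × ℂ => (p.1.2 - p.1.1)⁻¹ • (γ p.1.2 - γ p.1.1))
        (nhdsWithin ((τ, τ), (0 : ℂ)) {p | p.1.1 < p.1.2}) (nhds (deriv γ τ)) := by
      refine hstrict.tendsto_slope.comp (tendsto_nhdsWithin_iff.2
        ⟨(Continuous.tendsto continuous_fst ((τ, τ), (0 : ℂ))).mono_left hle, ?_⟩)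
      exact eventually_mem_nhdsWithin
    have hdt : Filter.Tendsto (fun p : (ℝ × ℝ) × ℂ => K * (p.1.2 - p.1.1))
        (nhdsWithin ((τ, τ), (0 : ℂ)) {p | p.1.1 < p.1.2}) (nhds 0) := by
      have h1 : Continuous fun p : (ℝ × ℝ) × ℂ => K * (p.1.2 - p.1.1) := by fun_prop
      have := h1.tendsto ((τ, τ), (0 : ℂ))
      simp only [sub_self, mul_zero] at this
      exact this.mono_left hle
    have hlim := ((Complex.continuous_re.tendsto _).comp
      (((((hΦ l').comp hsnd).sub ((hΦ l).comp hfst)).mono_left hle).mul hQ)).add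
      (hdt.mul (hQ.norm.pow 2))
    have hneg : ((deriv (Φ l') (γ τ) - deriv (Φ l) (γ τ)) * deriv γ τ).re +
        0 * ‖deriv γ τ‖ ^ 2 < 0 := by
      rw [sub_mul, Complex.sub_re] at hl hl' ⊢
      linarith
    refine eventually_nhdsWithin_iff.1
      (show ∀ᶠ p : (ℝ × ℝ) × ℂ in nhdsWithin ((τ, τ), 0) {p | p.1.1 < p.1.2}, ∀ c c',
        AgreesNear u (Φ l) c (p.2 + γ p.1.1) → AgreesNear u (Φ l') c' (p.2 + γ p.1.2) →
        False from ?_)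
    filter_upwards [hlim.eventually_lt_const hneg, hle ((hpt'.comp hfst).eventually hD),
      hle ((hpt'.comp hsnd).eventually hD), self_mem_nhdsWithin] with p h1 h2 h3 h4 c c' hc hc'
    have h4 : p.1.1 < p.1.2 := h4
    have hpos : 0 < p.1.2 - p.1.1 := sub_pos.2 h4
    have key := hK _ h2 _ h3 l l' c c' hc hc'
    simp only [Function.comp] at h1 key
    set Q := (p.1.2 - p.1.1)⁻¹ • (γ p.1.2 - γ p.1.1) with hQdef
    have e1 : p.2 + γ p.1.2 - (p.2 + γ p.1.1) = (p.1.2 - p.1.1) • Q := by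
      rw [hQdef, smul_smul, mul_inv_cancel₀ hpos.ne', one_smul]
      ring
    clear_value Q
    rw [e1, mul_smul_comm, mul_smul_comm, Complex.smul_re, Complex.smul_re, norm_smul,
      Real.norm_eq_abs, abs_of_pos hpos, smul_eq_mul, smul_eq_mul, mul_pow] at key
    rw [sub_mul, Complex.sub_re] at h1
    have := mul_neg_of_pos_of_neg hpos h1
    nlinarith
  have hall : ∀ᶠ p : (ℝ × ℝ) × ℂ in nhds ((τ, τ), 0), ∀ l l',
      0 < ((deriv (Φ l) (γ τ) - deriv (Φ i) (γ τ)) * deriv γ τ).re →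
      ¬ 0 < ((deriv (Φ l') (γ τ) - deriv (Φ i) (γ τ)) * deriv γ τ).re →
      p.1.1 < p.1.2 → ∀ c c',
        AgreesNear u (Φ l) c (p.2 + γ p.1.1) → AgreesNear u (Φ l') c' (p.2 + γ p.1.2) →
        False := by
    refine Filter.eventually_all.2 fun l => Filter.eventually_all.2 fun l' => ?_
    by_cases h1 : 0 < ((deriv (Φ l) (γ τ) - deriv (Φ i) (γ τ)) * deriv γ τ).re
    · by_cases h2 : ¬ 0 < ((deriv (Φ l') (γ τ) - deriv (Φ i) (γ τ)) * deriv γ τ).re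
      · filter_upwards [hcmp l l' h1 h2] with p hp _ _ using hp
      · exact Filter.Eventually.of_forall fun p _ h3 => absurd h3 h2
    · exact Filter.Eventually.of_forall fun p h3 => absurd h3 h1
  filter_upwards [hall, hfst.eventually (Filter.eventually_all.2 hsign),
    hsnd.eventually (Filter.eventually_all.2 hsign)] with p h1 h2 h3 hlt l l' c c' hc hc' hl
  rw [h3 l']
  rw [h2 l] at hl
  by_contra hn
  exact h1 l l' hl hn hlt c c' hc hc'

end IsPiecewiseRe

namespace IsPiecewiseRe

variable {ι : Type*} {O : Set ℂ} {u : ℂ → ℝ} {Φ : ι → ℂ → ℂ}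

/-- Along a curve on which the other branches are strictly monotone relative to `Re (Φ i)`, the
constant belonging to `Φ i` cannot increase. -/
theorem const_le_of_path [Finite ι] (h : IsPiecewiseRe O u Φ) {i : ι} {γ : ℝ → ℂ} {a b : ℝ}
    (hab : a < b) (hO : ∀ t ∈ Set.Icc a b, γ t ∈ O)
    (hnd : ∀ t ∈ Set.Icc a b, IsNondegenerateAt Φ (γ t))
    (hγ : ∀ t ∈ Set.Icc a b, ContDiffAt ℝ 2 γ t)
    (hsep : ∀ t ∈ Set.Icc a b, ∀ l, (∀ᶠ z in nhds (γ t), deriv (Φ l) z = deriv (Φ i) z) ∨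
      ((deriv (Φ l) (γ t) - deriv (Φ i) (γ t)) * deriv γ t).re ≠ 0)
    {c c' : ℝ} (hc : AgreesNear u (Φ i) c (γ a)) (hc' : AgreesNear u (Φ i) c' (γ b)) :
    c' ≤ c := by
  by_contra hcc
  push Not at hcc
  have hshift : ∀ t ∈ Set.Icc a b, Filter.Tendsto (fun p : ℂ × ℝ => p.1 + γ p.2) (nhds (0, t))
      (nhds (γ t)) := by
    intro t ht
    have : ContinuousAt (fun p : ℂ × ℝ => p.1 + γ p.2) (0, t) :=
      continuousAt_fst.add ((hγ t ht).continuousAt.comp_of_eq continuousAt_snd rfl)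
    have := this.tendsto
    rwa [zero_add] at this
  -- the curve is translated slightly, so that almost all of it avoids the exceptional set
  have hO' : ∀ᶠ s in nhds (0 : ℂ), ∀ t ∈ Set.Icc a b, s + γ t ∈ O :=
    isCompact_Icc.eventually_forall_of_forall_eventually fun t ht =>
      (hshift t ht).eventually (h.isOpen.mem_nhds (hO t ht))
  have hslope : ∀ᶠ s in nhds (0 : ℂ), ∀ t ∈ Set.Icc a b, ∀ᶠ p : ℝ × ℝ in nhds (t, t),
      p.1 < p.2 → ∀ l l' c c',
      AgreesNear u (Φ l) c (s + γ p.1) → AgreesNear u (Φ l') c' (s + γ p.2) →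
      0 < ((deriv (Φ l) (s + γ p.1) - deriv (Φ i) (s + γ p.1)) * deriv γ p.1).re →
      0 < ((deriv (Φ l') (s + γ p.2) - deriv (Φ i) (s + γ p.2)) * deriv γ p.2).re := by
    refine isCompact_Icc.eventually_forall_of_forall_eventually fun t ht => ?_
    have h1 := (h.eventually_slope_pos (hO t ht) (hnd t ht) (hγ t ht)
      (hsep t ht)).eventually_nhds
    have h2 : Filter.Tendsto (fun p : ℂ × ℝ => ((p.2, p.2), p.1)) (nhds (0, t))
        (nhds ((t, t), 0)) := Continuous.tendsto (by fun_prop) ((0 : ℂ), t)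
    filter_upwards [h2.eventually h1] with p hp
    have h3 : Filter.Tendsto (fun q : ℝ × ℝ => (q, p.1)) (nhds (p.2, p.2))
        (nhds ((p.2, p.2), p.1)) := Continuous.tendsto (by fun_prop) (p.2, p.2)
    exact h3.eventually hp
  have haI : a ∈ Set.Icc a b := ⟨le_rfl, hab.le⟩
  have hbI : b ∈ Set.Icc a b := ⟨hab.le, le_rfl⟩
  have hs0 : ∀ t : ℝ, Filter.Tendsto (fun s : ℂ => s + γ t) (nhds 0) (nhds (γ t)) := fun t => by
    have h1 : Continuous fun s : ℂ => s + γ t := by fun_prop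
    have := h1.tendsto 0
    rwa [zero_add] at this
  -- Clamping the parameter to `[a, b]` makes the curve measurable on all of `ℝ`.
  have hproj : Measurable fun t => γ (Set.projIcc a b hab.le t) := by
    refine Continuous.measurable (continuous_iff_continuousAt.2 fun t => ?_)
    exact (hγ _ (Set.projIcc a b hab.le t).2).continuousAt.comp
      (f := fun t => (Set.projIcc a b hab.le t : ℝ))
      (continuous_subtype_val.comp continuous_projIcc).continuousAt
  obtain ⟨s, ⟨⟨⟨hsO, hsl⟩, hsc⟩, hsc'⟩, hgen⟩ := exists_of_eventually_nhds_of_ae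
    (((hO'.and hslope).and ((hs0 a).eventually hc.eventually)).and
      ((hs0 b).eventually hc'.eventually)) (ae_ae_add_notMem_of_null h.null hproj)
  have hgen' : ∀ᵐ t : ℝ, t ∈ Set.Icc a b → ∃ l d, AgreesNear u (Φ l) d (s + γ t) := by
    filter_upwards [hgen] with t ht htI
    rw [Set.projIcc_of_mem hab.le htI] at ht
    exact exists_agreesNear (hsO t htI) ht
  have hAC := h.absolutelyContinuousOnInterval_sub i c (γ := fun t => s + γ t) hab.le
    (fun t ht => contDiffAt_const.add ((hγ t ht).of_le (by norm_num))) hsO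
  obtain ⟨t₁, ht₁, ⟨l₁, d₁, hl₁⟩, -, hd₁⟩ := hAC.exists_pos_of_pos_deriv hab.le
    (by rw [hsc.eq]; simp) (by rw [hsc'.eq]; linarith) hgen'
  have ht₁I : t₁ ∈ Set.Icc a b := ⟨ht₁.1.le, ht₁.2.le⟩
  have hγd : HasDerivAt (fun t => s + γ t) (deriv γ t₁) t₁ :=
    (((hγ t₁ ht₁I).differentiableAt (by norm_num)).hasDerivAt).const_add s
  rw [(h.hasDerivAt_sub_of_agreesNear i c (γ := fun t => s + γ t) (hsO t₁ ht₁I) hγd hl₁).deriv,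
    ← Complex.sub_re, ← sub_mul] at hd₁
  -- At `t₁` the slope relative to branch `i` is positive, since the difference rises from `0` to
  -- `c' - c > 0`. At `b` it is zero, since branch `i` itself is attained there. Near the infimum of
  -- `S` a positive slope would be followed by a nonpositive one, which `hsl` forbids.
  let S : Set ℝ := {t | t ∈ Set.Ioc t₁ b ∧ ∃ l d, AgreesNear u (Φ l) d (s + γ t) ∧
    ¬ 0 < ((deriv (Φ l) (s + γ t) - deriv (Φ i) (s + γ t)) * deriv γ t).re}
  have hbS : b ∈ S := ⟨⟨ht₁.2, le_rfl⟩, i, c', hsc', by simp⟩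
  have hSbd : BddBelow S := ⟨t₁, fun t ht => ht.1.1.le⟩
  set T := sInf S with hT
  have hT₁ : t₁ ≤ T := le_csInf ⟨b, hbS⟩ fun t ht => ht.1.1.le
  have hTb : T ≤ b := csInf_le hSbd hbS
  obtain ⟨η, hη, hball⟩ := Metric.eventually_nhds_iff_ball.1 (hsl T ⟨ht₁.1.le.trans hT₁, hTb⟩)
  obtain ⟨t, htS, htη⟩ := exists_lt_of_csInf_lt ⟨b, hbS⟩ (lt_add_of_pos_right T hη)
  have hTt : T ≤ t := csInf_le hSbd htS
  obtain ⟨⟨htt₁, htb⟩, l, d, hld, hneg⟩ := htS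
  have hmemball : ∀ {x y : ℝ}, |x - T| < η → |y - T| < η → (x, y) ∈ Metric.ball (T, T) η := by
    intro x y hx hy
    rw [← ball_prod_same]
    exact ⟨by rwa [Metric.mem_ball, Real.dist_eq], by rwa [Metric.mem_ball, Real.dist_eq]⟩
  have htT : |t - T| < η := abs_lt.2 ⟨by linarith, by linarith⟩
  obtain ⟨t', ht'η, ht't, l', d', hld', hpos⟩ : ∃ t', |t' - T| < η ∧ t' < t ∧ ∃ l' d',
      AgreesNear u (Φ l') d' (s + γ t') ∧
      0 < ((deriv (Φ l') (s + γ t') - deriv (Φ i) (s + γ t')) * deriv γ t').re := by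
    rcases hT₁.eq_or_lt with heq | hlt
    · refine ⟨t₁, by rw [← heq]; simpa using hη, htt₁, l₁, d₁, hl₁, hd₁⟩
    · obtain ⟨t', hg, ht'⟩ := (Measure.dense_of_ae hgen').exists_mem_open isOpen_Ioo
        (Set.nonempty_Ioo.2 (max_lt hlt (sub_lt_self T hη)))
      obtain ⟨ht'l, ht'r⟩ := ht'
      have h1 := (le_max_left _ _).trans_lt ht'l
      have h2 := (le_max_right _ _).trans_lt ht'l
      obtain ⟨l', d', hl'⟩ := hg ⟨ht₁.1.le.trans h1.le, ht'r.le.trans hTb⟩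
      refine ⟨t', abs_lt.2 ⟨by linarith, by linarith⟩, ht'r.trans_le hTt, l', d', hl', ?_⟩
      by_contra hn
      exact absurd (csInf_le hSbd (show t' ∈ S from ⟨⟨h1, ht'r.le.trans hTb⟩, l', d', hl', hn⟩))
        (not_le.2 ht'r)
  exact hneg (hball _ (hmemball ht'η htT) ht't l' l d' d hld' hld hpos)

/-- Along a curve on which the other branches are strictly monotone relative to `Re (Φ i)`, the
constants belonging to `Φ i` agree. -/
theorem const_eq_of_path [Finite ι] (h : IsPiecewiseRe O u Φ) {i : ι} {γ : ℝ → ℂ} {a b : ℝ}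
    (hab : a < b) (hO : ∀ t ∈ Set.Icc a b, γ t ∈ O)
    (hnd : ∀ t ∈ Set.Icc a b, IsNondegenerateAt Φ (γ t))
    (hγ : ∀ t ∈ Set.Icc a b, ContDiffAt ℝ 2 γ t)
    (hsep : ∀ t ∈ Set.Icc a b, ∀ l, (∀ᶠ z in nhds (γ t), deriv (Φ l) z = deriv (Φ i) z) ∨
      ((deriv (Φ l) (γ t) - deriv (Φ i) (γ t)) * deriv γ t).re ≠ 0)
    {c c' : ℝ} (hc : AgreesNear u (Φ i) c (γ a)) (hc' : AgreesNear u (Φ i) c' (γ b)) :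
    c = c' := by
  refine le_antisymm ?_ (h.const_le_of_path hab hO hnd hγ hsep hc hc')
  have hI : ∀ t ∈ Set.Icc (-b) (-a), -t ∈ Set.Icc a b := fun t ht =>
    ⟨by linarith [ht.2], by linarith [ht.1]⟩
  refine h.const_le_of_path (i := i) (γ := fun t => γ (-t)) (neg_lt_neg hab)
    (fun t ht => hO _ (hI t ht)) (fun t ht => hnd _ (hI t ht))
    (fun t ht => (hγ _ (hI t ht)).comp t contDiff_neg.contDiffAt) (fun t ht l => ?_)
    (by simpa using hc') (by simpa using hc)
  refine (hsep _ (hI t ht) l).imp id fun hne => ?_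
  rw [deriv_comp_neg, mul_neg, Complex.neg_re]
  exact neg_ne_zero.2 hne

end IsPiecewiseRe

/-! ### Local finiteness of the additive constants. -/

namespace IsPiecewiseRe

variable {ι : Type*} {O : Set ℂ} {u : ℂ → ℝ} {Φ : ι → ℂ → ℂ}

/-- Zeros of a difference of two derivatives are isolated unless it vanishes near `p`. Consequently
every point of the punctured ball is nondegenerate, even if `p` is not. -/
theorem exists_ball_dichotomy [Finite ι] (h : IsPiecewiseRe O u Φ) {p : ℂ} (hp : p ∈ O) :
    ∃ r > 0, Metric.ball p r ⊆ O ∧ ∀ j l,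
      ((∀ᶠ z in nhds p, deriv (Φ j) z = deriv (Φ l) z) ∧
        ∀ z ∈ Metric.ball p r, deriv (Φ j) z = deriv (Φ l) z) ∨
      ((¬ ∀ᶠ z in nhds p, deriv (Φ j) z = deriv (Φ l) z) ∧
        ∀ z ∈ Metric.ball p r, z ≠ p → deriv (Φ j) z ≠ deriv (Φ l) z) := by
  have h1 : ∀ᶠ r in nhdsWithin (0 : ℝ) (Set.Ioi 0), ∀ j l,
      ((∀ᶠ z in nhds p, deriv (Φ j) z = deriv (Φ l) z) ∧
        ∀ z ∈ Metric.ball p r, deriv (Φ j) z = deriv (Φ l) z) ∨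
      ((¬ ∀ᶠ z in nhds p, deriv (Φ j) z = deriv (Φ l) z) ∧
        ∀ z ∈ Metric.ball p r, z ≠ p → deriv (Φ j) z ≠ deriv (Φ l) z) := by
    refine Filter.eventually_all.2 fun j => Filter.eventually_all.2 fun l => ?_
    by_cases heq : ∀ᶠ z in nhds p, deriv (Φ j) z = deriv (Φ l) z
    · filter_upwards [eventually_forall_mem_ball heq] with r hr using Or.inl ⟨heq, hr⟩
    · have := ((h.analyticAt j hp).deriv.eventually_eq_or_eventually_ne
        (h.analyticAt l hp).deriv).resolve_left heq
      filter_upwards [eventually_forall_mem_ball (eventually_nhdsWithin_iff.1 this)] with r hr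
      exact Or.inr ⟨heq, hr⟩
  obtain ⟨r, ⟨hr1, hr2⟩, hr0⟩ := ((h1.and (eventually_forall_mem_ball
    (h.isOpen.mem_nhds hp))).and self_mem_nhdsWithin).exists
  exact ⟨r, hr0, hr2, hr1⟩

/-- Near every point of the domain only finitely many additive constants occur. -/
theorem exists_finite_const [Finite ι] (h : IsPiecewiseRe O u Φ) {p : ℂ} (hp : p ∈ O) (i : ι) :
    ∃ r > 0, {c | ∃ z ∈ Metric.ball p r, AgreesNear u (Φ i) c z}.Finite := by
  by_contra hcon
  push Not at hcon
  obtain ⟨r, hr0, hrO, hdich⟩ := h.exists_ball_dichotomy hp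
  -- Only branches whose derivative is not locally that of `Φ i` need to be separated from it; `φ j`
  -- is the relative branch normalized to vanish at `p`.
  let J := {j : ι // ¬ ∀ᶠ z in nhds p, deriv (Φ j) z = deriv (Φ i) z}
  let φ : J → ℂ → ℂ := fun j w => Φ j (p + w) - Φ i (p + w) - (Φ j p - Φ i p)
  have hφd : ∀ (j : J) (w : ℂ), p + w ∈ O →
      HasDerivAt (φ j) (deriv (Φ j) (p + w) - deriv (Φ i) (p + w)) w := fun j w hw =>
    (((h.hasDerivAt j hw).comp_const_add p w).sub
      ((h.hasDerivAt i hw).comp_const_add p w)).sub_const _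
  have hφa : ∀ j, AnalyticAt ℂ (φ j) 0 := by
    intro j
    have hl : AnalyticAt ℂ (fun w : ℂ => p + w) 0 := by fun_prop
    have e : p + 0 = p := add_zero p
    exact (((h.analyticAt j hp).comp_of_eq hl e).sub
      ((h.analyticAt i hp).comp_of_eq hl e)).sub analyticAt_const
  have hφ0 : ∀ j, φ j 0 = 0 := fun j => by simp [φ]
  have hnear : Filter.Tendsto (fun w : ℂ => p + w) (nhds 0) (nhds p) := by
    have := (show Continuous fun w : ℂ => p + w by fun_prop).tendsto 0
    rwa [add_zero] at this
  have hsubp : Filter.Tendsto (fun z : ℂ => z - p) (nhds p) (nhds 0) := by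
    have := (show Continuous fun w : ℂ => w - p by fun_prop).tendsto p
    rwa [sub_self] at this
  have hnz : ∀ j, ¬ ∀ᶠ w in nhds 0, φ j w = 0 := by
    intro j hj
    refine j.2 ?_
    filter_upwards [hsubp.eventually hj.eventually_nhds, h.isOpen.mem_nhds hp] with z hz hzO
    have h1 : HasDerivAt (φ j) 0 (z - p) :=
      (hasDerivAt_const (z - p) (0 : ℂ)).congr_of_eventuallyEq hz
    have h2 := hφd j (z - p) (by rwa [add_sub_cancel])
    rw [add_sub_cancel] at h2
    exact sub_eq_zero.1 (h2.unique h1)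
  -- Each constant occurs on an open set, so its point may be moved off `p`, and then along a
  -- generic line off the zero sets of the `Re (φ j)`, whose derivatives along that line do not
  -- vanish.
  have hstep : ∀ ρ > 0, ∀ s : Finset ℝ, ∃ (c : ℝ) (z : ℂ), c ∉ s ∧ ‖z‖ < ρ ∧ z ≠ 0 ∧
      AgreesNear u (Φ i) c (p + z) ∧ ∀ j, (φ j z).re ≠ 0 := by
    intro ρ hρ s
    obtain ⟨c, ⟨z₀, hz₀, hag⟩, hcs⟩ := (hcon (min ρ r) (lt_min hρ hr0)).exists_notMem_finset s
    have hz₀' : ∀ᶠ z in nhds z₀, z ∈ Metric.ball p (min ρ r) := Metric.isOpen_ball.mem_nhds hz₀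
    obtain ⟨z₁, ⟨hz₁, hag₁⟩, hne⟩ := exists_of_eventually_nhds_of_ae
      (hz₀'.and hag.eventually) (show ∀ᵐ z : ℂ, z ≠ p by simp [ae_iff])
    have hz₁r : z₁ ∈ Metric.ball p r := Metric.ball_subset_ball (min_le_right _ _) hz₁
    obtain ⟨v, hv⟩ := (ae_isGenericDirection Φ z₁).exists
    have hline : Filter.Tendsto (fun t : ℝ => z₁ + t • v) (nhdsWithin 0 {0}ᶜ) (nhds z₁) := by
      have := (show Continuous fun t : ℝ => z₁ + t • v by fun_prop).tendsto 0
      rw [zero_smul, add_zero] at this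
      exact this.mono_left nhdsWithin_le_nhds
    have hre : ∀ j : J, ∀ᶠ t : ℝ in nhdsWithin 0 {0}ᶜ, (φ j (z₁ + t • v - p)).re ≠ 0 := by
      intro j
      have hd1 : HasDerivAt (fun t : ℝ => z₁ + t • v - p) v 0 :=
        (hasDerivAt_add_smul z₁ v 0).sub_const p
      have hd2 := hφd j (z₁ - p) (by rw [add_sub_cancel]; exact hrO hz₁r)
      have hd3 : HasDerivAt (fun t : ℝ => (φ j (z₁ + t • v - p)).re)
          ((deriv (Φ j) z₁ - deriv (Φ i) z₁) * v).re 0 := by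
        have hd4 : HasDerivAt (φ j) (deriv (Φ j) z₁ - deriv (Φ i) z₁) (z₁ + (0 : ℝ) • v - p) := by
          rw [zero_smul, add_zero]
          rwa [add_sub_cancel] at hd2
        exact Complex.reCLM.hasFDerivAt.comp_hasDerivAt (0 : ℝ) (hd4.comp (0 : ℝ) hd1)
      refine hd3.eventually_ne (hv j i ?_)
      exact ((hdich j i).resolve_left fun h' => j.2 h'.1).2 z₁ hz₁r hne
    obtain ⟨t, ht1, ht2, ht3, ht4⟩ := ((Filter.eventually_all.2 hre).and
      ((hline.eventually (Metric.isOpen_ball.mem_nhds hz₁)).and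
        ((hline.eventually hag₁.eventually).and
          (hline.eventually (isOpen_ne.mem_nhds hne))))).exists
    have ht2 : z₁ + t • v ∈ Metric.ball p (min ρ r) := ht2
    rw [Metric.mem_ball, dist_eq_norm] at ht2
    refine ⟨c, z₁ + t • v - p, hcs, ht2.trans_le (min_le_left _ _), sub_ne_zero.2 ht4, ?_, ht1⟩
    rwa [add_sub_cancel]
  -- The recursion produces pairwise distinct constants at points whose norms at least halve, so the
  -- points tend to the origin.
  obtain ⟨f, hf, hfr⟩ := exists_seq_of_forall_finset_exists
    (fun x : ℝ × ℂ => x.2 ≠ 0 ∧ AgreesNear u (Φ i) x.1 (p + x.2) ∧ ∀ j, (φ j x.2).re ≠ 0)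
    (fun x y : ℝ × ℂ => x.1 ≠ y.1 ∧ ‖y.2‖ ≤ ‖x.2‖ / 2) fun s hs => by
      have hev : ∀ᶠ ρ in nhdsWithin (0 : ℝ) (Set.Ioi 0), ∀ x ∈ s, ρ ≤ ‖x.2‖ / 2 := by
        refine (Filter.eventually_all_finset s).2 fun x hx => ?_
        have hpos : 0 < ‖x.2‖ / 2 := half_pos (norm_pos_iff.2 (hs x hx).1)
        filter_upwards [Ioo_mem_nhdsGT hpos] with ρ hρ using hρ.2.le
      obtain ⟨ρ, hρ, hρ0⟩ := (hev.and self_mem_nhdsWithin).exists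
      obtain ⟨c, z, h1, h2, h3, h4, h5⟩ := hstep ρ hρ0 (s.image Prod.fst)
      refine ⟨(c, z), ⟨h3, h4, h5⟩, fun x hx => ⟨fun heq => h1 ?_, h2.le.trans (hρ x hx)⟩⟩
      exact Finset.mem_image.2 ⟨x, hx, heq⟩
  have hgeo : ∀ n, ‖(f n).2‖ ≤ ‖(f 0).2‖ * (1 / 2) ^ n := by
    intro n
    induction n with
    | zero => simp
    | succ n ih =>
      have := (hfr n (n + 1) (Nat.lt_succ_self n)).2
      rw [pow_succ]
      linarith
  have hlim : Filter.Tendsto (fun n => (f n).2) Filter.atTop (nhds 0) := by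
    refine squeeze_zero_norm hgeo ?_
    have := (tendsto_pow_atTop_nhds_zero_of_lt_one (r := (1 / 2 : ℝ)) (by norm_num)
      (by norm_num)).const_mul ‖(f 0).2‖
    rwa [mul_zero] at this
  obtain ⟨m, n, hmn, a, b, γ, hab, hγa, hγb, hγ⟩ := exists_monotonePath hφa hφ0 hnz hlim
    (fun n => (hf n).1) (fun j n => (hf n).2.2 j) hr0
  have hball : ∀ t ∈ Set.Icc a b, p + γ t ∈ Metric.ball p r := fun t ht => by
    rw [Metric.mem_ball, dist_eq_norm, add_sub_cancel_left]
    exact (hγ t ht).2.2.1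
  have hne : ∀ t ∈ Set.Icc a b, p + γ t ≠ p := fun t ht => by
    simpa using (hγ t ht).2.1
  have heq : (f m).1 = (f n).1 := by
    refine h.const_eq_of_path (γ := fun t => p + γ t) (i := i) hab (fun t ht => hrO (hball t ht))
      (fun t ht j l => ?_) (fun t ht => contDiffAt_const.add (hγ t ht).1) (fun t ht l => ?_)
      (by rw [hγa]; exact (hf m).2.1) (by rw [hγb]; exact (hf n).2.1)
    · rcases hdich j l with h1 | h1
      · exact Or.inl (Filter.mem_of_superset (Metric.isOpen_ball.mem_nhds (hball t ht)) h1.2)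
      · exact Or.inr (h1.2 _ (hball t ht) (hne t ht))
    · rcases hdich l i with h1 | h1
      · exact Or.inl (Filter.mem_of_superset (Metric.isOpen_ball.mem_nhds (hball t ht)) h1.2)
      · right
        have h2 := (hγ t ht).2.2.2 ⟨l, h1.1⟩
        rwa [(hφd ⟨l, h1.1⟩ (γ t) (hrO (hball t ht))).deriv,
          ← deriv_const_add p (f := γ) (x := t)] at h2
  rcases lt_or_gt_of_ne hmn with hlt | hlt
  · exact (hfr m n hlt).1 heq
  · exact (hfr n m hlt).1 heq.symm

end IsPiecewiseRe

/-! ### Gronwall's inequality for weak derivatives. -/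

/-- A function on a disc whose derivative is bounded by a multiple of the function satisfies
Gronwall's inequality. -/
theorem le_exp_mul_of_fderiv_le {m : ℂ → ℝ} {m' : ℂ → ℂ →L[ℝ] ℝ} {p : ℂ} {r L : ℝ}
    (hm : ∀ z ∈ Metric.ball p r, HasFDerivAt m (m' z) z)
    (hle : ∀ z ∈ Metric.ball p r, ∀ v, m' z v ≤ L * ‖v‖ * m z) {z w : ℂ}
    (hz : z ∈ Metric.ball p r) (hw : w ∈ Metric.ball p r) :
    m z ≤ Real.exp (L * ‖z - w‖) * m w := by
  have hmem : ∀ s ∈ Set.Icc (0 : ℝ) 1, w + s • (z - w) ∈ Metric.ball p r := fun s hs =>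
    (convex_ball p r).add_smul_mem_of_mem_Icc (a := 0) (b := 1) (by simpa using hw)
      (by simpa using hz) hs
  have hd : ∀ s ∈ Set.Icc (0 : ℝ) 1, HasDerivAt
      (fun s : ℝ => m (w + s • (z - w)) * Real.exp (-(L * ‖z - w‖) * s))
      (m' (w + s • (z - w)) (z - w) * Real.exp (-(L * ‖z - w‖) * s) +
        m (w + s • (z - w)) * (Real.exp (-(L * ‖z - w‖) * s) * (-(L * ‖z - w‖)))) s := by
    intro s hs
    have h1 := (hm _ (hmem s hs)).comp_hasDerivAt s (hasDerivAt_add_smul w (z - w) s)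
    have h2 : HasDerivAt (fun s : ℝ => -(L * ‖z - w‖) * s) (-(L * ‖z - w‖)) s := by
      simpa using (hasDerivAt_id s).const_mul (-(L * ‖z - w‖))
    exact h1.mul h2.exp
  have hanti := antitoneOn_of_deriv_nonpos (convex_Icc (0 : ℝ) 1)
    (fun s hs => (hd s hs).continuousAt.continuousWithinAt)
    (fun s hs => (hd s (interior_subset hs)).differentiableAt.differentiableWithinAt)
    (fun s hs => by
      rw [(hd s (interior_subset hs)).deriv]
      have h1 := hle _ (hmem s (interior_subset hs)) (z - w)
      have h2 := Real.exp_pos (-(L * ‖z - w‖) * s)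
      nlinarith)
  have h := hanti ⟨le_rfl, zero_le_one⟩ ⟨zero_le_one, le_rfl⟩ zero_le_one
  simp only [one_smul, add_sub_cancel, zero_smul, add_zero, mul_one, mul_zero, Real.exp_zero] at h
  rw [Real.exp_neg] at h
  rw [mul_comm]
  exact (div_le_iff₀ (Real.exp_pos _)).1 (by rwa [div_eq_mul_inv])

open scoped Convolution ContDiff in
open ContinuousLinearMap in
/-- A function whose distribution derivatives are bounded by a multiple of the function satisfies
Gronwall's inequality almost everywhere. -/
theorem exists_null_le_exp_mul {f : ℂ → ℝ} {D : ℂ → ℂ → ℝ} {p : ℂ} {R r L : ℝ} (hrR : r < R)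
    (hf : IntegrableOn f (Metric.ball p R))
    (hD : ∀ v, ∀ᵐ z, z ∈ Metric.ball p R → |D v z| ≤ L * ‖v‖ * f z)
    (hweak : ∀ φ : ℂ → ℝ, ContDiff ℝ ∞ φ → HasCompactSupport φ → tsupport φ ⊆ Metric.ball p R →
      ∀ v, ∫ z, f z * fderiv ℝ φ z v = -∫ z, φ z * D v z) :
    ∃ N : Set ℂ, volume N = 0 ∧ ∀ z ∈ Metric.ball p r, z ∉ N → ∀ w ∈ Metric.ball p r, w ∉ N →
      f z ≤ Real.exp (L * ‖z - w‖) * f w := by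
  let F : ℂ → ℝ := (Metric.ball p R).indicator f
  have hFint : Integrable F := hf.integrable_indicator Metric.isOpen_ball.measurableSet
  have hF : LocallyIntegrable F := hFint.locallyIntegrable
  -- The ratio of outer to inner radius stays equal to `2`, as almost everywhere convergence of the
  -- mollifications requires a bounded ratio.
  let ψ : ℕ → ContDiffBump (0 : ℂ) := fun n =>
    ⟨1 / ((n : ℝ) + 1) / 2, 1 / ((n : ℝ) + 1), by positivity, half_lt_self (by positivity)⟩
  have hψ0 : Filter.Tendsto (fun n => (ψ n).rOut) Filter.atTop (nhds 0) :=
    tendsto_one_div_add_atTop_nhds_zero_nat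
  have hlim := ContDiffBump.ae_convolution_tendsto_right_of_locallyIntegrable (μ := volume)
    (K := 2) hψ0 (Filter.Eventually.of_forall fun n => by
      change 1 / ((n : ℝ) + 1) ≤ 2 * (1 / ((n : ℝ) + 1) / 2)
      linarith) hF
  -- The exceptional set consists of the points where the mollifications fail to converge. Because
  -- the mollifier is nonnegative, each mollification satisfies the derivative bound pointwise, and
  -- the inequality passes to the limit.
  refine ⟨_, ae_iff.1 hlim, fun z hz hzN w hw hwN => ?_⟩
  simp only [Set.mem_ofPred_eq, not_not] at hzN hwN
  have hzR : F z = f z := Set.indicator_of_mem (Metric.ball_subset_ball hrR.le hz) _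
  have hwR : F w = f w := Set.indicator_of_mem (Metric.ball_subset_ball hrR.le hw) _
  rw [hzR] at hzN
  rw [hwR] at hwN
  refine le_of_tendsto_of_tendsto hzN (hwN.const_mul _) ?_
  filter_upwards [hψ0.eventually_lt_const (sub_pos.2 hrR)] with n hn
  set χ := (ψ n).normed volume with hχ
  have hχc : HasCompactSupport χ := (ψ n).hasCompactSupport_normed
  have hχs : ContDiff ℝ ∞ χ := (ψ n).contDiff_normed
  have hconv : ∀ x, (χ ⋆[lsmul ℝ ℝ, volume] F) x = (F ⋆[lsmul ℝ ℝ, volume] χ) x := fun x => by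
    rw [convolution_lsmul_swap, convolution_lsmul]
    simp only [smul_eq_mul, mul_comm]
  rw [hconv z, hconv w]
  refine le_exp_mul_of_fderiv_le (p := p) (r := r)
    (fun x _ => hχc.hasFDerivAt_convolution_right _ hF (hχs.of_le (by norm_num)) x)
    (fun x hx v => ?_) hz hw
  rw [convolution_precompR_apply _ hF (hχc.fderiv ℝ) (hχs.continuous_fderiv (by norm_num)),
    convolution_lsmul, convolution_lsmul]
  -- the translated and reflected bump function serves as a test function
  let φ : ℂ → ℝ := fun t => χ (x - t)
  have hφs : ContDiff ℝ ∞ φ := hχs.comp (contDiff_const.sub contDiff_id)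
  have hsupp : ∀ t, φ t ≠ 0 → t ∈ Metric.closedBall x (ψ n).rOut := by
    intro t ht
    have h1 : x - t ∈ Function.support χ := ht
    rw [(ψ n).support_normed_eq, mem_ball_zero_iff] at h1
    rw [Metric.mem_closedBall, dist_eq_norm, norm_sub_rev]
    exact h1.le
  have htsupp : tsupport φ ⊆ Metric.closedBall x (ψ n).rOut :=
    closure_minimal hsupp Metric.isClosed_closedBall
  have hcb : Metric.closedBall x (ψ n).rOut ⊆ Metric.ball p R := by
    intro t ht
    have h1 : dist t x ≤ (ψ n).rOut := ht
    have h2 : dist x p < r := hx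
    exact lt_of_le_of_lt (dist_triangle t x p) (by linarith)
  have hφc : HasCompactSupport φ :=
    HasCompactSupport.of_support_subset_isCompact (isCompact_closedBall x (ψ n).rOut) hsupp
  have hφd : ∀ t, fderiv ℝ φ t v = -fderiv ℝ χ (x - t) v := by
    intro t
    have h1 : HasFDerivAt φ ((fderiv ℝ χ (x - t)).comp (-(ContinuousLinearMap.id ℝ ℂ))) t :=
      ((hχs.differentiable (by norm_num)) (x - t)).hasFDerivAt.comp t
        ((hasFDerivAt_id t).const_sub x)
    rw [h1.fderiv]
    simp
  have hw := hweak φ hφs hφc (htsupp.trans hcb) v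
  have hout : ∀ t, t ∉ Metric.ball p R → φ t = 0 ∧ fderiv ℝ φ t v = 0 := by
    intro t ht
    have h1 : t ∉ tsupport φ := fun h => ht (hcb (htsupp h))
    refine ⟨image_eq_zero_of_notMem_tsupport h1, ?_⟩
    have h2 : t ∉ tsupport (fderiv ℝ φ) := fun h => h1 (tsupport_fderiv_subset ℝ h)
    rw [image_eq_zero_of_notMem_tsupport h2]
    rfl
  have hFφ : ∀ t, F t * fderiv ℝ χ (x - t) v = -(f t * fderiv ℝ φ t v) := by
    intro t
    rw [hφd]
    by_cases ht : t ∈ Metric.ball p R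
    · rw [show F t = f t from Set.indicator_of_mem ht _]
      ring
    · have := (hout t ht).2
      rw [hφd, neg_eq_zero] at this
      rw [this]
      simp
  simp only [smul_eq_mul]
  rw [integral_congr_ae (Filter.Eventually.of_forall hFφ), integral_neg, hw, neg_neg,
    ← integral_const_mul]
  have hφ0 : ∀ t, 0 ≤ φ t := fun t => (ψ n).nonneg_normed _
  refine (le_abs_self _).trans ?_
  rw [← Real.norm_eq_abs]
  refine (norm_integral_le_integral_norm _).trans
    (integral_mono_of_nonneg (Filter.Eventually.of_forall fun t => norm_nonneg _) ?_ ?_)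
  · have h1 : Integrable fun t => F t * χ (x - t) := by
      obtain ⟨C, hC⟩ := hχc.exists_bound_of_continuous hχs.continuous
      exact hFint.mul_bdd (c := C) (hχs.continuous.comp (by fun_prop)).aestronglyMeasurable
        (Filter.Eventually.of_forall fun t => hC _)
    exact h1.const_mul _
  · filter_upwards [hD v] with t ht
    by_cases htR : t ∈ Metric.ball p R
    · rw [show F t = f t from Set.indicator_of_mem htR _, Real.norm_eq_abs, abs_mul,
        abs_of_nonneg (hφ0 t)]
      calc φ t * |D v t| ≤ φ t * (L * ‖v‖ * f t) := mul_le_mul_of_nonneg_left (ht htR) (hφ0 t)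
        _ = L * ‖v‖ * (f t * χ (x - t)) := by ring
    · rw [(hout t htR).1, show F t = 0 from Set.indicator_of_notMem htR _]
      simp

/-! ### Energy estimate and identification of the weak derivative. -/

theorem integrable_of_bounded_of_support {α : Type*} [MeasurableSpace α] {μ : Measure α}
    {g : α → ℝ} (hg : Measurable g) {C : ℝ} (hC : ∀ᵐ x ∂μ, |g x| ≤ C) {B : Set α}
    (hB : μ B ≠ ⊤) (hs : ∀ x, x ∉ B → g x = 0) : Integrable g μ := by
  have h : IntegrableOn g B μ := Measure.integrableOn_of_bounded (M := C) hB
    hg.aestronglyMeasurable (ae_restrict_of_ae hC)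
  exact (integrableOn_iff_integrable_of_support_subset fun x hx => by
    by_contra hn
    exact hx (hs x hn)).1 h

open scoped ContDiff in
theorem exists_taylor_bound_of_hasCompactSupport {φ : ℂ → ℝ} (hφ : ContDiff ℝ ∞ φ)
    (hc : HasCompactSupport φ) :
    ∃ C, 0 ≤ C ∧ ∀ z h, |φ (z + h) - φ z - fderiv ℝ φ z h| ≤ C * ‖h‖ ^ 2 := by
  obtain ⟨K, hK⟩ := (hφ.fderiv_right (m := 1)
    (WithTop.coe_le_coe.2 (le_top : (1 + 1 : ℕ∞) ≤ ⊤))).lipschitzWith_of_hasCompactSupport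
    (hc.fderiv ℝ) one_ne_zero
  refine ⟨K, K.2, fun z h => ?_⟩
  have := (convex_closedBall z ‖h‖).norm_image_sub_le_of_norm_fderiv_le' (f := φ) (x := z)
    (y := z + h) (C := K * ‖h‖) (φ := fderiv ℝ φ z) (fun x _ => hφ.differentiable (by norm_num) x)
    (fun x hx => (hK.norm_sub_le x z).trans (by
      gcongr
      simpa [dist_eq_norm] using hx)) (Metric.mem_closedBall_self (norm_nonneg h))
      (by simp [dist_eq_norm])
  rw [add_sub_cancel_left, Real.norm_eq_abs] at this
  calc _ ≤ K * ‖h‖ * ‖h‖ := this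
    _ = K * ‖h‖ ^ 2 := by ring

/-- The uniform measure on angles. -/
noncomputable def angleMeasure : Measure ℝ := volume.restrict (Set.Ioc 0 (2 * Real.pi))

instance : IsFiniteMeasure angleMeasure := by
  unfold angleMeasure
  infer_instance

/-- Sine and cosine have mean zero over a period. This removes the first order Taylor term in the
energy estimate. -/
theorem integral_angleMeasure_linear (ℓ : ℂ →L[ℝ] ℝ) (r : ℝ) :
    ∫ θ, ℓ (circleMap 0 r θ) ∂angleMeasure = 0 := by
  have h : ∀ θ : ℝ, ℓ (circleMap 0 r θ) = r * ℓ 1 * Real.cos θ + r * ℓ Complex.I * Real.sin θ := by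
    intro θ
    have : circleMap 0 r θ = (r * Real.cos θ) • (1 : ℂ) + (r * Real.sin θ) • Complex.I := by
      apply Complex.ext <;> simp [circleMap, Complex.cos_ofReal_re, Complex.sin_ofReal_re]
    rw [this, map_add, map_smul, map_smul, smul_eq_mul, smul_eq_mul]
    ring
  simp_rw [h]
  rw [angleMeasure, ← intervalIntegral.integral_of_le Real.two_pi_pos.le,
    intervalIntegral.integral_add (Continuous.intervalIntegrable (by fun_prop) _ _)
      (Continuous.intervalIntegrable (by fun_prop) _ _),
    intervalIntegral.integral_const_mul, intervalIntegral.integral_const_mul, integral_cos,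
    integral_sin]
  simp

theorem measurable_shift (r : ℝ) : Measurable fun x : ℂ × ℝ => x.1 + circleMap 0 r x.2 :=
  measurable_fst.add ((continuous_circleMap 0 r).measurable.comp measurable_snd)

theorem measurable_shift_sub (r : ℝ) : Measurable fun x : ℂ × ℝ => x.1 - circleMap 0 r x.2 :=
  measurable_fst.sub ((continuous_circleMap 0 r).measurable.comp measurable_snd)

theorem norm_circleMap_zero' {r : ℝ} (hr : 0 ≤ r) (θ : ℝ) : ‖circleMap 0 r θ‖ = r := by
  rw [norm_circleMap_zero, abs_of_nonneg hr]

theorem prod_angleMeasure_ne_top (p : ℂ) (R : ℝ) :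
    (volume.prod angleMeasure) (Metric.ball p R ×ˢ Set.univ) ≠ ⊤ := by
  rw [Measure.prod_prod]
  exact ENNReal.mul_ne_top measure_ball_lt_top.ne (measure_ne_top _ _)

open scoped ContDiff in
/-- The energy estimate for bounded functions with the sub-mean value property. -/
theorem exists_energy_bound {E : ℂ → ℝ} (hE : Measurable E) {M : ℝ} (hE0 : ∀ z, 0 ≤ E z)
    (hEM : ∀ z, E z ≤ M) {p : ℂ} {R : ℝ}
    (hsub : ∀ c r, 0 < r → Metric.closedBall c r ⊆ Metric.ball p R → E c ≤ Real.circleAverage E c r)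
    {φ : ℂ → ℝ} (hφ : ContDiff ℝ ∞ φ) (hc : HasCompactSupport φ)
    (hs : tsupport φ ⊆ Metric.ball p R) :
    ∃ C, 0 ≤ C ∧ ∀ᶠ r in nhdsWithin (0 : ℝ) (Set.Ioi 0),
      ∫ x, (φ x.1 * (E (x.1 + circleMap 0 r x.2) - E x.1)) ^ 2 ∂(volume.prod angleMeasure) ≤
        C * r ^ 2 := by
  have hM : 0 ≤ M := (hE0 0).trans (hEM 0)
  obtain ⟨r₀, hr₀, hthick⟩ : ∃ r₀ > 0, ∀ z, φ z ≠ 0 → Metric.closedBall z r₀ ⊆ Metric.ball p R := by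
    obtain ⟨δ, hδ, h⟩ := hc.isCompact.exists_cthickening_subset_open Metric.isOpen_ball hs
    exact ⟨δ, hδ, fun z hz => (Metric.closedBall_subset_cthickening
      (subset_tsupport φ hz) δ).trans h⟩
  -- With `E_r` the translate of `E`, `χ (E_r - E)² = χ E_r² - χ E² + 2 χ E (E - E_r)`. The last
  -- term has nonpositive integral by the sub-mean value property. In the first, the translation is
  -- moved onto `χ`, whose linear Taylor term averages to zero over the circle, leaving `O(r²)`.
  let χ : ℂ → ℝ := fun z => φ z ^ 2
  have hχ : ContDiff ℝ ∞ χ := hφ.pow 2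
  have hχc : HasCompactSupport χ := by
    have : χ = fun z => φ z * φ z := funext fun z => sq (φ z)
    rw [this]
    exact hc.mul_left
  obtain ⟨C, hC0, hC⟩ := exists_taylor_bound_of_hasCompactSupport hχ hχc
  obtain ⟨A, hA⟩ := hχc.exists_bound_of_continuous hχ.continuous
  obtain ⟨A', hA'⟩ := (hχc.fderiv ℝ).exists_bound_of_continuous (hχ.continuous_fderiv (by norm_num))
  have hA0 : 0 ≤ A := (norm_nonneg _).trans (hA 0)
  have hA'0 : 0 ≤ A' := (norm_nonneg _).trans (hA' 0)
  set B : Set (ℂ × ℝ) := Metric.ball p (R + r₀) ×ˢ Set.univ with hB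
  have hBm : MeasurableSet B := Metric.isOpen_ball.measurableSet.prod MeasurableSet.univ
  have hBt := prod_angleMeasure_ne_top p (R + r₀)
  have hχball : ∀ z, χ z ≠ 0 → z ∈ Metric.ball p R := fun z hz =>
    hs (subset_tsupport φ fun h => hz (by simp [χ, h]))
  have hχ'ball : ∀ z, z ∉ Metric.ball p R → fderiv ℝ χ z = 0 := by
    intro z hz
    refine image_eq_zero_of_notMem_tsupport fun h => hz ?_
    have h1 : tsupport χ ⊆ tsupport φ := closure_mono fun z hz => by
      exact fun h => hz (by simp [χ, h])
    exact hs (h1 (tsupport_fderiv_subset ℝ h))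
  have hout : ∀ x : ℂ × ℝ, x ∉ B → χ x.1 = 0 ∧ fderiv ℝ χ x.1 = 0 := by
    intro x hx
    have h1 : x.1 ∉ Metric.ball p R := fun h => hx
      ⟨Metric.ball_subset_ball (by linarith) h, trivial⟩
    refine ⟨?_, hχ'ball _ h1⟩
    by_contra h
    exact h1 (hχball _ h)
  have hχm : Measurable χ := hχ.continuous.measurable
  have hE1 : Measurable fun x : ℂ × ℝ => E x.1 := hE.comp measurable_fst
  have hχ1 : Measurable fun x : ℂ × ℝ => χ x.1 := hχm.comp measurable_fst
  have habsE : ∀ z, |E z| ≤ M := fun z => by rw [abs_of_nonneg (hE0 z)]; exact hEM z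
  refine ⟨M ^ 2 * C * (volume.prod angleMeasure).real B, by positivity, ?_⟩
  filter_upwards [Ioo_mem_nhdsGT hr₀] with r ⟨hr0, hrr⟩
  have hEr : Measurable fun x : ℂ × ℝ => E (x.1 + circleMap 0 r x.2) := hE.comp (measurable_shift r)
  have hχr : Measurable fun x : ℂ × ℝ => χ (x.1 - circleMap 0 r x.2) :=
    hχm.comp (measurable_shift_sub r)
  have houtr : ∀ x : ℂ × ℝ, x ∉ B → χ (x.1 - circleMap 0 r x.2) = 0 := by
    intro x hx
    by_contra h
    have h1 : dist (x.1 - circleMap 0 r x.2) p < R := hχball _ h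
    refine hx ⟨?_, trivial⟩
    have h2 : dist x.1 (x.1 - circleMap 0 r x.2) = r := by
      rw [dist_eq_norm, sub_sub_cancel, norm_circleMap_zero' hr0.le]
    have := dist_triangle x.1 (x.1 - circleMap 0 r x.2) p
    exact Metric.mem_ball.2 (by linarith)
  have hint1 : Integrable (fun x : ℂ × ℝ => χ x.1 * E (x.1 + circleMap 0 r x.2) ^ 2)
      (volume.prod angleMeasure) :=
    integrable_of_bounded_of_support (C := A * M ^ 2) (hχ1.mul (hEr.pow_const 2))
      (Filter.Eventually.of_forall fun x => by
      rw [abs_mul, abs_pow (E _)]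
      exact mul_le_mul (hA _) (pow_le_pow_left₀ (abs_nonneg _) (habsE _) 2) (by positivity) hA0)
      hBt fun x hx => by rw [(hout x hx).1, zero_mul]
  have hint2 : Integrable (fun x : ℂ × ℝ => χ x.1 * E x.1 ^ 2) (volume.prod angleMeasure) :=
    integrable_of_bounded_of_support (C := A * M ^ 2) (hχ1.mul (hE1.pow_const 2))
      (Filter.Eventually.of_forall fun x => by
      rw [abs_mul, abs_pow (E _)]
      exact mul_le_mul (hA _) (pow_le_pow_left₀ (abs_nonneg _) (habsE _) 2) (by positivity) hA0)
      hBt fun x hx => by rw [(hout x hx).1, zero_mul]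
  have hint3 : Integrable (fun x : ℂ × ℝ => 2 * χ x.1 * E x.1 *
      (E x.1 - E (x.1 + circleMap 0 r x.2))) (volume.prod angleMeasure) :=
    integrable_of_bounded_of_support (C := 2 * A * M * (M + M))
      (((hχ1.const_mul 2).mul hE1).mul (hE1.sub hEr)) (Filter.Eventually.of_forall fun x => by
        rw [abs_mul, abs_mul, abs_mul, abs_two]
        refine mul_le_mul (mul_le_mul (mul_le_mul_of_nonneg_left (hA _) zero_le_two) (habsE _)
          (abs_nonneg _) (by positivity)) ?_ (abs_nonneg _) (by positivity)
        exact (abs_sub _ _).trans (add_le_add (habsE _) (habsE _)))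
      hBt fun x hx => by rw [(hout x hx).1, mul_zero, zero_mul, zero_mul]
  have hint4 : Integrable (fun x : ℂ × ℝ => χ (x.1 - circleMap 0 r x.2) * E x.1 ^ 2)
      (volume.prod angleMeasure) :=
    integrable_of_bounded_of_support (C := A * M ^ 2) (hχr.mul (hE1.pow_const 2))
      (Filter.Eventually.of_forall fun x => by
      rw [abs_mul, abs_pow (E _)]
      exact mul_le_mul (hA _) (pow_le_pow_left₀ (abs_nonneg _) (habsE _) 2) (by positivity) hA0)
      hBt fun x hx => by rw [houtr x hx, zero_mul]
  have hfm : Measurable fun x : ℂ × ℝ => fderiv ℝ χ x.1 (circleMap 0 r x.2) := by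
    have h1 : Continuous fun x : ℂ × ℝ => fderiv ℝ χ x.1 (circleMap 0 r x.2) :=
      ((hχ.continuous_fderiv (by norm_num)).comp continuous_fst).clm_apply
        ((continuous_circleMap 0 r).comp continuous_snd)
    exact h1.measurable
  have hint5 : Integrable (fun x : ℂ × ℝ => E x.1 ^ 2 * fderiv ℝ χ x.1 (circleMap 0 r x.2))
      (volume.prod angleMeasure) :=
    integrable_of_bounded_of_support (C := M ^ 2 * (A' * r)) ((hE1.pow_const 2).mul hfm)
      (Filter.Eventually.of_forall fun x => by
        rw [abs_mul, abs_pow (E _)]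
        refine mul_le_mul (pow_le_pow_left₀ (abs_nonneg _) (habsE _) 2) ?_ (abs_nonneg _)
          (by positivity)
        rw [← Real.norm_eq_abs]
        refine (ContinuousLinearMap.le_opNorm _ _).trans ?_
        rw [norm_circleMap_zero' hr0.le]
        exact mul_le_mul_of_nonneg_right (hA' _) hr0.le)
      hBt fun x hx => by rw [(hout x hx).2]; simp
  have hint12 : Integrable (fun x : ℂ × ℝ =>
      χ x.1 * E (x.1 + circleMap 0 r x.2) ^ 2 - χ x.1 * E x.1 ^ 2) (volume.prod angleMeasure) :=
    hint1.sub hint2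
  have hint42 : Integrable (fun x : ℂ × ℝ =>
      χ (x.1 - circleMap 0 r x.2) * E x.1 ^ 2 - χ x.1 * E x.1 ^ 2) (volume.prod angleMeasure) :=
    hint4.sub hint2
  -- the cross term has a sign by the sub-mean value property
  have hcross : ∫ x, 2 * χ x.1 * E x.1 * (E x.1 - E (x.1 + circleMap 0 r x.2))
      ∂(volume.prod angleMeasure) ≤ 0 := by
    rw [integral_prod _ hint3]
    refine integral_nonpos fun z => ?_
    change ∫ θ, 2 * χ z * E z * (E z - E (z + circleMap 0 r θ)) ∂angleMeasure ≤ 0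
    rw [integral_const_mul]
    by_cases hz : φ z = 0
    · simp [χ, hz]
    have h1 := hsub z r hr0 ((Metric.closedBall_subset_closedBall hrr.le).trans (hthick z hz))
    have h2 : Integrable (fun θ => E (z + circleMap 0 r θ)) angleMeasure :=
      Integrable.of_bound (hE.comp (measurable_const.add
        (continuous_circleMap 0 r).measurable)).aestronglyMeasurable M
        (Filter.Eventually.of_forall fun θ => habsE _)
    have h3 : ∫ θ, E (z + circleMap 0 r θ) ∂angleMeasure =
        2 * Real.pi * Real.circleAverage E z r := by
      rw [Real.circleAverage_def, smul_eq_mul, mul_inv_cancel_left₀ Real.two_pi_pos.ne',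
        intervalIntegral.integral_of_le Real.two_pi_pos.le]
      simp [circleMap, angleMeasure]
    have h4 : (∫ θ, (E z - E (z + circleMap 0 r θ)) ∂angleMeasure) ≤ 0 := by
      rw [integral_sub (integrable_const _) h2, h3, integral_const]
      have : angleMeasure.real Set.univ = 2 * Real.pi := by
        simp [angleMeasure, Real.two_pi_pos.le]
      rw [this, smul_eq_mul]
      nlinarith [Real.two_pi_pos]
    have h5 : 0 ≤ 2 * χ z * E z := mul_nonneg (mul_nonneg zero_le_two (sq_nonneg _)) (hE0 z)
    exact mul_nonpos_of_nonneg_of_nonpos h5 h4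
  have hshift : ∫ x, χ x.1 * E (x.1 + circleMap 0 r x.2) ^ 2 ∂(volume.prod angleMeasure) =
      ∫ x, χ (x.1 - circleMap 0 r x.2) * E x.1 ^ 2 ∂(volume.prod angleMeasure) := by
    rw [integral_prod_symm _ hint1, integral_prod_symm _ hint4]
    congr 1
    funext θ
    rw [← integral_add_right_eq_self (fun z => χ (z - circleMap 0 r θ) * E z ^ 2) (circleMap 0 r θ)]
    simp
  have hlin : ∫ x, E x.1 ^ 2 * fderiv ℝ χ x.1 (circleMap 0 r x.2) ∂(volume.prod angleMeasure) =
      0 := by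
    rw [integral_prod _ hint5]
    simp only [integral_const_mul, integral_angleMeasure_linear, mul_zero, integral_zero]
  have hint6 : Integrable (fun x : ℂ × ℝ => B.indicator (fun _ => M ^ 2 * (C * r ^ 2)) x)
      (volume.prod angleMeasure) := (integrable_indicator_iff hBm).2
        (integrableOn_const hBt)
  calc ∫ x, (φ x.1 * (E (x.1 + circleMap 0 r x.2) - E x.1)) ^ 2 ∂(volume.prod angleMeasure)
      = ∫ x, (χ x.1 * E (x.1 + circleMap 0 r x.2) ^ 2 - χ x.1 * E x.1 ^ 2 +
          2 * χ x.1 * E x.1 * (E x.1 - E (x.1 + circleMap 0 r x.2)))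
          ∂(volume.prod angleMeasure) := by
        congr 1
        funext x
        simp only [χ]
        ring
    _ = (∫ x, χ (x.1 - circleMap 0 r x.2) * E x.1 ^ 2 ∂(volume.prod angleMeasure)) -
          (∫ x, χ x.1 * E x.1 ^ 2 ∂(volume.prod angleMeasure)) +
          ∫ x, 2 * χ x.1 * E x.1 * (E x.1 - E (x.1 + circleMap 0 r x.2))
          ∂(volume.prod angleMeasure) := by
        rw [integral_add hint12 hint3, integral_sub hint1 hint2, hshift]
    _ ≤ (∫ x, χ (x.1 - circleMap 0 r x.2) * E x.1 ^ 2 ∂(volume.prod angleMeasure)) -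
          (∫ x, χ x.1 * E x.1 ^ 2 ∂(volume.prod angleMeasure)) +
          ∫ x, E x.1 ^ 2 * fderiv ℝ χ x.1 (circleMap 0 r x.2) ∂(volume.prod angleMeasure) := by
        rw [hlin]
        linarith
    _ = ∫ x, (χ (x.1 - circleMap 0 r x.2) * E x.1 ^ 2 - χ x.1 * E x.1 ^ 2 +
          E x.1 ^ 2 * fderiv ℝ χ x.1 (circleMap 0 r x.2)) ∂(volume.prod angleMeasure) := by
        rw [integral_add hint42 hint5, integral_sub hint4 hint2]
    _ ≤ ∫ x, B.indicator (fun _ => M ^ 2 * (C * r ^ 2)) x ∂(volume.prod angleMeasure) := by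
        refine integral_mono (hint42.add hint5) hint6 fun x => ?_
        change χ (x.1 - circleMap 0 r x.2) * E x.1 ^ 2 - χ x.1 * E x.1 ^ 2 +
          E x.1 ^ 2 * fderiv ℝ χ x.1 (circleMap 0 r x.2) ≤ _
        by_cases hx : x ∈ B
        · rw [Set.indicator_of_mem hx]
          have h1 := hC x.1 (-circleMap 0 r x.2)
          rw [← sub_eq_add_neg, norm_neg, norm_circleMap_zero' hr0.le, map_neg,
            sub_neg_eq_add] at h1
          calc χ (x.1 - circleMap 0 r x.2) * E x.1 ^ 2 - χ x.1 * E x.1 ^ 2 +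
              E x.1 ^ 2 * fderiv ℝ χ x.1 (circleMap 0 r x.2)
              = E x.1 ^ 2 * (χ (x.1 - circleMap 0 r x.2) - χ x.1 +
                fderiv ℝ χ x.1 (circleMap 0 r x.2)) := by ring
            _ ≤ E x.1 ^ 2 * (C * r ^ 2) :=
              mul_le_mul_of_nonneg_left ((le_abs_self _).trans h1) (sq_nonneg _)
            _ ≤ M ^ 2 * (C * r ^ 2) :=
              mul_le_mul_of_nonneg_right (pow_le_pow_left₀ (hE0 _) (hEM _) 2) (by positivity)
        · rw [Set.indicator_of_notMem hx, houtr x hx, (hout x hx).1, (hout x hx).2]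
          simp
    _ = M ^ 2 * C * (volume.prod angleMeasure).real B * r ^ 2 := by
        rw [integral_indicator_const _ hBm, smul_eq_mul]
        ring

/-- Splits off a truncated part, to which dominated convergence applies, from a tail controlled by
an `L²` bound. -/
theorem abs_le_min_add_sq_div (y : ℝ) {lam : ℝ} (hl : 0 < lam) :
    |y| ≤ min |y| lam + y ^ 2 / lam := by
  rcases le_total |y| lam with h | h
  · rw [min_eq_left h]
    have : 0 ≤ y ^ 2 / lam := by positivity
    linarith
  · rw [min_eq_right h]
    have : |y| ≤ y ^ 2 / lam := by
      rw [le_div_iff₀ hl, ← sq_abs]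
      nlinarith [abs_nonneg y]
    linarith

/-- A continuous nonnegative integrand of integral zero vanishes; the angles `π / 2` and `2 π`
isolate `b` and `a`. -/
theorem eq_zero_of_integral_abs_cos_sin_le {a b : ℝ}
    (h : ∫ θ, |Real.cos θ * a + Real.sin θ * b| ∂angleMeasure ≤ 0) : a = 0 ∧ b = 0 := by
  have hc : Continuous fun θ : ℝ => |Real.cos θ * a + Real.sin θ * b| := by fun_prop
  have hint : Integrable (fun θ : ℝ => |Real.cos θ * a + Real.sin θ * b|) angleMeasure :=
    (hc.integrableOn_Icc (a := 0) (b := 2 * Real.pi)).mono_set Set.Ioc_subset_Icc_self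
  have h0 := le_antisymm h (integral_nonneg fun θ => abs_nonneg _)
  rw [integral_eq_zero_iff_of_nonneg (fun θ => abs_nonneg _) hint] at h0
  have heq := Measure.eqOn_Ioc_of_ae_eq (μ := volume) h0 hc.continuousOn
    continuousOn_const
  have hpi := Real.pi_pos
  have h1 := heq (show Real.pi / 2 ∈ Set.Ioc 0 (2 * Real.pi) from ⟨by linarith, by linarith⟩)
  have h2 := heq (show 2 * Real.pi ∈ Set.Ioc 0 (2 * Real.pi) from ⟨by linarith, le_rfl⟩)
  simp only [Real.cos_pi_div_two, Real.sin_pi_div_two, Real.cos_two_pi, Real.sin_two_pi] at h1 h2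
  simpa using And.intro h2 h1

theorem apply_eq_re_im (ℓ : ℂ →L[ℝ] ℝ) (v : ℂ) : ℓ v = v.re * ℓ 1 + v.im * ℓ Complex.I := by
  have : v = v.re • (1 : ℂ) + v.im • Complex.I := by
    apply Complex.ext <;> simp
  conv_lhs => rw [this]
  rw [map_add, map_smul, map_smul, smul_eq_mul, smul_eq_mul]

theorem circleMap_zero_eq_smul (r θ : ℝ) : circleMap 0 r θ = r • circleMap 0 1 θ := by
  simp [circleMap]

open scoped ContDiff in
/-- A bounded function with the sub-mean value property, which is differentiable with bounded
derivative off a null set, has its classical derivative as weak derivative. -/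
theorem integral_mul_fderiv_eq_neg {E : ℂ → ℝ} (hE : Measurable E) {M : ℝ} (hE0 : ∀ z, 0 ≤ E z)
    (hEM : ∀ z, E z ≤ M) {p : ℂ} {R : ℝ}
    (hsub : ∀ c r, 0 < r → Metric.closedBall c r ⊆ Metric.ball p R → E c ≤ Real.circleAverage E c r)
    {L : ℝ} (hL : 0 ≤ L) (hd : ∀ᵐ z, z ∈ Metric.ball p R →
      DifferentiableAt ℝ E z ∧ ‖fderiv ℝ E z‖ ≤ L)
    {φ : ℂ → ℝ} (hφ : ContDiff ℝ ∞ φ) (hc : HasCompactSupport φ)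
    (hs : tsupport φ ⊆ Metric.ball p R) (v : ℂ) :
    ∫ z, E z * fderiv ℝ φ z v = -∫ z, φ z * fderiv ℝ E z v := by
  have hM : 0 ≤ M := (hE0 0).trans (hEM 0)
  have habsE : ∀ z, |E z| ≤ M := fun z => by rw [abs_of_nonneg (hE0 z)]; exact hEM z
  obtain ⟨C, hC0, hC⟩ := exists_taylor_bound_of_hasCompactSupport hφ hc
  obtain ⟨C₂, hC₂0, hen⟩ := exists_energy_bound hE hE0 hEM hsub hφ hc hs
  obtain ⟨A, hA⟩ := hc.exists_bound_of_continuous hφ.continuous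
  obtain ⟨A', hA'⟩ := (hc.fderiv ℝ).exists_bound_of_continuous (hφ.continuous_fderiv (by norm_num))
  have hA0 : 0 ≤ A := (norm_nonneg _).trans (hA 0)
  have hA'0 : 0 ≤ A' := (norm_nonneg _).trans (hA' 0)
  have hφ0 : ∀ z, z ∉ Metric.ball p R → φ z = 0 := fun z hz =>
    image_eq_zero_of_notMem_tsupport fun h => hz (hs h)
  have hφ'0 : ∀ z, z ∉ Metric.ball p R → fderiv ℝ φ z = 0 := fun z hz =>
    image_eq_zero_of_notMem_tsupport fun h => hz (hs (tsupport_fderiv_subset ℝ h))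
  have hφm : Measurable φ := hφ.continuous.measurable
  have hφ'm : ∀ w, Measurable fun z => fderiv ℝ φ z w := fun w =>
    ((hφ.continuous_fderiv (by norm_num)).clm_apply continuous_const).measurable
  have hE'm : ∀ w, Measurable fun z => fderiv ℝ E z w := fun w =>
    measurable_fderiv_apply_const ℝ E w
  have hφE'bd : ∀ᵐ z, ∀ w, |φ z * fderiv ℝ E z w| ≤ A * (L * ‖w‖) := by
    filter_upwards [hd] with z hz w
    by_cases hzb : z ∈ Metric.ball p R
    · rw [abs_mul]
      refine mul_le_mul (hA z) ?_ (abs_nonneg _) hA0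
      rw [← Real.norm_eq_abs]
      exact (ContinuousLinearMap.le_opNorm _ _).trans
        (mul_le_mul_of_nonneg_right (hz hzb).2 (norm_nonneg _))
    · rw [hφ0 z hzb, zero_mul, abs_zero]
      positivity
  have hi1 : ∀ w, Integrable fun z => E z * fderiv ℝ φ z w := fun w =>
    integrable_of_bounded_of_support (C := M * (A' * ‖w‖)) (hE.mul (hφ'm w))
      (Filter.Eventually.of_forall fun z => by
        rw [abs_mul]
        refine mul_le_mul (habsE z) ?_ (abs_nonneg _) hM
        rw [← Real.norm_eq_abs]
        exact (ContinuousLinearMap.le_opNorm _ _).trans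
          (mul_le_mul_of_nonneg_right (hA' z) (norm_nonneg _)))
      measure_ball_lt_top.ne fun z hz => by rw [hφ'0 z hz]; simp
  have hi2 : ∀ w, Integrable fun z => φ z * fderiv ℝ E z w := fun w =>
    integrable_of_bounded_of_support (C := A * (L * ‖w‖)) (hφm.mul (hE'm w))
      (hφE'bd.mono fun z hz => hz w) measure_ball_lt_top.ne fun z hz => by rw [hφ0 z hz, zero_mul]
  -- `ℓ w` is the defect of the integration by parts formula in the direction `w`. As it is real
  -- linear in `w`, it suffices that the mean of `|ℓ|` over the unit circle is zero.
  let ℓ : ℂ → ℝ := fun w => (∫ z, E z * fderiv ℝ φ z w) + ∫ z, φ z * fderiv ℝ E z w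
  have hℓ : ∀ w, ℓ w = w.re * ℓ 1 + w.im * ℓ Complex.I := by
    intro w
    have e1 : ∫ z, E z * fderiv ℝ φ z w = w.re * (∫ z, E z * fderiv ℝ φ z 1) +
        w.im * ∫ z, E z * fderiv ℝ φ z Complex.I := by
      rw [← integral_const_mul, ← integral_const_mul,
        ← integral_add ((hi1 1).const_mul _) ((hi1 Complex.I).const_mul _)]
      congr 1
      funext z
      rw [apply_eq_re_im (fderiv ℝ φ z) w]
      ring
    have e2 : ∫ z, φ z * fderiv ℝ E z w = w.re * (∫ z, φ z * fderiv ℝ E z 1) +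
        w.im * ∫ z, φ z * fderiv ℝ E z Complex.I := by
      rw [← integral_const_mul, ← integral_const_mul,
        ← integral_add ((hi2 1).const_mul _) ((hi2 Complex.I).const_mul _)]
      congr 1
      funext z
      rw [apply_eq_re_im (fderiv ℝ E z) w]
      ring
    simp only [ℓ]
    rw [e1, e2]
    ring
  let P : Measure (ℂ × ℝ) := volume.prod angleMeasure
  -- The quotients `r⁻¹ * q r` converge to `d` almost everywhere along `r = 1 / (n + 1)` and are
  -- bounded in `L²` by the energy estimate; together this gives convergence in `L¹`.
  let q : ℝ → ℂ × ℝ → ℝ := fun r x => φ x.1 * (E (x.1 + circleMap 0 r x.2) - E x.1)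
  let d : ℂ × ℝ → ℝ := fun x => φ x.1 * fderiv ℝ E x.1 (circleMap 0 1 x.2)
  set B : Set (ℂ × ℝ) := Metric.ball p R ×ˢ Set.univ with hB
  have hBm : MeasurableSet B := Metric.isOpen_ball.measurableSet.prod MeasurableSet.univ
  have hBt : P B ≠ ⊤ := prod_angleMeasure_ne_top p R
  have hout : ∀ x : ℂ × ℝ, x ∉ B → φ x.1 = 0 := fun x hx => hφ0 _ fun h => hx ⟨h, trivial⟩
  have hqm : ∀ r, Measurable (q r) := fun r =>
    (hφm.comp measurable_fst).mul ((hE.comp (measurable_shift r)).sub (hE.comp measurable_fst))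
  have hdm : Measurable d := by
    have : d = fun x => φ x.1 * ((circleMap 0 1 x.2).re * fderiv ℝ E x.1 1 +
        (circleMap 0 1 x.2).im * fderiv ℝ E x.1 Complex.I) := by
      funext x
      simp only [d]
      rw [apply_eq_re_im (fderiv ℝ E x.1) _]
    rw [this]
    have hcm : Measurable fun x : ℂ × ℝ => circleMap 0 1 x.2 :=
      (continuous_circleMap 0 1).measurable.comp measurable_snd
    exact (hφm.comp measurable_fst).mul
      (((Complex.measurable_re.comp hcm).mul ((hE'm 1).comp measurable_fst)).add
        ((Complex.measurable_im.comp hcm).mul ((hE'm Complex.I).comp measurable_fst)))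
  have hqb : ∀ r x, |q r x| ≤ A * (M + M) := fun r x => by
    simp only [q]
    rw [abs_mul]
    exact mul_le_mul (hA _) ((abs_sub _ _).trans (add_le_add (habsE _) (habsE _)))
      (abs_nonneg _) hA0
  have hdb : ∀ᵐ x ∂P, |d x| ≤ A * L := by
    have h1 : ∀ᵐ x ∂P, ∀ w, |φ x.1 * fderiv ℝ E x.1 w| ≤ A * (L * ‖w‖) :=
      Measure.quasiMeasurePreserving_fst.ae hφE'bd
    filter_upwards [h1] with x hx
    have := hx (circleMap 0 1 x.2)
    rwa [norm_circleMap_zero' zero_le_one, mul_one] at this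
  have hqi : ∀ r, Integrable (q r) P := fun r =>
    integrable_of_bounded_of_support (hqm r) (Filter.Eventually.of_forall (hqb r)) hBt
      fun x hx => by simp only [q]; rw [hout x hx, zero_mul]
  have hdi : Integrable d P := integrable_of_bounded_of_support hdm hdb hBt
      fun x hx => by simp only [d]; rw [hout x hx, zero_mul]
  have hq2 : ∀ r, Integrable (fun x => q r x ^ 2) P := fun r =>
    integrable_of_bounded_of_support (C := (A * (M + M)) ^ 2) ((hqm r).pow_const 2)
      (Filter.Eventually.of_forall fun x => by
        rw [abs_pow]
        exact pow_le_pow_left₀ (abs_nonneg _) (hqb r x) 2) hBt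
      fun x hx => by simp only [q]; rw [hout x hx, zero_mul, zero_pow two_ne_zero]
  have hd2 : Integrable (fun x => d x ^ 2) P :=
    integrable_of_bounded_of_support (C := (A * L) ^ 2) (hdm.pow_const 2)
      (hdb.mono fun x hx => by
        rw [abs_pow]
        exact pow_le_pow_left₀ (abs_nonneg _) hx 2) hBt
      fun x hx => by simp only [d]; rw [hout x hx, zero_mul, zero_pow two_ne_zero]
  have hxi : ∀ r, Integrable (fun x => r⁻¹ * q r x - d x) P := fun r =>
    ((hqi r).const_mul r⁻¹).sub hdi
  set C₁ : ℝ := volume.real (Metric.ball p (R + 1)) * (M * C) with hC₁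
  -- Translating the increment of `E` onto `φ` costs a Taylor error `C₁ * r`; the rest of the defect
  -- is the distance of the difference quotient from the derivative.
  have hmain : ∀ r ∈ Set.Ioo (0 : ℝ) 1, ∀ θ : ℝ,
      |ℓ (circleMap 0 1 θ)| ≤ C₁ * r + ∫ z, |r⁻¹ * q r (z, θ) - d (z, θ)| := by
    intro r hr θ
    have hr0 := hr.1
    set e := circleMap 0 1 θ with he
    have hne : ‖e‖ = 1 := norm_circleMap_zero' zero_le_one θ
    have hre : circleMap 0 r θ = r • e := circleMap_zero_eq_smul r θ
    have hout1 : ∀ z, z ∉ Metric.ball p (R + 1) → φ z = 0 ∧ φ (z - r • e) = 0 := by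
      intro z hz
      refine ⟨hφ0 z fun h => hz (Metric.ball_subset_ball (by linarith) h), hφ0 _ fun h => hz ?_⟩
      have h1 : dist (z - r • e) p < R := h
      have h2 : dist z (z - r • e) = r := by
        rw [dist_eq_norm, sub_sub_cancel, norm_smul, hne, mul_one, Real.norm_of_nonneg hr0.le]
      have := dist_triangle z (z - r • e) p
      exact Metric.mem_ball.2 (by linarith [hr.2])
    have hbd : ∀ z w, |φ z * E w| ≤ A * M := fun z w => by
      rw [abs_mul]
      exact mul_le_mul (hA z) (habsE w) (abs_nonneg _) hA0
    have hf1 : Integrable fun z => φ z * E (z + r • e) :=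
      integrable_of_bounded_of_support (hφm.mul (hE.comp (measurable_id.add_const _)))
        (Filter.Eventually.of_forall fun z => hbd _ _) measure_ball_lt_top.ne
        fun z hz => by rw [(hout1 z hz).1, zero_mul]
    have hf2 : Integrable fun z => φ z * E z :=
      integrable_of_bounded_of_support (hφm.mul hE)
        (Filter.Eventually.of_forall fun z => hbd _ _) measure_ball_lt_top.ne
        fun z hz => by rw [(hout1 z hz).1, zero_mul]
    have hf3 : Integrable fun z => φ (z - r • e) * E z :=
      integrable_of_bounded_of_support ((hφm.comp (measurable_id.sub_const _)).mul hE)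
        (Filter.Eventually.of_forall fun z => hbd _ _) measure_ball_lt_top.ne
        fun z hz => by rw [(hout1 z hz).2, zero_mul]
    have hqe : ∀ z, q r (z, θ) = φ z * E (z + r • e) - φ z * E z := fun z => by
      simp only [q]
      rw [hre]
      ring
    have hqθ : Integrable fun z => q r (z, θ) := by
      simp_rw [hqe]
      exact hf1.sub hf2
    have hdθ : Integrable fun z => d (z, θ) := hi2 e
    have hsh : ∫ z, φ z * E (z + r • e) = ∫ z, φ (z - r • e) * E z := by
      rw [← integral_add_right_eq_self (fun z => φ (z - r • e) * E z) (r • e)]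
      simp
    have hqint : ∫ z, q r (z, θ) = ∫ z, (φ (z - r • e) * E z - φ z * E z) := by
      simp_rw [hqe]
      rw [integral_sub hf1 hf2, integral_sub hf3 hf2, hsh]
    have hf4 : Integrable fun z => r⁻¹ * (φ (z - r • e) * E z - φ z * E z) :=
      (hf3.sub hf2).const_mul _
    have hrep : ℓ e = (∫ z, (E z * fderiv ℝ φ z e + r⁻¹ * (φ (z - r • e) * E z - φ z * E z))) -
        ∫ z, (r⁻¹ * q r (z, θ) - d (z, θ)) := by
      rw [integral_add (hi1 e) hf4, integral_sub (hqθ.const_mul _) hdθ, integral_const_mul,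
        integral_const_mul, hqint]
      simp only [ℓ, d]
      ring
    have hfirst : |∫ z, (E z * fderiv ℝ φ z e + r⁻¹ * (φ (z - r • e) * E z - φ z * E z))| ≤
        C₁ * r := by
      have hind : Integrable ((Metric.ball p (R + 1)).indicator fun _ => M * C * r) :=
        (integrable_indicator_iff Metric.isOpen_ball.measurableSet).2
          (integrableOn_const measure_ball_lt_top.ne)
      have h1 : ∫ z, (Metric.ball p (R + 1)).indicator (fun _ => M * C * r) z = C₁ * r := by
        rw [integral_indicator_const _ Metric.isOpen_ball.measurableSet, smul_eq_mul, hC₁]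
        ring
      rw [← h1, ← Real.norm_eq_abs]
      refine norm_integral_le_of_norm_le hind (Filter.Eventually.of_forall fun z => ?_)
      by_cases hz : z ∈ Metric.ball p (R + 1)
      · rw [Set.indicator_of_mem hz, Real.norm_eq_abs]
        have h2 := hC z (-(r • e))
        rw [← sub_eq_add_neg, norm_neg, map_neg, sub_neg_eq_add, map_smul, smul_eq_mul, norm_smul,
          hne, mul_one, Real.norm_of_nonneg hr0.le] at h2
        have h3 : E z * fderiv ℝ φ z e + r⁻¹ * (φ (z - r • e) * E z - φ z * E z) =
            E z * (r⁻¹ * (φ (z - r • e) - φ z + r * fderiv ℝ φ z e)) := by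
          field_simp
          ring
        rw [h3, abs_mul, abs_mul, abs_of_pos (inv_pos.2 hr0)]
        calc |E z| * (r⁻¹ * |φ (z - r • e) - φ z + r * fderiv ℝ φ z e|)
            ≤ M * (r⁻¹ * (C * r ^ 2)) := by
              gcongr
              exact habsE z
          _ = M * C * r := by field_simp
      · rw [Set.indicator_of_notMem hz, (hout1 z hz).1, (hout1 z hz).2,
          hφ'0 z fun h => hz (Metric.ball_subset_ball (by linarith) h)]
        simp
    rw [hrep]
    refine (abs_sub _ _).trans (add_le_add hfirst ?_)
    exact abs_integral_le_integral_abs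
  have hang : angleMeasure.real Set.univ = 2 * Real.pi := by
    simp [angleMeasure, Real.two_pi_pos.le]
  have hℓint : Integrable (fun θ => |ℓ (circleMap 0 1 θ)|) angleMeasure := by
    have hcont : Continuous fun θ => |ℓ (circleMap 0 1 θ)| := by
      simp_rw [hℓ (circleMap 0 1 _)]
      have := continuous_circleMap 0 1
      fun_prop
    exact (hcont.integrableOn_Icc (a := 0) (b := 2 * Real.pi)).mono_set Set.Ioc_subset_Icc_self
  have hxm : ∀ r, Measurable fun x => r⁻¹ * q r x - d x := fun r =>
    ((hqm r).const_mul r⁻¹).sub hdm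
  have hx0 : ∀ r, ∀ x ∉ B, r⁻¹ * q r x - d x = 0 := fun r x hx => by simp [q, d, hout x hx]
  have hmini : ∀ r, ∀ lam > 0, Integrable (fun x => min |r⁻¹ * q r x - d x| lam) P :=
    fun r lam hlam =>
      integrable_of_bounded_of_support (C := lam) ((hxm r).abs.min measurable_const)
        (Filter.Eventually.of_forall fun x => by
          rw [abs_of_nonneg (le_min (abs_nonneg _) hlam.le)]
          exact min_le_right _ _) hBt
        fun x hx => by rw [hx0 r x hx, abs_zero, min_eq_left hlam.le]
  have hI : ∀ᶠ r in nhdsWithin (0 : ℝ) (Set.Ioi 0), ∀ lam > 0,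
      ∫ θ, |ℓ (circleMap 0 1 θ)| ∂angleMeasure ≤ 2 * Real.pi * (C₁ * r) +
        ∫ x, min |r⁻¹ * q r x - d x| lam ∂P + (2 * C₂ + 2 * ∫ x, d x ^ 2 ∂P) / lam := by
    filter_upwards [hen, Ioo_mem_nhdsGT zero_lt_one] with r hr2 hr lam hlam
    have hr0 := hr.1
    have hsq : Integrable (fun x => (r⁻¹ * q r x - d x) ^ 2) P := by
      refine integrable_of_bounded_of_support (C := (r⁻¹ * (A * (M + M)) + A * L) ^ 2)
        ((hxm r).pow_const 2) (hdb.mono fun x hx => ?_) hBt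
        fun x hx => by rw [hx0 r x hx, zero_pow two_ne_zero]
      rw [abs_pow]
      refine pow_le_pow_left₀ (abs_nonneg _) ((abs_sub _ _).trans (add_le_add ?_ hx)) 2
      rw [abs_mul, abs_of_pos (inv_pos.2 hr0)]
      exact mul_le_mul_of_nonneg_left (hqb r x) (inv_pos.2 hr0).le
    have h1 : ∫ θ, |ℓ (circleMap 0 1 θ)| ∂angleMeasure ≤
        ∫ θ, (C₁ * r + ∫ z, |r⁻¹ * q r (z, θ) - d (z, θ)|) ∂angleMeasure :=
      integral_mono hℓint ((integrable_const _).add (hxi r).abs.integral_prod_right)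
        fun θ => hmain r hr θ
    rw [integral_add (integrable_const _) (hxi r).abs.integral_prod_right, integral_const, hang,
      smul_eq_mul, ← integral_prod_symm _ (hxi r).abs] at h1
    have h2 : ∫ x, |r⁻¹ * q r x - d x| ∂P ≤
        ∫ x, (min |r⁻¹ * q r x - d x| lam + (r⁻¹ * q r x - d x) ^ 2 / lam) ∂P :=
      integral_mono (hxi r).abs ((hmini r lam hlam).add (hsq.div_const lam))
        fun x => abs_le_min_add_sq_div _ hlam
    rw [integral_add (hmini r lam hlam) (hsq.div_const lam), integral_div] at h2
    have h3 : ∫ x, (r⁻¹ * q r x - d x) ^ 2 ∂P ≤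
        ∫ x, (2 * (r⁻¹ ^ 2 * q r x ^ 2) + 2 * d x ^ 2) ∂P :=
      integral_mono hsq ((((hq2 r).const_mul _).const_mul 2).add (hd2.const_mul 2)) fun x => by
        change (r⁻¹ * q r x - d x) ^ 2 ≤ 2 * (r⁻¹ ^ 2 * q r x ^ 2) + 2 * d x ^ 2
        nlinarith [sq_nonneg (r⁻¹ * q r x + d x)]
    rw [integral_add (((hq2 r).const_mul _).const_mul 2) (hd2.const_mul 2), integral_const_mul,
      integral_const_mul, integral_const_mul] at h3
    have h4 : r⁻¹ ^ 2 * ∫ x, q r x ^ 2 ∂P ≤ C₂ := by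
      calc r⁻¹ ^ 2 * ∫ x, q r x ^ 2 ∂P ≤ r⁻¹ ^ 2 * (C₂ * r ^ 2) :=
            mul_le_mul_of_nonneg_left hr2 (by positivity)
        _ = C₂ := by field_simp
    have h5 : (∫ x, (r⁻¹ * q r x - d x) ^ 2 ∂P) / lam ≤ (2 * C₂ + 2 * ∫ x, d x ^ 2 ∂P) / lam :=
      div_le_div_of_nonneg_right (by linarith) hlam.le
    linarith
  have hlim : ∀ lam > 0, Filter.Tendsto
      (fun n : ℕ => ∫ x, min |(1 / ((n : ℝ) + 1))⁻¹ * q (1 / ((n : ℝ) + 1)) x - d x| lam ∂P)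
      Filter.atTop (nhds 0) := by
    intro lam hlam
    have h0 : ∫ x : ℂ × ℝ, (0 : ℝ) ∂P = 0 := integral_zero _ _
    rw [← h0]
    refine tendsto_integral_of_dominated_convergence (B.indicator fun _ => lam)
      (fun n => (hmini _ lam hlam).aestronglyMeasurable)
      ((integrable_indicator_iff hBm).2 (integrableOn_const hBt)) (fun n => ?_) ?_
    · refine Filter.Eventually.of_forall fun x => ?_
      rw [Real.norm_of_nonneg (le_min (abs_nonneg _) hlam.le)]
      by_cases hx : x ∈ B
      · rw [Set.indicator_of_mem hx]
        exact min_le_right _ _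
      · rw [Set.indicator_of_notMem hx]
        refine (min_le_left _ _).trans (le_of_eq ?_)
        simp [q, d, hout x hx]
    · have h1 : ∀ᵐ x ∂P, x.1 ∈ Metric.ball p R → DifferentiableAt ℝ E x.1 ∧ ‖fderiv ℝ E x.1‖ ≤ L :=
        Measure.quasiMeasurePreserving_fst.ae hd
      filter_upwards [h1] with x hx
      have hpt : Filter.Tendsto (fun n : ℕ => (1 / ((n : ℝ) + 1))⁻¹ * q (1 / ((n : ℝ) + 1)) x)
          Filter.atTop (nhds (d x)) := by
        by_cases hxb : x.1 ∈ Metric.ball p R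
        · have h2 : HasDerivAt (fun t : ℝ => E (x.1 + t • circleMap 0 1 x.2))
              (fderiv ℝ E x.1 (circleMap 0 1 x.2)) 0 := by
            have h3 : HasFDerivAt E (fderiv ℝ E x.1) (x.1 + (0 : ℝ) • circleMap 0 1 x.2) := by
              rw [zero_smul, add_zero]
              exact (hx hxb).1.hasFDerivAt
            exact h3.comp_hasDerivAt 0 (hasDerivAt_add_smul x.1 (circleMap 0 1 x.2) 0)
          have h3 := h2.tendsto_slope_zero_right
          have h4 : Filter.Tendsto (fun n : ℕ => 1 / ((n : ℝ) + 1)) Filter.atTop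
              (nhdsWithin 0 (Set.Ioi 0)) :=
            tendsto_nhdsWithin_iff.2 ⟨tendsto_one_div_add_atTop_nhds_zero_nat,
              Filter.Eventually.of_forall fun n => by
                change 0 < 1 / ((n : ℝ) + 1)
                positivity⟩
          refine ((h3.comp h4).const_mul (φ x.1)).congr fun n => ?_
          simp only [Function.comp, q, zero_add, zero_smul, add_zero, smul_eq_mul]
          rw [circleMap_zero_eq_smul (1 / ((n : ℝ) + 1))]
          ring
        · simp [q, d, hφ0 x.1 hxb]
      have h2 := ((hpt.sub_const (d x)).abs).min (tendsto_const_nhds (x := lam))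
      rwa [sub_self, abs_zero, min_eq_left hlam.le] at h2
  -- First `r → 0` with the truncation level `lam` fixed; afterwards `lam → ∞`.
  have hbound : ∀ lam > 0, ∫ θ, |ℓ (circleMap 0 1 θ)| ∂angleMeasure ≤
      (2 * C₂ + 2 * ∫ x, d x ^ 2 ∂P) / lam := by
    intro lam hlam
    have h4 : Filter.Tendsto (fun n : ℕ => 1 / ((n : ℝ) + 1)) Filter.atTop (nhds 0) :=
      tendsto_one_div_add_atTop_nhds_zero_nat
    have h5 : Filter.Tendsto (fun n : ℕ => 1 / ((n : ℝ) + 1)) Filter.atTop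
        (nhdsWithin 0 (Set.Ioi 0)) :=
      tendsto_nhdsWithin_iff.2 ⟨h4, Filter.Eventually.of_forall fun n => by
        change 0 < 1 / ((n : ℝ) + 1)
        positivity⟩
    have h6 := (((h4.const_mul C₁).const_mul (2 * Real.pi)).add (hlim lam hlam)).add_const
      ((2 * C₂ + 2 * ∫ x, d x ^ 2 ∂P) / lam)
    rw [mul_zero, mul_zero, zero_add, zero_add] at h6
    exact ge_of_tendsto h6 ((h5.eventually hI).mono fun n hn => hn lam hlam)
  have hfinal : ∫ θ, |ℓ (circleMap 0 1 θ)| ∂angleMeasure ≤ 0 := by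
    have h1 : Filter.Tendsto (fun lam : ℝ => (2 * C₂ + 2 * ∫ x, d x ^ 2 ∂P) / lam) Filter.atTop
        (nhds 0) := Filter.Tendsto.div_atTop tendsto_const_nhds Filter.tendsto_id
    exact ge_of_tendsto h1 ((Filter.eventually_gt_atTop 0).mono hbound)
  have hzero : ℓ 1 = 0 ∧ ℓ Complex.I = 0 := by
    refine eq_zero_of_integral_abs_cos_sin_le ?_
    refine le_of_eq_of_le ?_ hfinal
    congr 1
    funext θ
    rw [hℓ (circleMap 0 1 θ)]
    simp [circleMap]
  have := hℓ v
  rw [hzero.1, hzero.2, mul_zero, mul_zero, add_zero] at this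
  exact eq_neg_of_add_eq_zero_left this

/-! ### Subharmonic functions: polar coordinates, local integrability and essential bounds. -/

/-- Polar coordinates around a point `c` of the plane. -/
theorem lintegral_eq_lintegral_circleMap {f : ℂ → ENNReal} (hf : Measurable f) (c : ℂ) :
    ∫⁻ z, f z = ∫⁻ ρ in Set.Ioi (0 : ℝ),
      ENNReal.ofReal ρ * ∫⁻ θ, f (circleMap c ρ θ) ∂angleMeasure := by
  have h1 : ∫⁻ z, f z = ∫⁻ z, f (c - z) := (lintegral_sub_left_eq_self f c).symm
  rw [h1, ← Complex.lintegral_comp_polarCoord_symm (fun z => f (c - z)),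
    show polarCoord.target = Set.Ioi (0 : ℝ) ×ˢ Set.Ioo (-Real.pi) Real.pi from rfl,
    Measure.volume_eq_prod, ← Measure.prod_restrict]
  have hm : Measurable fun p : ℝ × ℝ => f (c - Complex.polarCoord.symm p) := by
    have h2 : Measurable fun p : ℝ × ℝ => c - Complex.polarCoord.symm p := by
      simp only [Complex.polarCoord_symm_apply]
      fun_prop
    exact hf.comp h2
  rw [lintegral_prod _ (by
    exact (ENNReal.measurable_ofReal.comp measurable_fst).smul hm |>.aemeasurable)]
  refine lintegral_congr fun ρ => ?_
  simp only [smul_eq_mul]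
  have hmρ : Measurable fun θ : ℝ => f (c - Complex.polarCoord.symm (ρ, θ)) :=
    hm.comp measurable_prodMk_left
  rw [lintegral_const_mul _ hmρ]
  congr 1
  -- The reflection `z ↦ c - z` shifts the angle by `π`, which carries the range `(-π, π)` of polar
  -- coordinates to `(0, 2π)`.
  have h3 : ∀ θ : ℝ, f (c - Complex.polarCoord.symm (ρ, θ)) = f (circleMap c ρ (θ + Real.pi)) := by
    intro θ
    congr 1
    rw [Complex.polarCoord_symm_apply, circleMap, Complex.ofReal_add, add_mul, Complex.exp_add,
      Complex.exp_pi_mul_I, Complex.exp_mul_I]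
    push_cast
    ring
  simp_rw [h3]
  have h4 : ∀ θ : ℝ, (Set.Ioo (-Real.pi) Real.pi).indicator
      (fun θ => f (circleMap c ρ (θ + Real.pi))) θ =
      (Set.Ioo 0 (2 * Real.pi)).indicator (fun θ => f (circleMap c ρ θ)) (θ + Real.pi) := by
    intro θ
    by_cases hθ : θ ∈ Set.Ioo (-Real.pi) Real.pi
    · rw [Set.indicator_of_mem hθ, Set.indicator_of_mem
        (show θ + Real.pi ∈ Set.Ioo 0 (2 * Real.pi) from ⟨by linarith [hθ.1], by linarith [hθ.2]⟩)]
    · rw [Set.indicator_of_notMem hθ, Set.indicator_of_notMem fun h =>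
        hθ ⟨by linarith [h.1], by linarith [h.2]⟩]
  rw [← lintegral_indicator measurableSet_Ioo, lintegral_congr h4,
    lintegral_add_right_eq_self ((Set.Ioo 0 (2 * Real.pi)).indicator
      fun θ => f (circleMap c ρ θ)) Real.pi, lintegral_indicator measurableSet_Ioo, angleMeasure,
    Measure.restrict_congr_set Ioo_ae_eq_Ioc]

theorem angleMeasure_univ : angleMeasure Set.univ = ENNReal.ofReal (2 * Real.pi) := by
  simp [angleMeasure]

namespace IsSubharmonic

variable {V : ℂ → EReal} {Ω : Opens ℂ}

-- Nothing is known about `V` off `Ω`. Replacing it there by `⊥` gives a Borel function, as needed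
-- for integration in polar coordinates.
open Classical in
theorem measurable_extension (h : IsSubharmonic V Ω) :
    Measurable fun z => if z ∈ Ω then V z else ⊥ := by
  refine measurable_of_Iio fun a => ?_
  have hopen : IsOpen {z | z ∈ Ω ∧ V z < a} := by
    refine isOpen_iff_mem_nhds.2 fun z hz => ?_
    have h1 := (h.upperSemicontinuousOn z hz.1) a hz.2
    rw [Ω.isOpen.nhdsWithin_eq hz.1] at h1
    filter_upwards [h1, Ω.isOpen.mem_nhds hz.1] with w hw1 hw2 using ⟨hw2, hw1⟩
  have : (fun z => if z ∈ Ω then V z else ⊥) ⁻¹' Set.Iio a =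
      {z | z ∈ Ω ∧ V z < a} ∪ {z | z ∉ Ω ∧ ⊥ < a} := by
    ext z
    by_cases hz : z ∈ Ω <;> simp [hz]
  rw [this]
  refine hopen.measurableSet.union ?_
  by_cases ha : ⊥ < a
  · simp only [ha, and_true]
    exact Ω.isOpen.measurableSet.compl
  · simp [ha]

theorem exists_measurable_eqOn (h : IsSubharmonic V Ω) :
    ∃ W : ℂ → EReal, Measurable W ∧ ∀ z ∈ Ω, W z = V z := by
  classical
  exact ⟨_, h.measurable_extension, fun z hz => by simp [hz]⟩

theorem exists_le_real (h : IsSubharmonic V Ω) {K : Set ℂ} (hK : IsCompact K)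
    (hKΩ : K ⊆ (Ω : Set ℂ)) : ∃ M : ℝ, 0 ≤ M ∧ ∀ z ∈ K, V z ≤ M := by
  rcases K.eq_empty_or_nonempty with rfl | hne
  · exact ⟨0, le_rfl, fun z hz => hz.elim⟩
  obtain ⟨z, hz, hmax⟩ := (h.upperSemicontinuousOn.mono hKΩ).exists_isMaxOn hne hK
  refine ⟨max (V z).toReal 0, le_max_right _ _, fun w hw => (hmax hw).trans ?_⟩
  refine (EReal.le_coe_toReal (h.ne_top z (hKΩ hz))).trans ?_
  exact_mod_cast le_max_left _ _

theorem eventually_lt (h : IsSubharmonic V Ω) {z : ℂ} (hz : z ∈ Ω) {a : EReal} (ha : V z < a) :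
    ∀ᶠ w in nhds z, V w < a := by
  have h1 := (h.upperSemicontinuousOn z hz) a ha
  rwa [Ω.isOpen.nhdsWithin_eq hz] at h1

/-- The negative part has bounded means over circles around a point where `V` is finite. -/
theorem lintegral_neg_le (h : IsSubharmonic V Ω) {c : ℂ} {r : ℝ} (hr : 0 < r)
    (hcr : Metric.closedBall c r ⊆ (Ω : Set ℂ)) {M a : ℝ} (hM : 0 ≤ M)
    (hVM : ∀ z ∈ Metric.closedBall c r, V z ≤ M) (ha : (a : EReal) ≤ V c) :
    ∫⁻ θ, (-V (circleMap c r θ)).toENNReal ∂angleMeasure ≤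
      ENNReal.ofReal (2 * Real.pi * (M - a)) := by
  have h1 := ha.trans (h.le_circleMean c r hr hcr)
  unfold circleMeanEReal at h1
  change (a : EReal) ≤ ((laverage angleMeasure fun θ : ℝ => (V (circleMap c r θ)).toENNReal :
    ENNReal) : EReal) - ((laverage angleMeasure
      fun θ : ℝ => (-V (circleMap c r θ)).toENNReal : ENNReal) : EReal) at h1
  set p := laverage angleMeasure fun θ : ℝ => (V (circleMap c r θ)).toENNReal with hp
  set n := laverage angleMeasure fun θ : ℝ => (-V (circleMap c r θ)).toENNReal with hn
  have hpi := Real.two_pi_pos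
  have hune : ENNReal.ofReal (2 * Real.pi) ≠ 0 := by simpa using Real.pi_pos
  have hpM : p ≤ ENNReal.ofReal M := by
    rw [hp, laverage_eq, angleMeasure_univ]
    refine ENNReal.div_le_of_le_mul ?_
    calc ∫⁻ θ, (V (circleMap c r θ)).toENNReal ∂angleMeasure
        ≤ ∫⁻ θ, ENNReal.ofReal M ∂angleMeasure := lintegral_mono fun θ => by
          have := EReal.toENNReal_le_toENNReal
            (hVM _ (circleMap_mem_closedBall c hr.le θ))
          simpa using this
      _ = ENNReal.ofReal M * ENNReal.ofReal (2 * Real.pi) := by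
          rw [lintegral_const, angleMeasure_univ]
  have hnle : n ≤ ENNReal.ofReal (M - a) := by
    -- An infinite mean of the negative part would make the right side of `h1` equal to `⊥`.
    have hnt : n ≠ ⊤ := by
      intro hnt
      rw [hnt] at h1
      simp at h1
    have hpt : p ≠ ⊤ := ne_top_of_le_ne_top ENNReal.ofReal_ne_top hpM
    lift n to NNReal using hnt with n'
    lift p to NNReal using hpt with p'
    have h2 : (a : EReal) ≤ ((p' : ℝ) : EReal) - ((n' : ℝ) : EReal) := h1
    have h3 : a ≤ p' - n' := by exact_mod_cast h2
    have h4 : (p' : ℝ) ≤ M := by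
      have := ENNReal.toReal_mono ENNReal.ofReal_ne_top hpM
      rwa [ENNReal.toReal_ofReal hM] at this
    rw [← ENNReal.ofReal_coe_nnreal]
    exact ENNReal.ofReal_le_ofReal (by linarith)
  have h5 : ∫⁻ θ, (-V (circleMap c r θ)).toENNReal ∂angleMeasure =
      ENNReal.ofReal (2 * Real.pi) * n := by
    rw [hn, laverage_eq, angleMeasure_univ, ENNReal.mul_div_cancel hune ENNReal.ofReal_ne_top]
  rw [h5, ENNReal.ofReal_mul hpi.le]
  gcongr

/-- `V` is integrable on discs around points at which it is finite. -/
theorem integrableOn_ball_of_ne_bot (h : IsSubharmonic V Ω) {c : ℂ} {r : ℝ}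
    (hcr : Metric.closedBall c r ⊆ (Ω : Set ℂ)) (hc : V c ≠ ⊥) :
    IntegrableOn (fun z => (V z).toReal) (Metric.ball c r) ∧
      ∀ᵐ z, z ∈ Metric.ball c r → V z ≠ ⊥ := by
  rcases le_or_gt r 0 with hr | hr
  · rw [Metric.ball_eq_empty.2 hr]
    simp
  obtain ⟨M, hM, hVM⟩ := h.exists_le_real (isCompact_closedBall c r) hcr
  obtain ⟨W, hW, hWV⟩ := h.exists_measurable_eqOn
  have ha : ((V c).toReal : EReal) ≤ V c :=
    (EReal.coe_toReal (h.ne_top c (hcr (Metric.mem_closedBall_self hr.le))) hc).le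
  set a := (V c).toReal
  have hballm : MeasurableSet (Metric.ball c r) := Metric.isOpen_ball.measurableSet
  have hWn : Measurable fun z => (-W z).toENNReal := measurable_ereal_toENNReal.comp hW.neg
  let f : ℂ → ENNReal := (Metric.ball c r).indicator fun z => (-W z).toENNReal
  have hfm : Measurable f := hWn.indicator hballm
  -- The bounds for the means of the negative part over circles around `c` are integrated over the
  -- radii; the positive part is bounded by `M`.
  have hfin : ∫⁻ z, f z < ⊤ := by
    rw [lintegral_eq_lintegral_circleMap hfm c]
    have hle : ∀ ρ ∈ Set.Ioi (0 : ℝ), ENNReal.ofReal ρ *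
        ∫⁻ θ, f (circleMap c ρ θ) ∂angleMeasure ≤ (Set.Ioo 0 r).indicator
          (fun _ => ENNReal.ofReal r * ENNReal.ofReal (2 * Real.pi * (M - a))) ρ := by
      intro ρ hρ
      have hρ : 0 < ρ := hρ
      have hdist : ∀ θ, dist (circleMap c ρ θ) c = ρ := fun θ => by
        simp [dist_eq_norm, circleMap, abs_of_pos hρ]
      by_cases hρr : ρ < r
      · rw [Set.indicator_of_mem (show ρ ∈ Set.Ioo 0 r from ⟨hρ, hρr⟩)]
        refine mul_le_mul' (ENNReal.ofReal_le_ofReal hρr.le) ?_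
        have hsub := Metric.closedBall_subset_closedBall (x := c) hρr.le
        refine le_trans (le_of_eq (lintegral_congr fun θ => ?_))
          (h.lintegral_neg_le hρ (hsub.trans hcr) hM (fun z hz => hVM z (hsub hz)) ha)
        have hb : circleMap c ρ θ ∈ Metric.ball c r := Metric.mem_ball.2 (by rwa [hdist])
        simp only [f]
        rw [Set.indicator_of_mem hb, hWV _ (hcr (Metric.ball_subset_closedBall hb))]
      · have h0 : ∀ θ, f (circleMap c ρ θ) = 0 := fun θ =>
          Set.indicator_of_notMem (fun hb => hρr (by rwa [Metric.mem_ball, hdist] at hb)) _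
        simp [h0]
    refine (setLIntegral_mono (Measurable.indicator measurable_const measurableSet_Ioo)
      hle).trans_lt ?_
    refine (setLIntegral_le_lintegral _ _).trans_lt ?_
    rw [lintegral_indicator measurableSet_Ioo, lintegral_const]
    refine ENNReal.mul_lt_top (ENNReal.mul_lt_top ENNReal.ofReal_lt_top ENNReal.ofReal_lt_top) ?_
    simp
  have hVW : ∀ z ∈ Metric.ball c r, W z = V z := fun z hz =>
    hWV z (hcr (Metric.ball_subset_closedBall hz))
  rw [lintegral_indicator hballm] at hfin
  constructor
  · have hWint : IntegrableOn (fun z => (W z).toReal) (Metric.ball c r) := by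
      refine ⟨(measurable_ereal_toReal.comp hW).aestronglyMeasurable, ?_⟩
      rw [hasFiniteIntegral_iff_enorm]
      have hle : ∀ z ∈ Metric.ball c r, ‖(W z).toReal‖ₑ ≤ ENNReal.ofReal M + (-W z).toENNReal := by
        intro z hz
        have hzM : W z ≤ M := by
          rw [hVW z hz]
          exact hVM z (Metric.ball_subset_closedBall hz)
        generalize W z = x at hzM
        induction x using EReal.rec with
        | bot => simp
        | top => simp at hzM
        | coe x =>
          have hxM : x ≤ M := by exact_mod_cast hzM
          rw [← EReal.coe_neg, EReal.toReal_coe, EReal.real_coe_toENNReal,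
            Real.enorm_eq_ofReal_abs]
          rcases le_total 0 x with hx | hx
          · rw [abs_of_nonneg hx]
            exact (ENNReal.ofReal_le_ofReal hxM).trans le_self_add
          · rw [abs_of_nonpos hx]
            exact le_add_self
      refine (setLIntegral_mono (measurable_const.add hWn)
        hle).trans_lt ?_
      simp only [Pi.add_apply]
      rw [lintegral_add_left measurable_const, lintegral_const]
      refine ENNReal.add_lt_top.2 ⟨ENNReal.mul_lt_top ENNReal.ofReal_lt_top ?_, hfin⟩
      rw [Measure.restrict_apply_univ]
      exact measure_ball_lt_top
    exact hWint.congr_fun (fun z hz => by simp only [hVW z hz]) hballm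
  · have h1 := ae_lt_top hWn hfin.ne
    rw [ae_restrict_iff' hballm] at h1
    filter_upwards [h1] with z hz hzb hbot
    have := hz hzb
    simp [hVW z hzb, hbot] at this

end IsSubharmonic

/-- The form `x⁺ + a⁻ ≤ x⁻ + a⁺` of `x ≤ a` contains no subtraction, so it can be integrated in `[0,
∞]`. -/
theorem EReal.toENNReal_add_le_of_le {x : EReal} {a : ℝ} (h : x ≤ a) :
    x.toENNReal + ENNReal.ofReal (-a) ≤ (-x).toENNReal + ENNReal.ofReal a := by
  induction x using EReal.rec with
  | bot => simp
  | top => simp at h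
  | coe x =>
    have hxa : x ≤ a := by exact_mod_cast h
    rw [← EReal.coe_neg, EReal.real_coe_toENNReal, EReal.real_coe_toENNReal]
    rcases le_total 0 x with hx | hx
    · rw [ENNReal.ofReal_of_nonpos (show -a ≤ 0 by linarith), add_zero]
      exact (ENNReal.ofReal_le_ofReal hxa).trans le_add_self
    · rw [ENNReal.ofReal_of_nonpos hx, zero_add]
      exact (ENNReal.ofReal_le_ofReal (neg_le_neg hxa)).trans le_self_add

/-- A property which holds almost everywhere holds almost everywhere on some small circle. -/
theorem exists_ae_circleMap_notMem {A : Set ℂ} (hAm : MeasurableSet A) (hA0 : volume A = 0) (z : ℂ)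
    {s : ℝ} (hs0 : 0 < s) :
    ∃ ρ ∈ Set.Ioo 0 s, ∀ᵐ θ ∂angleMeasure, circleMap z ρ θ ∉ A := by
  have hcm : Measurable fun p : ℝ × ℝ => circleMap z p.1 p.2 := by
    unfold circleMap
    fun_prop
  have hfm : Measurable (A.indicator fun _ => (1 : ENNReal)) := measurable_const.indicator hAm
  have hms : MeasurableSet {p : ℝ × ℝ | circleMap z p.1 p.2 ∈ A} := hcm hAm
  have h0 : ∫⁻ w, A.indicator (fun _ => (1 : ENNReal)) w = 0 := by
    rw [lintegral_indicator hAm, lintegral_one, Measure.restrict_apply_univ, hA0]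
  rw [lintegral_eq_lintegral_circleMap hfm z] at h0
  have hin : ∀ ρ : ℝ, ∫⁻ θ, A.indicator (fun _ => (1 : ENNReal)) (circleMap z ρ θ) ∂angleMeasure =
      angleMeasure (Prod.mk ρ ⁻¹' {p : ℝ × ℝ | circleMap z p.1 p.2 ∈ A}) := by
    intro ρ
    rw [← lintegral_indicator_one (measurable_prodMk_left hms)]
    rfl
  simp only [hin] at h0
  have hm2 : Measurable fun ρ : ℝ => ENNReal.ofReal ρ *
      angleMeasure (Prod.mk ρ ⁻¹' {p : ℝ × ℝ | circleMap z p.1 p.2 ∈ A}) :=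
    ENNReal.measurable_ofReal.mul (measurable_measure_prodMk_left hms)
  have h0 := ae_imp_of_ae_restrict ((lintegral_eq_zero_iff hm2).1 h0)
  obtain ⟨ρ, hρs, hρ⟩ := (Measure.dense_of_ae h0).exists_mem_open isOpen_Ioo
    (Set.nonempty_Ioo.2 hs0)
  refine ⟨ρ, hρ, ?_⟩
  have h1 : ENNReal.ofReal ρ *
      angleMeasure (Prod.mk ρ ⁻¹' {p : ℝ × ℝ | circleMap z p.1 p.2 ∈ A}) = 0 := hρs hρ.1
  have h2 := (mul_eq_zero.1 h1).resolve_left (by simpa using hρ.1)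
  exact measure_eq_zero_iff_ae_notMem.1 h2

theorem circleMeanEReal_le_of_ae_le {V : ℂ → EReal} {z : ℂ} {ρ a : ℝ}
    (hle : ∀ᵐ θ ∂angleMeasure, V (circleMap z ρ θ) ≤ a) : circleMeanEReal V z ρ ≤ a := by
  unfold circleMeanEReal
  change ((laverage angleMeasure fun θ : ℝ => (V (circleMap z ρ θ)).toENNReal :
    ENNReal) : EReal) - ((laverage angleMeasure
      fun θ : ℝ => (-V (circleMap z ρ θ)).toENNReal : ENNReal) : EReal) ≤ a
  set p := laverage angleMeasure fun θ : ℝ => (V (circleMap z ρ θ)).toENNReal with hp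
  set n := laverage angleMeasure fun θ : ℝ => (-V (circleMap z ρ θ)).toENNReal with hn
  have hpi := Real.two_pi_pos
  have hune : ENNReal.ofReal (2 * Real.pi) ≠ 0 := by simpa using Real.pi_pos
  have hkey : p + ENNReal.ofReal (-a) ≤ n + ENNReal.ofReal a := by
    have e : ∀ (f : ℝ → ENNReal) (b : ENNReal), laverage angleMeasure f + b =
        (∫⁻ θ, (f θ + b) ∂angleMeasure) / ENNReal.ofReal (2 * Real.pi) := by
      intro f b
      rw [lintegral_add_right _ measurable_const, lintegral_const, angleMeasure_univ,
        ENNReal.add_div, ENNReal.mul_div_cancel_right hune ENNReal.ofReal_ne_top, laverage_eq,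
        angleMeasure_univ]
    rw [hp, hn, e, e]
    refine ENNReal.div_le_div_right (lintegral_mono_ae ?_) _
    filter_upwards [hle] with θ hθ using EReal.toENNReal_add_le_of_le hθ
  by_cases hnt : n = ⊤
  · rw [hnt]
    simp
  have hpt : p ≠ ⊤ := by
    intro hpt
    rw [hpt, top_add, top_le_iff, ENNReal.add_eq_top] at hkey
    rcases hkey with h2 | h2
    · exact hnt h2
    · exact ENNReal.ofReal_ne_top h2
  lift n to NNReal using hnt with n'
  lift p to NNReal using hpt with p'
  change ((p' : ℝ) : EReal) - ((n' : ℝ) : EReal) ≤ a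
  have h3 : (p' : ℝ) - n' ≤ a := by
    have h4 := ENNReal.toReal_mono (by simp) hkey
    rw [ENNReal.toReal_add (by simp) (by simp), ENNReal.toReal_add (by simp) (by simp)] at h4
    simp only [ENNReal.coe_toReal, ENNReal.toReal_ofReal'] at h4
    rcases le_total 0 a with ha | ha
    · rw [max_eq_left ha, max_eq_right (by linarith)] at h4
      linarith
    · rw [max_eq_right ha, max_eq_left (by linarith)] at h4
      linarith
  exact_mod_cast h3

namespace IsSubharmonic

variable {V : ℂ → EReal} {Ω : Opens ℂ}

/-- A subharmonic function is bounded at a point by its essential upper bound near this point. -/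
theorem le_of_ae_le (h : IsSubharmonic V Ω) {z : ℂ} (hz : z ∈ Ω) {a : ℝ} {r : ℝ} (hr : 0 < r)
    (hae : ∀ᵐ w, w ∈ Metric.ball z r → V w ≤ a) : V z ≤ a := by
  obtain ⟨ρ₀, hρ₀, hρΩ⟩ := Metric.nhds_basis_closedBall.mem_iff.1 (Ω.isOpen.mem_nhds hz)
  obtain ⟨A, hA, hAm, hA0⟩ := exists_measurable_superset_of_null (ae_iff.1 hae)
  obtain ⟨ρ, hρ, hρA⟩ := exists_ae_circleMap_notMem hAm hA0 z (lt_min hr hρ₀)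
  refine (h.le_circleMean z ρ hρ.1 ((Metric.closedBall_subset_closedBall
    (hρ.2.le.trans (min_le_right _ _))).trans hρΩ)).trans (circleMeanEReal_le_of_ae_le ?_)
  filter_upwards [hρA] with θ hθ
  by_contra hn
  refine hθ (hA fun hcon => hn (hcon ?_))
  have := hρ.2.trans_le (min_le_left _ _)
  simpa [dist_eq_norm, circleMap, abs_of_pos hρ.1] using this

/-- A subharmonic function is locally integrable. -/
theorem exists_integrableOn_ball (h : IsSubharmonic V Ω) {z : ℂ} (hz : z ∈ Ω) :
    ∃ r > 0, Metric.closedBall z r ⊆ (Ω : Set ℂ) ∧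
      IntegrableOn (fun z => (V z).toReal) (Metric.ball z r) ∧
      ∀ᵐ w, w ∈ Metric.ball z r → V w ≠ ⊥ := by
  -- `G` is the union of the discs centred at points where `V` is finite. Since `V` is finite almost
  -- everywhere in such discs, a limit point of `G` in `Ω` has a finite point close enough to serve
  -- as a centre. So `G` is relatively open and closed and fills the component.
  let G : Set ℂ := {z | ∃ w r, V w ≠ ⊥ ∧ Metric.closedBall w r ⊆ (Ω : Set ℂ) ∧
    z ∈ Metric.ball w r}
  have hGo : IsOpen G := by
    refine isOpen_iff_mem_nhds.2 ?_
    rintro x ⟨w, r, h1, h2, h3⟩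
    filter_upwards [Metric.isOpen_ball.mem_nhds h3] with y hy using ⟨w, r, h1, h2, hy⟩
  have hpt : ∀ w ∈ Ω, V w ≠ ⊥ → w ∈ G := by
    intro w hw hne
    obtain ⟨r, hr, hrΩ⟩ := Metric.nhds_basis_closedBall.mem_iff.1 (Ω.isOpen.mem_nhds hw)
    exact ⟨w, r, hne, hrΩ, Metric.mem_ball_self hr⟩
  have hGc : closure G ∩ connectedComponentIn (Ω : Set ℂ) z ⊆ G := by
    rintro x ⟨hx, hxc⟩
    have hxΩ := connectedComponentIn_subset _ _ hxc
    obtain ⟨r, hr, hrΩ⟩ := Metric.nhds_basis_closedBall.mem_iff.1 (Ω.isOpen.mem_nhds hxΩ)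
    obtain ⟨g, ⟨w, ρ, hw, hwΩ, hgw⟩, hxg⟩ := Metric.mem_closure_iff.1 hx (r / 3) (by positivity)
    have hae := (h.integrableOn_ball_of_ne_bot hwΩ hw).2
    obtain ⟨y, ⟨hy1, hy2⟩, hy3⟩ := exists_of_eventually_nhds_of_ae (w := g)
      (Filter.Eventually.and (Metric.isOpen_ball.mem_nhds hgw : ∀ᶠ y in nhds g, y ∈ Metric.ball w ρ)
        (Metric.isOpen_ball.mem_nhds (by rwa [Metric.mem_ball, dist_comm]) :
          ∀ᶠ y in nhds g, y ∈ Metric.ball x (r / 3))) hae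
    have hyx : dist y x < r / 3 := hy2
    refine ⟨y, 2 * r / 3, hy3 hy1, fun v hv => hrΩ ?_, ?_⟩
    · have hv : dist v y ≤ 2 * r / 3 := hv
      have := dist_triangle v y x
      exact Metric.mem_closedBall.2 (by linarith)
    · rw [Metric.mem_ball, dist_comm]
      linarith
  obtain ⟨w₀, hw₀, hne⟩ := h.exists_ne_bot z hz
  have hsub := isPreconnected_connectedComponentIn.subset_of_closure_inter_subset hGo
    ⟨w₀, hw₀, hpt w₀ (connectedComponentIn_subset _ _ hw₀) hne⟩ hGc
  obtain ⟨w, r, hw, hwΩ, hzw⟩ := hsub (mem_connectedComponentIn hz)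
  obtain ⟨h1, h2⟩ := h.integrableOn_ball_of_ne_bot hwΩ hw
  obtain ⟨ρ, hρ, hρs⟩ := Metric.nhds_basis_closedBall.mem_iff.1 (Metric.isOpen_ball.mem_nhds hzw)
  have hb := Metric.ball_subset_closedBall.trans hρs
  exact ⟨ρ, hρ, hρs.trans (Metric.ball_subset_closedBall.trans hwΩ), h1.mono_set hb,
    h2.mono fun v hv hvb => hv (hb hvb)⟩

end IsSubharmonic

/-! ### Integration by parts and functions with holomorphic distribution derivative. -/

theorem integrable_mul_of_tsupport_subset {f ψ : ℂ → ℝ} {W : Set ℂ} (hW : IsOpen W)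
    (hf : ContinuousOn f W) (hψ : Continuous ψ) (hc : HasCompactSupport ψ) (hs : tsupport ψ ⊆ W) :
    Integrable fun z => f z * ψ z := by
  have h1 : Continuous fun z => f z * ψ z :=
    (hf.mul hψ.continuousOn).continuous_of_tsupport_subset hW
      ((tsupport_mul_subset_right (f := f) (g := ψ)).trans hs)
  exact h1.integrable_of_hasCompactSupport hc.mul_left

open scoped ContDiff in
/-- Integration by parts for the real part of a holomorphic function. -/
theorem integral_re_mul_fderiv {Φ Φ' : ℂ → ℂ} {W : Set ℂ} (hW : IsOpen W)
    (hΦ : ∀ z ∈ W, HasDerivAt Φ (Φ' z) z) (hΦ' : ContinuousOn Φ' W) {φ : ℂ → ℝ}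
    (hφ : ContDiff ℝ ∞ φ) (hc : HasCompactSupport φ) (hs : tsupport φ ⊆ W) (v : ℂ) :
    ∫ z, (Φ z).re * fderiv ℝ φ z v = -∫ z, φ z * (Φ' z * v).re := by
  have hφd : Differentiable ℝ φ := hφ.differentiable (by norm_num)
  have hre : ∀ z ∈ W, HasFDerivAt (fun z => (Φ z).re)
      (Complex.reCLM.comp ((ContinuousLinearMap.toSpanSingleton ℂ (Φ' z)).restrictScalars ℝ)) z :=
    fun z hz => Complex.reCLM.hasFDerivAt.comp z ((hΦ z hz).hasFDerivAt.restrictScalars ℝ)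
  have hprod : ∀ z, HasFDerivAt (fun z => (Φ z).re * φ z) ((Φ z).re • fderiv ℝ φ z +
      φ z • (Complex.reCLM.comp
        ((ContinuousLinearMap.toSpanSingleton ℂ (Φ' z)).restrictScalars ℝ))) z := by
    intro z
    by_cases hz : z ∈ tsupport φ
    · exact (hre z (hs hz)).mul (hφd z).hasFDerivAt
    · have h0 : φ =ᶠ[nhds z] 0 := notMem_tsupport_iff_eventuallyEq.1 hz
      have h1 : (fun z => (Φ z).re * φ z) =ᶠ[nhds z] fun _ => 0 := by
        filter_upwards [h0] with w hw
        simp [hw]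
      have h2 : fderiv ℝ φ z = 0 := by
        rw [h0.fderiv_eq]
        simp
      rw [h2, h0.eq_of_nhds]
      simpa using (hasFDerivAt_const (0 : ℝ) z).congr_of_eventuallyEq h1
  have hcont : ContinuousOn (fun z => (Φ z).re) W := fun z hz =>
    (hre z hz).continuousAt.continuousWithinAt
  have hi1 : Integrable fun z => (Φ z).re * fderiv ℝ φ z v := by
    refine integrable_mul_of_tsupport_subset hW hcont
      ((hφ.continuous_fderiv (by norm_num)).clm_apply continuous_const) (hc.fderiv_apply ℝ v) ?_
    exact (closure_mono (fun z hz => by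
      by_contra h
      have : φ =ᶠ[nhds z] 0 := notMem_tsupport_iff_eventuallyEq.1 h
      exact hz (by simp [this.fderiv_eq]))).trans ((isClosed_tsupport φ).closure_eq.subset.trans hs)
  have hi2 : Integrable fun z => (Φ' z * v).re * φ z :=
    integrable_mul_of_tsupport_subset hW
      (Complex.continuous_re.comp_continuousOn (hΦ'.mul continuousOn_const)) hφ.continuous hc hs
  have hf' : ∀ z, fderiv ℝ (fun z => (Φ z).re * φ z) z v =
      (Φ z).re * fderiv ℝ φ z v + (Φ' z * v).re * φ z := by
    intro z
    rw [(hprod z).fderiv]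
    simp [mul_comm, -Complex.mul_re]
  have h := integral_mul_fderiv_eq_neg_fderiv_mul_of_integrable (𝕜 := ℝ) (μ := volume)
    (f := fun z => (Φ z).re * φ z) (g := fun _ => (1 : ℝ)) (v := v)
    (by simp only [hf', mul_one]; exact hi1.add hi2) (by simp)
    (by simpa using integrable_mul_of_tsupport_subset hW hcont hφ.continuous hc hs)
    (fun z _ => (hprod z).differentiableAt) (by fun_prop)
  simp only [hf', mul_one] at h
  rw [integral_add hi1 hi2] at h
  simp only [mul_comm (φ _)]
  simp at h
  simp
  linarith

/-- A function which is integrable on the support of a continuous compactly supported function has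
integrable product with it. -/
theorem integrable_mul_of_integrableOn {f ψ : ℂ → ℝ} {B : Set ℂ}
    (hf : IntegrableOn f B) (hψ : Continuous ψ) (hc : HasCompactSupport ψ)
    (hs : ∀ z, z ∉ B → ψ z = 0) : Integrable fun z => f z * ψ z := by
  obtain ⟨A, hA⟩ := hc.exists_bound_of_continuous hψ
  have h1 : IntegrableOn (fun z => f z * ψ z) B :=
    hf.mul_bdd (c := A) hψ.aestronglyMeasurable (Filter.Eventually.of_forall hA)
  refine (integrableOn_iff_integrable_of_support_subset ?_).1 h1
  intro z hz
  by_contra h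
  exact hz (by simp [hs z h])

-- For real `V` the single complex equation `∂V/∂z = g` contains both partial derivatives in its
-- real and imaginary parts: the derivative in the direction `v` is `Re (2 g v)`.
open scoped ContDiff in
theorem HasDistribDz.integral_mul_fderiv {V : ℂ → EReal} {Ω : Opens ℂ} {g : ℂ → ℂ} {W : Set ℂ}
    (h : HasDistribDz V Ω g W) {p : ℂ} {r : ℝ} (hW : Metric.ball p r ⊆ W)
    (hΩ : Metric.ball p r ⊆ (Ω : Set ℂ)) (hg : ContinuousOn g (Metric.ball p r))
    (hV : IntegrableOn (fun z => (V z).toReal) (Metric.ball p r)) {φ : ℂ → ℝ}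
    (hφ : ContDiff ℝ ∞ φ) (hc : HasCompactSupport φ) (hs : tsupport φ ⊆ Metric.ball p r) (v : ℂ) :
    ∫ z, (V z).toReal * fderiv ℝ φ z v = -∫ z, φ z * (2 * g z * v).re := by
  have h0 := h ⟨φ, hφ, hc, hs.trans hΩ⟩ (hs.trans hW)
  change ∫ z, g z * (φ z : ℂ) = - ∫ z, ((V z).toReal : ℂ) * wirtingerDz φ z at h0
  have hi : ∀ v, Integrable fun z => (V z).toReal * fderiv ℝ φ z v := fun v => by
    refine integrable_mul_of_integrableOn hV
      ((hφ.continuous_fderiv (by norm_num)).clm_apply continuous_const) (hc.fderiv_apply ℝ v) ?_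
    intro z hz
    have : φ =ᶠ[nhds z] 0 := notMem_tsupport_iff_eventuallyEq.1 fun hz' => hz (hs hz')
    simp [this.fderiv_eq]
  have hgr := integrable_mul_of_tsupport_subset Metric.isOpen_ball
    (Complex.continuous_re.comp_continuousOn hg) hφ.continuous hc hs
  have hgi := integrable_mul_of_tsupport_subset Metric.isOpen_ball
    (Complex.continuous_im.comp_continuousOn hg) hφ.continuous hc hs
  simp only [Function.comp_apply] at hgr hgi
  have e1 : ∫ z, g z * (φ z : ℂ) =
      ((∫ z, (g z).re * φ z : ℝ) : ℂ) + Complex.I * ((∫ z, (g z).im * φ z : ℝ) : ℂ) := by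
    rw [← integral_complex_ofReal, ← integral_complex_ofReal, ← integral_const_mul,
      ← integral_add hgr.ofReal (hgi.ofReal.const_mul _)]
    refine integral_congr_ae (Filter.Eventually.of_forall fun z => ?_)
    apply Complex.ext <;> simp
  have e2 : ∫ z, ((V z).toReal : ℂ) * wirtingerDz φ z =
      (1 / 2 : ℂ) * ((∫ z, (V z).toReal * fderiv ℝ φ z 1 : ℝ) : ℂ) -
        (1 / 2 : ℂ) * Complex.I * ((∫ z, (V z).toReal * fderiv ℝ φ z Complex.I : ℝ) : ℂ) := by
    rw [← integral_complex_ofReal, ← integral_complex_ofReal, ← integral_const_mul,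
      ← integral_const_mul, ← integral_sub ((hi _).ofReal.const_mul _) ((hi _).ofReal.const_mul _)]
    refine integral_congr_ae (Filter.Eventually.of_forall fun z => ?_)
    simp only [wirtingerDz]
    push_cast
    ring
  rw [e1, e2] at h0
  have hr := congrArg Complex.re h0
  have him := congrArg Complex.im h0
  simp at hr him
  have e3 : ∫ z, (V z).toReal * fderiv ℝ φ z v = v.re * (∫ z, (V z).toReal * fderiv ℝ φ z 1) +
      v.im * ∫ z, (V z).toReal * fderiv ℝ φ z Complex.I := by
    rw [← integral_const_mul, ← integral_const_mul,
      ← integral_add ((hi _).const_mul _) ((hi _).const_mul _)]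
    refine integral_congr_ae (Filter.Eventually.of_forall fun z => ?_)
    simp only [apply_eq_re_im (fderiv ℝ φ z) v]
    ring
  have e4 : ∫ z, φ z * (2 * g z * v).re = 2 * v.re * (∫ z, (g z).re * φ z) -
      2 * v.im * ∫ z, (g z).im * φ z := by
    rw [← integral_const_mul, ← integral_const_mul,
      ← integral_sub (hgr.const_mul _) (hgi.const_mul _)]
    refine integral_congr_ae (Filter.Eventually.of_forall fun z => ?_)
    simp
    ring
  rw [e3, e4, hr, him]
  ring

namespace IsSubharmonic

variable {V : ℂ → EReal} {Ω : Opens ℂ}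

/-- A subharmonic function which agrees almost everywhere with a continuous function agrees with it
everywhere. -/
theorem eq_of_ae_eq (h : IsSubharmonic V Ω) {f : ℂ → ℝ} {z : ℂ} (hz : z ∈ Ω) {r : ℝ} (hr : 0 < r)
    (hf : ContinuousAt f z) (hae : ∀ᵐ w, w ∈ Metric.ball z r → V w = f w) : V z = f z := by
  refine le_antisymm ?_ ?_
  · refine EReal.le_of_forall_lt_iff_le.1 fun b hb => ?_
    have hb : f z < b := by exact_mod_cast hb
    obtain ⟨s, hs, hsb⟩ := Metric.eventually_nhds_iff_ball.1 (hf.eventually_lt_const hb)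
    refine h.le_of_ae_le hz (lt_min hr hs) ?_
    filter_upwards [hae] with w hw hwb
    rw [hw (Metric.ball_subset_ball (min_le_left _ _) hwb)]
    exact_mod_cast (hsb w (Metric.ball_subset_ball (min_le_right _ _) hwb)).le
  -- If `V z < b < f z`, upper semicontinuity of `V` and continuity of `f` give `V < b < f` on a
  -- whole neighbourhood.
  · by_contra hcon
    obtain ⟨b, hb1, hb2⟩ := EReal.lt_iff_exists_real_btwn.1 (not_le.1 hcon)
    have hb2 : b < f z := by exact_mod_cast hb2
    obtain ⟨w, ⟨⟨h1, h2⟩, h3⟩, h4⟩ := exists_of_eventually_nhds_of_ae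
      (((h.eventually_lt hz hb1).and (hf.eventually_const_lt hb2)).and
        (Metric.ball_mem_nhds z hr : ∀ᶠ w in nhds z, w ∈ Metric.ball z r)) hae
    rw [h4 h3] at h1
    have h1 : f w < b := by exact_mod_cast h1
    exact lt_asymm h1 h2

/-- Where the distribution derivative of a subharmonic function is holomorphic, the function is
locally the real part of a primitive. -/
theorem exists_eventually_eq_re (h : IsSubharmonic V Ω) {g Φ : ℂ → ℂ} {W : Set ℂ} (hW : IsOpen W)
    (hWΩ : W ⊆ (Ω : Set ℂ)) (hd : HasDistribDz V Ω g W)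
    (hΦ : ∀ z ∈ W, HasDerivAt Φ (2 * g z) z) (hg : ContinuousOn g W) {p : ℂ} (hp : p ∈ W) :
    ∃ c : ℝ, ∀ᶠ z in nhds p, V z = (((Φ z).re + c : ℝ) : EReal) := by
  obtain ⟨r₁, hr₁, -, hint, hbot⟩ := h.exists_integrableOn_ball (hWΩ hp)
  obtain ⟨r₂, hr₂, hrW⟩ := Metric.nhds_basis_closedBall.mem_iff.1 (hW.mem_nhds hp)
  set R := min r₁ r₂ with hR
  have hR0 : 0 < R := lt_min hr₁ hr₂
  have hB1 : Metric.ball p R ⊆ Metric.ball p r₁ := Metric.ball_subset_ball (min_le_left _ _)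
  have hB2 : Metric.ball p R ⊆ Metric.closedBall p r₂ :=
    (Metric.ball_subset_ball (min_le_right _ _)).trans Metric.ball_subset_closedBall
  have hBW := hB2.trans hrW
  have hΦc : ContinuousOn (fun z => (Φ z).re) W := fun z hz =>
    (Complex.continuous_re.continuousAt.comp (hΦ z hz).continuousAt).continuousWithinAt
  have hΦi : IntegrableOn (fun z => (Φ z).re) (Metric.ball p R) :=
    ((hΦc.mono hrW).integrableOn_compact (isCompact_closedBall p r₂)).mono_set hB2
  have hVi := hint.mono_set hB1
  -- The difference `V - Re Φ` has zero weak gradient, and Gronwall's inequality with `L = 0` says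
  -- that it is constant almost everywhere.
  obtain ⟨N, hN, hle⟩ := exists_null_le_exp_mul (f := fun z => (V z).toReal - (Φ z).re)
    (D := fun _ _ => 0) (L := 0) (half_lt_self hR0) (hVi.sub hΦi) (by simp) (by
      intro φ hφ hc hs v
      have e1 := hd.integral_mul_fderiv hBW (hBW.trans hWΩ) (hg.mono hBW) hVi hφ hc hs v
      have e2 := integral_re_mul_fderiv hW hΦ (continuousOn_const.mul hg) hφ hc (hs.trans hBW) v
      have hz0 : ∀ z, z ∉ Metric.ball p R → fderiv ℝ φ z v = 0 := fun z hz => by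
        have : φ =ᶠ[nhds z] 0 := notMem_tsupport_iff_eventuallyEq.1 fun hz' => hz (hs hz')
        simp [this.fderiv_eq]
      have hfc : Continuous fun z => fderiv ℝ φ z v :=
        (hφ.continuous_fderiv (by norm_num)).clm_apply continuous_const
      simp only [sub_mul]
      rw [integral_sub (integrable_mul_of_integrableOn hVi hfc
        (hc.fderiv_apply ℝ v) hz0) (integrable_mul_of_integrableOn hΦi hfc
        (hc.fderiv_apply ℝ v) hz0), e1, e2]
      simp)
  have hNae : ∀ᵐ z, z ∉ N := measure_eq_zero_iff_ae_notMem.1 hN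
  obtain ⟨q, hqb, hqN⟩ := exists_of_eventually_nhds_of_ae (w := p)
    (Metric.ball_mem_nhds p (half_pos hR0) : ∀ᶠ z in nhds p, z ∈ Metric.ball p (R / 2)) hNae
  set c := (V q).toReal - (Φ q).re with hc
  have hae : ∀ᵐ z, z ∈ Metric.ball p (R / 2) → V z = (((Φ z).re + c : ℝ) : EReal) := by
    filter_upwards [hNae, hbot] with z hz hzbot hzb
    have h1 := hle z hzb hz q hqb hqN
    have h2 := hle q hqb hqN z hzb hz
    have hzR := Metric.ball_subset_ball (half_le_self hR0.le) hzb
    simp only [zero_mul, Real.exp_zero, one_mul] at h1 h2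
    rw [← EReal.coe_toReal (h.ne_top z (hWΩ (hBW hzR))) (hzbot (hB1 hzR))]
    congr 1
    linarith
  refine ⟨c, ?_⟩
  filter_upwards [Metric.ball_mem_nhds p (half_pos hR0)] with z hz
  have hzW : z ∈ W := hBW (Metric.ball_subset_ball (half_le_self hR0.le) hz)
  obtain ⟨s, hs, hsb⟩ := Metric.isOpen_iff.1 Metric.isOpen_ball z hz
  exact h.eq_of_ae_eq (f := fun z => (Φ z).re + c) (hWΩ hzW) hs
    ((hΦc.continuousAt (hW.mem_nhds hzW)).add continuousAt_const)
    (hae.mono fun w hw hwb => hw (hsb hwb))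

end IsSubharmonic

/-! ### Lipschitz regularity by means of the exponential. -/

namespace IsSubharmonic

variable {V : ℂ → EReal} {Ω : Opens ℂ}

/-- The sub-mean value inequality in terms of the Bochner integral. -/
theorem toReal_le_integral (h : IsSubharmonic V Ω) {c : ℂ} {r : ℝ} (hr : 0 < r)
    (hcr : Metric.closedBall c r ⊆ (Ω : Set ℂ)) (hc : V c ≠ ⊥) :
    (∀ᵐ θ ∂angleMeasure, V (circleMap c r θ) ≠ ⊥) ∧
      Integrable (fun θ => (V (circleMap c r θ)).toReal) angleMeasure ∧
      2 * Real.pi * (V c).toReal ≤ ∫ θ, (V (circleMap c r θ)).toReal ∂angleMeasure := by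
  obtain ⟨M, hM, hVM⟩ := h.exists_le_real (isCompact_closedBall c r) hcr
  obtain ⟨W, hW, hWV⟩ := h.exists_measurable_eqOn
  have ha : ((V c).toReal : EReal) ≤ V c :=
    (EReal.coe_toReal (h.ne_top c (hcr (Metric.mem_closedBall_self hr.le))) hc).le
  have hneg := h.lintegral_neg_le hr hcr hM hVM ha
  have hmem : ∀ θ, circleMap c r θ ∈ Metric.closedBall c r := circleMap_mem_closedBall c hr.le
  have hVe : (fun θ => V (circleMap c r θ)) = fun θ => W (circleMap c r θ) :=
    funext fun θ => (hWV _ (hcr (hmem θ))).symm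
  have hVm : Measurable fun θ => V (circleMap c r θ) := by
    rw [hVe]
    exact hW.comp (continuous_circleMap c r).measurable
  have hNm : Measurable fun θ => (-V (circleMap c r θ)).toENNReal :=
    measurable_ereal_toENNReal.comp hVm.neg
  have hPm : Measurable fun θ => (V (circleMap c r θ)).toENNReal :=
    measurable_ereal_toENNReal.comp hVm
  have hNfin : ∫⁻ θ, (-V (circleMap c r θ)).toENNReal ∂angleMeasure ≠ ⊤ :=
    ne_top_of_le_ne_top ENNReal.ofReal_ne_top hneg
  have hPfin : ∫⁻ θ, (V (circleMap c r θ)).toENNReal ∂angleMeasure ≠ ⊤ := by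
    refine ne_top_of_le_ne_top (b := ENNReal.ofReal M * ENNReal.ofReal (2 * Real.pi))
      (ENNReal.mul_ne_top ENNReal.ofReal_ne_top ENNReal.ofReal_ne_top) ?_
    rw [← angleMeasure_univ, ← lintegral_const]
    refine lintegral_mono fun θ => ?_
    simpa using EReal.toENNReal_le_toENNReal (hVM _ (hmem θ))
  have hbot : ∀ᵐ θ ∂angleMeasure, V (circleMap c r θ) ≠ ⊥ := by
    filter_upwards [ae_lt_top hNm hNfin] with θ hθ hb
    simp [hb] at hθ
  have htop : ∀ θ, V (circleMap c r θ) ≠ ⊤ := fun θ => h.ne_top _ (hcr (hmem θ))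
  have eP : ∀ᵐ θ ∂angleMeasure, ENNReal.ofReal (V (circleMap c r θ)).toReal =
      (V (circleMap c r θ)).toENNReal := Filter.Eventually.of_forall fun θ => by
    rw [EReal.toENNReal_of_ne_top (htop θ)]
  have eN : ∀ᵐ θ ∂angleMeasure, ENNReal.ofReal (-(V (circleMap c r θ)).toReal) =
      (-V (circleMap c r θ)).toENNReal := by
    filter_upwards [hbot] with θ hθ
    rw [EReal.toENNReal_of_ne_top (by simpa using hθ), EReal.toReal_neg_eq]
  have hrm : Measurable fun θ => (V (circleMap c r θ)).toReal := measurable_ereal_toReal.comp hVm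
  have hint : Integrable (fun θ => (V (circleMap c r θ)).toReal) angleMeasure := by
    refine ⟨hrm.aestronglyMeasurable, ?_⟩
    have hle : ∀ᵐ θ ∂angleMeasure, ‖(V (circleMap c r θ)).toReal‖ₑ ≤
        (V (circleMap c r θ)).toENNReal + (-V (circleMap c r θ)).toENNReal := by
      filter_upwards [eP, eN] with θ h1 h2
      rw [← h1, ← h2, Real.enorm_eq_ofReal_abs]
      rcases le_total 0 (V (circleMap c r θ)).toReal with hx | hx
      · rw [abs_of_nonneg hx]
        exact le_self_add
      · rw [abs_of_nonpos hx]
        exact le_add_self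
    refine (lintegral_mono_ae hle).trans_lt ?_
    rw [lintegral_add_left hPm]
    exact ENNReal.add_lt_top.2 ⟨hPfin.lt_top, hNfin.lt_top⟩
  refine ⟨hbot, hint, ?_⟩
  have h1 := ha.trans (h.le_circleMean c r hr hcr)
  unfold circleMeanEReal at h1
  change ((V c).toReal : EReal) ≤ ((laverage angleMeasure
    fun θ : ℝ => (V (circleMap c r θ)).toENNReal : ENNReal) : EReal) - ((laverage angleMeasure
      fun θ : ℝ => (-V (circleMap c r θ)).toENNReal : ENNReal) : EReal) at h1
  rw [laverage_eq, laverage_eq, angleMeasure_univ] at h1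
  rw [integral_eq_lintegral_pos_part_sub_lintegral_neg_part hint, lintegral_congr_ae eP,
    lintegral_congr_ae eN]
  lift (∫⁻ θ, (V (circleMap c r θ)).toENNReal ∂angleMeasure) to NNReal using hPfin with P
  lift (∫⁻ θ, (-V (circleMap c r θ)).toENNReal ∂angleMeasure) to NNReal using hNfin with N
  have hpi := Real.two_pi_pos
  have e : ∀ x : NNReal, (((x : ENNReal) / ENNReal.ofReal (2 * Real.pi) : ENNReal) : EReal) =
      ((x / (2 * Real.pi) : ℝ) : EReal) := by
    intro x
    rw [← ENNReal.ofReal_coe_nnreal, ← ENNReal.ofReal_div_of_pos hpi, EReal.coe_ennreal_ofReal,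
      max_eq_left (by positivity)]
  rw [e, e, ← EReal.coe_sub, EReal.coe_le_coe_iff, ← sub_div, le_div_iff₀ hpi] at h1
  simp only [ENNReal.coe_toReal]
  linarith

theorem toReal_le_circleAverage (h : IsSubharmonic V Ω) {c : ℂ} {r : ℝ} (hr : 0 < r)
    (hcr : Metric.closedBall c r ⊆ (Ω : Set ℂ)) (hc : V c ≠ ⊥) :
    (V c).toReal ≤ Real.circleAverage (fun z => (V z).toReal) c r := by
  rw [Real.circleAverage_def, intervalIntegral.integral_of_le Real.two_pi_pos.le, smul_eq_mul,
    inv_mul_eq_div, le_div_iff₀ Real.two_pi_pos, mul_comm]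
  exact (h.toReal_le_integral hr hcr hc).2.2

/-- The exponential of a subharmonic function is subharmonic. -/
theorem exp_le_circleAverage (h : IsSubharmonic V Ω) {c : ℂ} {r : ℝ} (hr : 0 < r)
    (hcr : Metric.closedBall c r ⊆ (Ω : Set ℂ)) {E : ℂ → ℝ} (hEm : Measurable E)
    (hE : ∀ z ∈ Metric.closedBall c r, E z = (V z).exp.toReal) :
    E c ≤ Real.circleAverage E c r := by
  have hE0 : ∀ θ, 0 ≤ E (circleMap c r θ) := fun θ => by
    rw [hE _ (circleMap_mem_closedBall c hr.le θ)]
    exact ENNReal.toReal_nonneg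
  rw [Real.circleAverage_def, intervalIntegral.integral_of_le Real.two_pi_pos.le, smul_eq_mul,
    inv_mul_eq_div, le_div_iff₀ Real.two_pi_pos]
  change E c * (2 * Real.pi) ≤ ∫ θ, E (circleMap c r θ) ∂angleMeasure
  have hcc := Metric.mem_closedBall_self (x := c) hr.le
  by_cases hc : V c = ⊥
  · rw [hE c hcc, hc]
    simpa using integral_nonneg (μ := angleMeasure) hE0
  obtain ⟨hbot, hint, hle⟩ := h.toReal_le_integral hr hcr hc
  obtain ⟨M, -, hVM⟩ := h.exists_le_real (isCompact_closedBall c r) hcr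
  set a := (V c).toReal with ha
  have hexp : ∀ z ∈ Metric.closedBall c r, V z ≠ ⊥ → E z = Real.exp (V z).toReal := by
    intro z hz hzb
    rw [hE z hz]
    have := EReal.coe_toReal (h.ne_top z (hcr hz)) hzb
    conv_lhs => rw [← this]
    rw [EReal.exp_coe, ENNReal.toReal_ofReal (Real.exp_pos _).le]
  have : IsFiniteMeasure angleMeasure := ⟨by rw [angleMeasure_univ]; exact ENNReal.ofReal_lt_top⟩
  have hEi : Integrable (fun θ => E (circleMap c r θ)) angleMeasure := by
    refine Integrable.of_bound
      (hEm.comp (continuous_circleMap c r).measurable).aestronglyMeasurable (Real.exp M) ?_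
    filter_upwards [hbot] with θ hθ
    have hm := circleMap_mem_closedBall c hr.le θ
    rw [Real.norm_of_nonneg (hE0 θ), hexp _ hm hθ, Real.exp_le_exp]
    exact EReal.toReal_le_toReal (hVM _ hm) hθ (EReal.coe_ne_top M)
  -- This is Jensen's inequality: the exponential lies above its tangent at `a`, and `V - a` has
  -- nonnegative mean over the circle.
  have hkey : ∫ θ, Real.exp a * (1 + ((V (circleMap c r θ)).toReal - a)) ∂angleMeasure ≤
      ∫ θ, E (circleMap c r θ) ∂angleMeasure := by
    refine integral_mono_ae (((integrable_const _).add
      (hint.sub (integrable_const _))).const_mul _) hEi ?_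
    filter_upwards [hbot] with θ hθ
    rw [hexp _ (circleMap_mem_closedBall c hr.le θ) hθ]
    set x := (V (circleMap c r θ)).toReal
    calc Real.exp a * (1 + (x - a)) ≤ Real.exp a * Real.exp (x - a) := by
          gcongr
          linarith [Real.add_one_le_exp (x - a)]
      _ = Real.exp x := by rw [← Real.exp_add]; congr 1; ring
  refine le_trans ?_ hkey
  have hi2 : Integrable (fun θ => (V (circleMap c r θ)).toReal - a) angleMeasure :=
    hint.sub (integrable_const _)
  rw [integral_const_mul, integral_add (integrable_const _) hi2,
    integral_sub hint (integrable_const _), integral_const, integral_const, Measure.real,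
    angleMeasure_univ, ENNReal.toReal_ofReal Real.two_pi_pos.le, hexp c hcc hc, smul_eq_mul,
    smul_eq_mul]
  gcongr
  linarith

/-- A subharmonic function which is Lipschitz off a null set is real-valued and Lipschitz. -/
theorem le_add_of_null (h : IsSubharmonic V Ω) {B : Set ℂ} (hB : IsOpen B) (hBΩ : B ⊆ (Ω : Set ℂ))
    {N : Set ℂ} (hN : volume N = 0) (hbot : ∀ z ∈ B, z ∉ N → V z ≠ ⊥) {L : ℝ}
    (hle : ∀ z ∈ B, z ∉ N → ∀ w ∈ B, w ∉ N → (V z).toReal ≤ (V w).toReal + L * ‖z - w‖) :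
    ∀ z ∈ B, V z ≠ ⊥ ∧ ∀ w ∈ B, (V z).toReal ≤ (V w).toReal + L * ‖z - w‖ := by
  have hNae : ∀ᵐ z, z ∉ N := measure_eq_zero_iff_ae_notMem.1 hN
  have hcoe : ∀ z ∈ B, z ∉ N → V z = (V z).toReal := fun z hz hzN =>
    (EReal.coe_toReal (h.ne_top z (hBΩ hz)) (hbot z hz hzN)).symm
  have hcont : ∀ w z : ℂ, Filter.Tendsto (fun x => L * ‖x - w‖) (nhds z) (nhds (L * ‖z - w‖)) :=
    fun w z => Continuous.tendsto (by fun_prop) z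
  -- At points of `N` the lower bound comes from upper semicontinuity, as good points are dense, and
  -- the upper bound `hup` from `le_of_ae_le`.
  have hlow : ∀ z ∈ B, ∀ w ∈ B, w ∉ N → (((V w).toReal - L * ‖z - w‖ : ℝ) : EReal) ≤ V z := by
    intro z hz w hw hwN
    by_contra hcon
    obtain ⟨b, hb1, hb2⟩ := EReal.lt_iff_exists_real_btwn.1 (not_le.1 hcon)
    have hb2 : b < (V w).toReal - L * ‖z - w‖ := by exact_mod_cast hb2
    have hev := (tendsto_const_nhds (x := (V w).toReal)).sub (hcont w z) |>.eventually_const_lt hb2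
    obtain ⟨x, ⟨⟨h1, h2⟩, h3⟩, h4⟩ := exists_of_eventually_nhds_of_ae
      (((h.eventually_lt (hBΩ hz) hb1).and hev).and (hB.mem_nhds hz : ∀ᶠ x in nhds z, x ∈ B)) hNae
    rw [hcoe x h3 h4] at h1
    have h1 : (V x).toReal < b := by exact_mod_cast h1
    have := hle w hw hwN x h3 h4
    rw [norm_sub_rev] at this
    linarith
  have hup : ∀ z ∈ B, ∀ w ∈ B, w ∉ N → V z ≤ (((V w).toReal + L * ‖z - w‖ : ℝ) : EReal) := by
    intro z hz w hw hwN
    refine EReal.le_of_forall_lt_iff_le.1 fun b hb => ?_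
    have hb : (V w).toReal + L * ‖z - w‖ < b := by exact_mod_cast hb
    have hev := (tendsto_const_nhds (x := (V w).toReal)).add (hcont w z) |>.eventually_lt_const hb
    obtain ⟨s, hs, hsb⟩ := Metric.eventually_nhds_iff_ball.1
      (hev.and (hB.mem_nhds hz : ∀ᶠ x in nhds z, x ∈ B))
    refine h.le_of_ae_le (hBΩ hz) hs ?_
    filter_upwards [hNae] with x hxN hx
    rw [hcoe x (hsb x hx).2 hxN]
    have h1 := (hsb x hx).1
    have h2 := hle x (hsb x hx).2 hxN w hw hwN
    exact_mod_cast h2.trans h1.le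
  have hne : ∀ z ∈ B, V z ≠ ⊥ := by
    intro z hz hzb
    obtain ⟨w, hw, hwN⟩ := exists_of_eventually_nhds_of_ae
      (hB.mem_nhds hz : ∀ᶠ x in nhds z, x ∈ B) hNae
    have := hlow z hz w hw hwN
    rw [hzb, le_bot_iff] at this
    exact EReal.coe_ne_bot _ this
  refine fun z hz => ⟨hne z hz, fun w hw => ?_⟩
  refine le_of_forall_pos_lt_add fun ε hε => ?_
  have hev : ∀ᶠ x in nhds w, L * ‖w - x‖ + L * ‖z - x‖ < L * ‖z - w‖ + ε := by
    have : Filter.Tendsto (fun x => L * ‖w - x‖ + L * ‖z - x‖) (nhds w)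
        (nhds (L * ‖w - w‖ + L * ‖z - w‖)) := Continuous.tendsto (by fun_prop) w
    refine this.eventually_lt_const ?_
    simpa using hε
  obtain ⟨x, ⟨h1, hxB⟩, hxN⟩ := exists_of_eventually_nhds_of_ae
    (hev.and (hB.mem_nhds hw : ∀ᶠ x in nhds w, x ∈ B)) hNae
  have h2 := hlow w hw x hxB hxN
  have h3 := hup z hz x hxB hxN
  rw [← EReal.coe_toReal (h.ne_top w (hBΩ hw)) (hne w hw), EReal.coe_le_coe_iff] at h2
  rw [← EReal.coe_toReal (h.ne_top z (hBΩ hz)) (hne z hz), EReal.coe_le_coe_iff] at h3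
  linarith

end IsSubharmonic

theorem EReal.toReal_exp {x : EReal} (h1 : x ≠ ⊥) (h2 : x ≠ ⊤) :
    x.exp.toReal = Real.exp x.toReal := by
  conv_lhs => rw [← EReal.coe_toReal h2 h1]
  rw [EReal.exp_coe, ENNReal.toReal_ofReal (Real.exp_pos _).le]

theorem exists_norm_deriv_le {ι : Type*} [Finite ι] {Φ : ι → ℂ → ℂ} {O : Set ℂ} (hO : IsOpen O)
    (hΦ : ∀ j, DifferentiableOn ℂ (Φ j) O) {K : Set ℂ} (hK : IsCompact K) (hKO : K ⊆ O) :
    ∃ L : ℝ, 0 ≤ L ∧ ∀ j, ∀ z ∈ K, ‖deriv (Φ j) z‖ ≤ L := by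
  have h1 : ∀ j, ∃ L, ∀ z ∈ K, ‖deriv (Φ j) z‖ ≤ L := fun j =>
    hK.exists_bound_of_continuousOn (((hΦ j).deriv hO).continuousOn.mono hKO)
  choose L hL using h1
  obtain ⟨M, hM⟩ := (Set.finite_range L).bddAbove
  exact ⟨max M 0, le_max_right _ _, fun j z hz =>
    (hL j z hz).trans ((hM ⟨j, rfl⟩).trans (le_max_left _ _))⟩

namespace IsSubharmonic

variable {V : ℂ → EReal} {Ω : Opens ℂ}

/-- A subharmonic function which almost everywhere locally agrees with one of finitely many real
parts of holomorphic functions up to a constant is real-valued and locally Lipschitz. -/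
theorem exists_isPiecewiseRe (h : IsSubharmonic V Ω) {ι : Type*} [Finite ι] {Φ : ι → ℂ → ℂ}
    {O : Set ℂ} (hO : IsOpen O) (hOΩ : O ⊆ (Ω : Set ℂ)) (hΦ : ∀ j, DifferentiableOn ℂ (Φ j) O)
    (hae : ∀ᵐ z, z ∈ O → ∃ j, ∃ c : ℝ, ∀ᶠ w in nhds z, V w = (((Φ j w).re + c : ℝ) : EReal))
    {p : ℂ} (hp : p ∈ O) :
    ∃ r > 0, Metric.ball p r ⊆ O ∧ (∀ z ∈ Metric.ball p r, V z ≠ ⊥) ∧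
      IsPiecewiseRe (Metric.ball p r) (fun z => (V z).toReal) Φ := by
  obtain ⟨r₁, hr₁, -, -, hbot⟩ := h.exists_integrableOn_ball (hOΩ hp)
  obtain ⟨r₂, hr₂, hrO⟩ := Metric.nhds_basis_closedBall.mem_iff.1 (hO.mem_nhds hp)
  set R := min r₁ r₂ with hR
  have hR0 : 0 < R := lt_min hr₁ hr₂
  have hB1 : Metric.ball p R ⊆ Metric.ball p r₁ := Metric.ball_subset_ball (min_le_left _ _)
  have hB2 : Metric.ball p R ⊆ Metric.closedBall p r₂ :=
    (Metric.ball_subset_ball (min_le_right _ _)).trans Metric.ball_subset_closedBall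
  have hBO := hB2.trans hrO
  obtain ⟨L, hL0, hL⟩ := exists_norm_deriv_le hO hΦ (isCompact_closedBall p r₂) hrO
  obtain ⟨M, -, hM⟩ := h.exists_le_real (isCompact_closedBall p r₂) (hrO.trans hOΩ)
  obtain ⟨W, hW, hWV⟩ := h.exists_measurable_eqOn
  -- Unlike `V`, its exponential is bounded, also where `V = ⊥`. Where `V = Re (Φ j) + c`, the
  -- gradient of `E` is at most `E * ‖deriv (Φ j)‖`, and the multiplicative Gronwall estimate for
  -- `E` becomes a Lipschitz estimate for `V`.
  let E : ℂ → ℝ := (Metric.ball p R).indicator fun z => (W z).exp.toReal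
  have hEm : Measurable E :=
    (ENNReal.measurable_toReal.comp (EReal.measurable_exp.comp hW)).indicator measurableSet_ball
  have hEB : ∀ z ∈ Metric.ball p R, E z = (V z).exp.toReal := fun z hz => by
    simp only [E]
    rw [Set.indicator_of_mem hz, hWV z (hOΩ (hBO hz))]
  have hE0 : ∀ z, 0 ≤ E z := fun z => Set.indicator_nonneg (fun _ _ => ENNReal.toReal_nonneg) z
  have hEM : ∀ z, E z ≤ Real.exp M := by
    intro z
    by_cases hz : z ∈ Metric.ball p R
    · rw [hEB z hz]
      have h1 := EReal.exp_monotone (hM z (hB2 hz))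
      rw [EReal.exp_coe] at h1
      have h2 := ENNReal.toReal_mono ENNReal.ofReal_ne_top h1
      rwa [ENNReal.toReal_ofReal (Real.exp_pos _).le] at h2
    · simp only [E]
      rw [Set.indicator_of_notMem hz]
      exact (Real.exp_pos _).le
  have hder : ∀ᵐ z, z ∈ Metric.ball p R → DifferentiableAt ℝ E z ∧ ‖fderiv ℝ E z‖ ≤ L * E z := by
    filter_upwards [hae] with z hz hzB
    obtain ⟨j, c, hjc⟩ := hz (hBO hzB)
    have hev : E =ᶠ[nhds z] fun w => Real.exp ((Φ j w).re + c) := by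
      filter_upwards [hjc, Metric.isOpen_ball.mem_nhds hzB] with w hw hwB
      rw [hEB w hwB, hw, EReal.exp_coe, ENNReal.toReal_ofReal (Real.exp_pos _).le]
    have hd := ((hΦ j).differentiableAt (hO.mem_nhds (hBO hzB))).hasDerivAt
    have hre : HasFDerivAt (fun w => (Φ j w).re + c) (Complex.reCLM.comp
        ((ContinuousLinearMap.toSpanSingleton ℂ (deriv (Φ j) z)).restrictScalars ℝ)) z :=
      (Complex.reCLM.hasFDerivAt.comp z (hd.hasFDerivAt.restrictScalars ℝ)).add_const c
    have hE' := hre.exp.congr_of_eventuallyEq hev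
    refine ⟨hE'.differentiableAt, ?_⟩
    rw [hE'.fderiv, ← hev.eq_of_nhds, norm_smul, Real.norm_of_nonneg (hE0 z), mul_comm]
    refine mul_le_mul_of_nonneg_right ?_ (hE0 z)
    refine ContinuousLinearMap.opNorm_le_bound _ hL0 fun v => ?_
    calc ‖(Complex.reCLM.comp ((ContinuousLinearMap.toSpanSingleton ℂ
          (deriv (Φ j) z)).restrictScalars ℝ)) v‖ = |(v * deriv (Φ j) z).re| := by simp
      _ ≤ ‖v * deriv (Φ j) z‖ := Complex.abs_re_le_norm _
      _ = ‖deriv (Φ j) z‖ * ‖v‖ := by rw [norm_mul, mul_comm]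
      _ ≤ L * ‖v‖ := by
        gcongr
        exact hL j z (hB2 hzB)
  have hsub : ∀ c r, 0 < r → Metric.closedBall c r ⊆ Metric.ball p R →
      E c ≤ Real.circleAverage E c r := fun c r hr hcr =>
    h.exp_le_circleAverage hr (hcr.trans (hBO.trans hOΩ)) hEm fun z hz => hEB z (hcr hz)
  have hEi : IntegrableOn E (Metric.ball p R) :=
    Measure.integrableOn_of_bounded measure_ball_lt_top.ne hEm.aestronglyMeasurable
      (Filter.Eventually.of_forall fun z => by rw [Real.norm_of_nonneg (hE0 z)]; exact hEM z)
  obtain ⟨N, hN, hle⟩ := exists_null_le_exp_mul (f := E) (D := fun v z => fderiv ℝ E z v) (L := L)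
    (half_lt_self hR0) hEi (fun v => by
      filter_upwards [hder] with z hz hzB
      calc |fderiv ℝ E z v| ≤ ‖fderiv ℝ E z‖ * ‖v‖ := (fderiv ℝ E z).le_opNorm v
        _ ≤ L * E z * ‖v‖ := by
          gcongr
          exact (hz hzB).2
        _ = L * ‖v‖ * E z := by ring)
    (fun φ hφ hc hs v => integral_mul_fderiv_eq_neg hEm hE0 hEM hsub
      (mul_nonneg hL0 (Real.exp_pos M).le) (by
        filter_upwards [hder] with z hz hzB
        exact ⟨(hz hzB).1, (hz hzB).2.trans (by gcongr; exact hEM z)⟩) hφ hc hs v)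
  have hrB : Metric.ball p (R / 2) ⊆ Metric.ball p R :=
    Metric.ball_subset_ball (half_le_self hR0.le)
  have hrΩ : Metric.ball p (R / 2) ⊆ (Ω : Set ℂ) := hrB.trans (hBO.trans hOΩ)
  have hN' : volume (N ∪ {z | ¬ (z ∈ Metric.ball p r₁ → V z ≠ ⊥)}) = 0 :=
    measure_union_null hN (ae_iff.1 hbot)
  have hbot' : ∀ z ∈ Metric.ball p (R / 2), z ∉ N ∪ {z | ¬ (z ∈ Metric.ball p r₁ → V z ≠ ⊥)} →
      V z ≠ ⊥ := fun z hz hzN => by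
    by_contra hcon
    exact hzN (Or.inr fun hcon' => hcon' (hB1 (hrB hz)) hcon)
  have hmain := h.le_add_of_null Metric.isOpen_ball hrΩ hN' hbot' (L := L) (by
    intro z hz hzN w hw hwN
    have h1 := hle z hz (fun hn => hzN (Or.inl hn)) w hw fun hn => hwN (Or.inl hn)
    rw [hEB z (hrB hz), hEB w (hrB hw),
      EReal.toReal_exp (hbot' z hz hzN) (h.ne_top z (hrΩ hz)),
      EReal.toReal_exp (hbot' w hw hwN) (h.ne_top w (hrΩ hw)), ← Real.exp_add,
      Real.exp_le_exp] at h1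
    linarith)
  refine ⟨R / 2, half_pos hR0, hrB.trans hBO, fun z hz => (hmain z hz).1, Metric.isOpen_ball,
    ⟨L.toNNReal, LipschitzOnWith.of_dist_le_mul fun z hz w hw => ?_⟩, fun c r hr hcr => ?_,
    fun j => (hΦ j).mono (hrB.trans hBO), ?_⟩
  · rw [Real.coe_toNNReal _ hL0, Real.dist_eq, dist_eq_norm]
    have h1 := (hmain z hz).2 w hw
    have h2 := (hmain w hw).2 z hz
    rw [norm_sub_rev] at h2
    exact abs_le.2 ⟨by linarith, by linarith⟩
  · exact h.toReal_le_circleAverage hr (hcr.trans hrΩ)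
      (hmain c (hcr (Metric.mem_closedBall_self hr.le))).1
  · refine measure_mono_null ?_ (ae_iff.1 hae)
    rintro z ⟨hz, hno⟩ hcon
    obtain ⟨j, c, hjc⟩ := hcon (hBO (hrB hz))
    refine hno j c ?_
    filter_upwards [hjc] with w hw
    rw [hw, EReal.toReal_coe]

end IsSubharmonic

/-! ### Localization and conclusion. -/

/-- The support of the Laplacian is a local notion. -/
theorem suppLaplacian_of_le (V : ℂ → EReal) {U Ω : Opens ℂ} (hU : U ≤ Ω) :
    suppLaplacian V U = (U : Set ℂ) ∩ suppLaplacian V Ω := by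
  have key : ∀ z ∈ U, z ∉ Distribution.dsupport (distribLaplacian V U) ↔
      z ∉ Distribution.dsupport (distribLaplacian V Ω) := by
    intro z hz
    rw [Distribution.notMem_dsupport_iff, Distribution.notMem_dsupport_iff]
    constructor
    · rintro ⟨s, hs, hso, hzs⟩
      refine ⟨s ∩ U, fun φ hφ => ?_, hso.inter U.isOpen, hzs, hz⟩
      exact hs ⟨φ, φ.contDiff, φ.hasCompactSupport, hφ.trans Set.inter_subset_right⟩
        (hφ.trans Set.inter_subset_left)
    · rintro ⟨s, hs, hso, hzs⟩
      refine ⟨s, fun φ hφ => ?_, hso, hzs⟩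
      exact hs ⟨φ, φ.contDiff, φ.hasCompactSupport, φ.tsupport_subset.trans hU⟩ hφ
  ext z
  simp only [suppLaplacian, Set.mem_inter_iff]
  constructor
  · rintro ⟨h1, h2⟩
    exact ⟨h1, hU h1, not_not.1 fun h => (key z h1).2 h h2⟩
  · rintro ⟨h1, -, h2⟩
    exact ⟨h1, not_not.1 fun h => (key z h1).1 h h2⟩

theorem isOpen_diff_suppLaplacian (V : ℂ → EReal) (Ω : Opens ℂ) :
    IsOpen ((Ω : Set ℂ) \ suppLaplacian V Ω) := by
  rw [suppLaplacian, Set.sdiff_self_inter]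
  exact Ω.isOpen.sdiff Distribution.isClosed_dsupport

theorem HasDistribDz.mono {V : ℂ → EReal} {Ω : Opens ℂ} {g : ℂ → ℂ} {W W' : Set ℂ}
    (h : HasDistribDz V Ω g W) (hW : W' ⊆ W) : HasDistribDz V Ω g W' :=
  fun φ hφ => h φ (hφ.trans hW)

/-- By the Cauchy–Riemann equations taking real parts halves the derivative, whence the factor `2`
in the choice of primitives. -/
theorem wirtingerDz_re {Φ : ℂ → ℂ} {a z : ℂ} (h : HasDerivAt Φ (2 * a) z) :
    wirtingerDz (fun z => (Φ z).re) z = a := by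
  have h1 : HasFDerivAt (fun z => (Φ z).re) (Complex.reCLM.comp
      ((ContinuousLinearMap.toSpanSingleton ℂ (2 * a)).restrictScalars ℝ)) z :=
    Complex.reCLM.hasFDerivAt.comp z (h.hasFDerivAt.restrictScalars ℝ)
  rw [wirtingerDz, h1.fderiv]
  apply Complex.ext <;> simp

theorem IsPiecewiseHarmonic.comp_equiv {ι κ : Type*} [Finite ι] [Finite κ] {V : ℂ → EReal}
    {Ω : Opens ℂ} {H : ι → ℂ → ℝ} (h : IsPiecewiseHarmonic V Ω H) (e : κ ≃ ι) :
    IsPiecewiseHarmonic V Ω fun k => H (e k) where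
  isSH0 := h.isSH0
  harmonic k := h.harmonic (e k)
  exists_eq z hz := by
    obtain ⟨j, hj⟩ := h.exists_eq z hz
    exact ⟨e.symm j, by simpa using hj⟩

namespace IsPiecewiseHolomorphicDz

variable {ι : Type*} {V : ℂ → EReal} {Ω U : Opens ℂ} {g Φ : ι → ℂ → ℂ}

theorem exists_forall_eventually_eq (hg : IsPiecewiseHolomorphicDz V Ω g)
    (hV : IsSubharmonic V Ω) (hΦ : ∀ i, ∀ z ∈ U, HasDerivAt (Φ i) (2 * g i z) z)
    {z : ℂ} (hz : z ∈ (Ω : Set ℂ) \ suppLaplacian V Ω) :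
    ∃ j, ∀ w ∈ connectedComponentIn ((Ω : Set ℂ) \ suppLaplacian V Ω) z, w ∈ U →
      ∃ c : ℝ, ∀ᶠ x in nhds w, V x = (((Φ j x).re + c : ℝ) : EReal) := by
  obtain ⟨j, hj⟩ := hg.exists_eq z hz
  refine ⟨j, fun w hw hwU => ?_⟩
  have hC := (isOpen_diff_suppLaplacian V Ω).connectedComponentIn (x := z)
  have hCΩ : connectedComponentIn ((Ω : Set ℂ) \ suppLaplacian V Ω) z ⊆ (Ω : Set ℂ) :=
    (connectedComponentIn_subset _ _).trans Set.sdiff_subset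
  refine hV.exists_eventually_eq_re (hC.inter U.isOpen) (Set.inter_subset_left.trans hCΩ)
    (hj.mono Set.inter_subset_left) (fun x hx => hΦ j x hx.2) ?_ ⟨hw, hwU⟩
  exact ((hg.differentiableOn j).mono (Set.inter_subset_left.trans hCΩ)).continuousOn

/-- The constant is locally determined: if `c` and `c'` are valid on overlapping neighbourhoods,
evaluation at a common point gives `c = c'`. So the set where `c` is valid is open and relatively
closed in the connected component. -/
theorem exists_forall_eventually_eq_const (hg : IsPiecewiseHolomorphicDz V Ω g)
    (hV : IsSubharmonic V Ω) (hΦ : ∀ i, ∀ z ∈ U, HasDerivAt (Φ i) (2 * g i z) z) {U₀ : Opens ℂ}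
    (hU₀ : U₀ ≤ U) (hUΩ : U ≤ Ω) {z : ℂ} (hz : z ∈ (U₀ : Set ℂ) \ suppLaplacian V U₀) :
    ∃ j, ∃ c : ℝ, ∀ w ∈ connectedComponentIn ((U₀ : Set ℂ) \ suppLaplacian V U₀) z,
      ∀ᶠ x in nhds w, V x = (((Φ j x).re + c : ℝ) : EReal) := by
  have hsub : (U₀ : Set ℂ) \ suppLaplacian V U₀ ⊆ (Ω : Set ℂ) \ suppLaplacian V Ω := by
    rw [suppLaplacian_of_le V (hU₀.trans hUΩ)]
    exact fun x hx => ⟨hUΩ (hU₀ hx.1), fun h => hx.2 ⟨hx.1, h⟩⟩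
  obtain ⟨j, hj⟩ := hg.exists_forall_eventually_eq hV hΦ (hsub hz)
  set C := connectedComponentIn ((U₀ : Set ℂ) \ suppLaplacian V U₀) z with hCdef
  have hzC : z ∈ C := mem_connectedComponentIn hz
  have hloc : ∀ w ∈ C, ∃ c : ℝ, ∀ᶠ x in nhds w, V x = (((Φ j x).re + c : ℝ) : EReal) :=
    fun w hw => hj w (connectedComponentIn_mono z hsub hw)
      (hU₀ (connectedComponentIn_subset _ _ hw).1)
  obtain ⟨c, hc⟩ := hloc z hzC
  let G : Set ℂ := {w | ∀ᶠ x in nhds w, V x = (((Φ j x).re + c : ℝ) : EReal)}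
  have hGo : IsOpen G := isOpen_iff_mem_nhds.2 fun w hw => eventually_eventually_nhds.2 hw
  refine ⟨j, c, isPreconnected_connectedComponentIn.subset_of_closure_inter_subset hGo
    ⟨z, hzC, hc⟩ ?_⟩
  rintro x ⟨hxG, hxC⟩
  obtain ⟨c', hc'⟩ := hloc x hxC
  obtain ⟨y, hy1, hy2⟩ := mem_closure_iff_nhds.1 hxG _ hc'
  have hy1 : V y = (((Φ j y).re + c' : ℝ) : EReal) := hy1
  have hy2 : V y = (((Φ j y).re + c : ℝ) : EReal) := by
    have hyG : ∀ᶠ x in nhds y, V x = (((Φ j x).re + c : ℝ) : EReal) := hy2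
    exact hyG.self_of_nhds
  rw [hy1, EReal.coe_eq_coe_iff, add_right_inj] at hy2
  rwa [hy2] at hc'

theorem exists_isPiecewiseRe [Finite ι] (hg : IsPiecewiseHolomorphicDz V Ω g) (hV : IsSH0 V Ω)
    (hUΩ : U ≤ Ω) (hΦ : ∀ i, ∀ z ∈ U, HasDerivAt (Φ i) (2 * g i z) z) {p : ℂ} (hp : p ∈ U) :
    ∃ r > 0, Metric.ball p r ⊆ (U : Set ℂ) ∧ (∀ z ∈ Metric.ball p r, V z ≠ ⊥) ∧
      IsPiecewiseRe (Metric.ball p r) (fun z => (V z).toReal) Φ := by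
  refine hV.isSubharmonic.exists_isPiecewiseRe U.isOpen hUΩ
    (fun i z hz => (hΦ i z hz).differentiableAt.differentiableWithinAt) ?_ hp
  filter_upwards [measure_eq_zero_iff_ae_notMem.1 hV.volume_suppLaplacian] with z hz hzU
  obtain ⟨j, hj⟩ := hg.exists_forall_eventually_eq hV.isSubharmonic hΦ (z := z) ⟨hUΩ hzU, hz⟩
  exact ⟨j, hj z (mem_connectedComponentIn ⟨hUΩ hzU, hz⟩) hzU⟩

/-- Compactness reduces the claim to the local finiteness `exists_finite_const`, applied to each of
the finitely many branches. -/
theorem finite_const [Finite ι] (hg : IsPiecewiseHolomorphicDz V Ω g) (hV : IsSH0 V Ω)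
    (hUΩ : U ≤ Ω) (hΦ : ∀ i, ∀ z ∈ U, HasDerivAt (Φ i) (2 * g i z) z) {K : Set ℂ}
    (hK : IsCompact K) (hKU : K ⊆ (U : Set ℂ)) :
    {c | ∃ i, ∃ z ∈ K, AgreesNear (fun z => (V z).toReal) (Φ i) c z}.Finite := by
  refine hK.induction_on (p := fun s =>
    {c | ∃ i, ∃ z ∈ s, AgreesNear (fun z => (V z).toReal) (Φ i) c z}.Finite) (by simp) ?_ ?_ ?_
  · intro s t hst ht
    refine ht.subset ?_
    rintro c ⟨i, z, hz, hc⟩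
    exact ⟨i, z, hst hz, hc⟩
  · intro s t hs ht
    refine (hs.union ht).subset ?_
    rintro c ⟨i, z, hz | hz, hc⟩
    · exact Or.inl ⟨i, z, hz, hc⟩
    · exact Or.inr ⟨i, z, hz, hc⟩
  · intro p hp
    obtain ⟨r, hr, -, -, hpw⟩ := hg.exists_isPiecewiseRe hV hUΩ hΦ (hKU hp)
    choose ρ hρ hfin using fun i => hpw.exists_finite_const (Metric.mem_ball_self hr) i
    have hnhds : ⋂ i, Metric.ball p (ρ i) ∈ nhds p :=
      Filter.iInter_mem.2 fun i => Metric.ball_mem_nhds p (hρ i)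
    refine ⟨_, mem_nhdsWithin_of_mem_nhds hnhds, (Set.finite_iUnion hfin).subset ?_⟩
    rintro c ⟨i, z, hz, hc⟩
    exact Set.mem_iUnion.2 ⟨i, z, Set.mem_iInter.1 hz i, hc⟩

/-- For a smaller open set the condition of not being identically `-∞` on components has to be
checked anew; it holds because `V` is finite at every point of `U`. -/
theorem isSH0_of_le [Finite ι] (hg : IsPiecewiseHolomorphicDz V Ω g) (hV : IsSH0 V Ω)
    (hUΩ : U ≤ Ω) (hΦ : ∀ i, ∀ z ∈ U, HasDerivAt (Φ i) (2 * g i z) z) {U₀ : Opens ℂ}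
    (hU₀ : U₀ ≤ U) : IsSH0 V U₀ where
  isSubharmonic :=
    { upperSemicontinuousOn := hV.isSubharmonic.upperSemicontinuousOn.mono (hU₀.trans hUΩ)
      ne_top := fun z hz => hV.isSubharmonic.ne_top z (hUΩ (hU₀ hz))
      exists_ne_bot := fun z hz => by
        obtain ⟨r, hr, -, hbot, -⟩ := hg.exists_isPiecewiseRe hV hUΩ hΦ (hU₀ hz)
        exact ⟨z, mem_connectedComponentIn hz, hbot z (Metric.mem_ball_self hr)⟩
      le_circleMean := fun c r hr hcr =>
        hV.isSubharmonic.le_circleMean c r hr (hcr.trans (hU₀.trans hUΩ)) }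
  volume_suppLaplacian := by
    rw [suppLaplacian_of_le V (hU₀.trans hUΩ)]
    exact measure_mono_null Set.inter_subset_right hV.volume_suppLaplacian

/-- The constants are all those that occur on `closure U₀`, and every one is combined with every `Φ
i`. Stating the index set as a variable `S` with `S = Set.univ` lets the result apply to a coerced
`Finset.univ` without transport between index types. -/
theorem exists_isPiecewiseHarmonic [Finite ι] (hg : IsPiecewiseHolomorphicDz V Ω g)
    (hV : IsSH0 V Ω) (hUΩ : U ≤ Ω) (hΦ : ∀ i, ∀ z ∈ U, HasDerivAt (Φ i) (2 * g i z) z)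
    {U₀ : Opens ℂ} (hc : IsCompact (closure (U₀ : Set ℂ)))
    (hU₀ : closure (U₀ : Set ℂ) ⊆ (U : Set ℂ)) :
    ∃ (m : ℕ) (c : Fin m → ℝ), ∀ S : Set (ι × Fin m), S = Set.univ →
      IsPiecewiseHarmonic V U₀ (fun (p : S) (z : ℂ) => (Φ p.1.1 z).re + c p.1.2) := by
  have hle : U₀ ≤ U := subset_closure.trans hU₀
  have hfin := hg.finite_const hV hUΩ hΦ hc hU₀
  have : Finite {c | ∃ i, ∃ z ∈ closure (U₀ : Set ℂ),
    AgreesNear (fun z => (V z).toReal) (Φ i) c z} := hfin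
  obtain ⟨m, ⟨e⟩⟩ := Finite.exists_equiv_fin {c | ∃ i, ∃ z ∈ closure (U₀ : Set ℂ),
    AgreesNear (fun z => (V z).toReal) (Φ i) c z}
  refine ⟨m, fun ν => (e.symm ν : ℝ), ?_⟩
  rintro S rfl
  refine ⟨hg.isSH0_of_le hV hUΩ hΦ hle, fun p z hz => ?_, fun z hz => ?_⟩
  · have h1 : DifferentiableOn ℂ (fun z => Φ p.1.1 z + ((e.symm p.1.2 : ℝ) : ℂ)) U :=
      fun z hz => ((hΦ p.1.1 z hz).differentiableAt.add_const _).differentiableWithinAt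
    simpa using (h1.analyticAt (U.isOpen.mem_nhds (hle hz))).harmonicAt_re
  · obtain ⟨j, c, hjc⟩ := hg.exists_forall_eventually_eq_const hV.isSubharmonic hΦ hle hUΩ hz
    have hmem : c ∈ {c | ∃ i, ∃ z ∈ closure (U₀ : Set ℂ),
        AgreesNear (fun z => (V z).toReal) (Φ i) c z} := by
      refine ⟨j, z, subset_closure hz.1, ?_⟩
      filter_upwards [hjc z (mem_connectedComponentIn hz)] with x hx
      rw [hx, EReal.toReal_coe]
    refine ⟨⟨(j, e ⟨c, hmem⟩), Set.mem_univ _⟩, fun w hw => ?_⟩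
    simpa using (hjc w hw).self_of_nhds

end IsPiecewiseHolomorphicDz

theorem theorem1 (Ω : Opens ℂ) (V : ℂ → EReal) (hV : IsSH0 V Ω) (k : ℕ) (g : Fin k → ℂ → ℂ)
    (hg : IsPiecewiseHolomorphicDz V Ω g) :
    (∀ U : Opens ℂ, U ≤ Ω → IsSimplyConnected (U : Set ℂ) →
      ∃ H : Fin k → ℂ → ℝ,
        (∀ i, HarmonicOnNhd (H i) (U : Set ℂ) ∧ ∀ z ∈ U, wirtingerDz (H i) z = g i z) ∧
        ∀ U₀ : Opens ℂ, IsCompact (closure (U₀ : Set ℂ)) → closure (U₀ : Set ℂ) ⊆ (U : Set ℂ) →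
          ∃ (m : ℕ) (c : Fin m → ℝ) (S : Finset (Fin k × Fin m)),
            IsPiecewiseHarmonic V U₀ (fun (p : S) (z : ℂ) => H p.1.1 z + c p.1.2)) ∧
    (∀ z ∈ Ω, ∃ N : Opens ℂ, z ∈ N ∧ N ≤ Ω ∧
      ∃ (n : ℕ) (H : Fin n → ℂ → ℝ), IsPiecewiseHarmonic V N H) := by
  have main : ∀ U : Opens ℂ, U ≤ Ω → IsSimplyConnected (U : Set ℂ) →
      ∃ H : Fin k → ℂ → ℝ,
        (∀ i, HarmonicOnNhd (H i) (U : Set ℂ) ∧ ∀ z ∈ U, wirtingerDz (H i) z = g i z) ∧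
        ∀ U₀ : Opens ℂ, IsCompact (closure (U₀ : Set ℂ)) → closure (U₀ : Set ℂ) ⊆ (U : Set ℂ) →
          ∃ (m : ℕ) (c : Fin m → ℝ) (S : Finset (Fin k × Fin m)),
            IsPiecewiseHarmonic V U₀ (fun (p : S) (z : ℂ) => H p.1.1 z + c p.1.2) := by
    intro U hUΩ hU
    have h2g : ∀ i, DifferentiableOn ℂ (fun z => 2 * g i z) (U : Set ℂ) := fun i =>
      ((hg.differentiableOn i).mono hUΩ).const_mul 2
    choose Φ hΦ using fun i => exists_primitive_of_isSimplyConnected U.isOpen hU (h2g i)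
    have hΦd : ∀ i, DifferentiableOn ℂ (Φ i) U := fun i z hz =>
      (hΦ i z hz).differentiableAt.differentiableWithinAt
    refine ⟨fun i z => (Φ i z).re, fun i => ⟨fun z hz =>
      ((hΦd i).analyticAt (U.isOpen.mem_nhds hz)).harmonicAt_re,
      fun z hz => wirtingerDz_re (hΦ i z hz)⟩, fun U₀ hc hU₀ => ?_⟩
    obtain ⟨m, c, h⟩ := hg.exists_isPiecewiseHarmonic hV hUΩ hΦ hc hU₀
    exact ⟨m, c, Finset.univ, h (Finset.univ : Finset (Fin k × Fin m)) Finset.coe_univ⟩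
  refine ⟨main, fun z hz => ?_⟩
  obtain ⟨r, hr, hrΩ⟩ := Metric.isOpen_iff.1 Ω.isOpen z hz
  obtain ⟨H, -, h⟩ := main ⟨Metric.ball z r, Metric.isOpen_ball⟩ hrΩ
    (by
      have : ContractibleSpace (Metric.ball z r) :=
        (convex_ball z r).contractibleSpace ⟨z, Metric.mem_ball_self hr⟩
      exact SimplyConnectedSpace.ofContractible (Metric.ball z r))
  have hcl : closure (Metric.ball z (r / 2)) ⊆ Metric.closedBall z (r / 2) :=
    Metric.closure_ball_subset_closedBall
  obtain ⟨m, c, S, hS⟩ := h ⟨Metric.ball z (r / 2), Metric.isOpen_ball⟩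
    ((isCompact_closedBall z (r / 2)).of_isClosed_subset isClosed_closure hcl)
    (hcl.trans (Metric.closedBall_subset_ball (half_lt_self hr)))
  exact ⟨_, Metric.mem_ball_self (half_pos hr),
    (Metric.ball_subset_ball (half_le_self hr.le)).trans hrΩ, _, _,
    hS.comp_equiv S.equivFin.symm⟩
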